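/- Throughout, $\mathbb Z[X]$ is the group ring of a finite abelian group $X$ (written additively, with elements $A(x)=\sum_g a_g x^g$), $[1]=x^0$, $A(x^n)=\sum_g a_g x^{ng}$, $X(x)=\sum_{g\in X}x^g$, $D(x)=\sum_{g\in D}x^g$ and $D^{(n)}=\{ng: g\in D\}$ for $D\subset X$, and $\chi_0(A)=\sum_g a_g$. A subset $D\subset X$ is a generalized skew Hadamard difference set (GSHDS) with respect to a quadratic non-residue $n_0\in(\mathbb Z/\exp(X))^*$ if $D(x)D(x^{n_0})=(k_0-\lambda)[1]+\lambda X(x)$ for some integer $\lambda$, where $k_0=|D\cap D^{(-n_0)}|$, and $D(x)+D(x^{n_0})=X(x)-[1]$. Let $p$ be an odd prime, $\alpha\ge 1$, $q=p^{2\alpha+1}$, $H=(\mathbb Z/p^2)^{2\alpha+1}$, $G=\mathbb Z/p\times H$ and $L=pH$. Identify $H$ additively with the Galois ring $R=GR(p^2,2\alpha+1)=(\mathbb Z/p^2)[X]/(f)$, where $f$ is monic of degree $2\alpha+1$ and irreducible modulo $p$; let $\mathrm{Tr}:R\to\mathbb Z/p^2$ be the trace and let $\zeta\in\mathbb C$ be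 a primitive $p^2$-th root of unity. Let $l_1,\dots,l_r\in R$ be squares of elements $t$ with $t^{q-1}=1$ such that $pl_1,\dots,pl_r$ represent the orbits of $(\mathbb Z/p)^*$ on $L\setminus\{0\}$. Let $\mathbb Z/p\subset L$ be the subgroup generated by $p\cdot 1_R$ and $K=L/(\mathbb Z/p)$. For $x\in R$ put $\sigma(x)=\left(\frac np\right)$ if $\mathrm{Tr}(x)=np$, and $\sigma(x)=0$ if $p\nmid\mathrm{Tr}(x)$. For each $k\in K$ fix a representative $y_k\in L$, and define $$L_0(x)=\sum_{k\in K}\Big(\sum_i\sigma(l_i(1+y_k))\Big)x^k\in\mathbb Z[K].$$ For $D\subset G$ and $x\in R=H$ let $d(x)=1$ if $(0,x)\in D$ and $d(x)=-1$ otherwise. Let $\tau=\sum_{n\bmod p}\left(\frac np\right)\zeta^{pn}$ (a square root of $\left(\frac{-1}p\right)p$), let $\overline D$ be the set of characters $\chi$ of $G$ with $\sum_{g\in D}\chi(g)=\frac{-1+p^{2\alpha+1}\tau}2$, let $M_x$ be the set of characters of $G$ that restrict to $h\mapsto\zeta^{\mathrm{Tr}(xh)}$ on $H$, and let $\nu(x)=|\overline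 D\cap M_x|-|\overline D^{(n_0)}\cap M_x|$. Put $$A(x)=\sum_{k\in K}\Big(\sum_i d(l_i(1+y_k))\Big)x^k,\quad B(x)=\sum_{k\in K}\Big(\sum_i \nu(l_i(1+y_k))\Big)x^k,\quad a_0=\sum_i d(pl_i),\quad b_0=\sum_i\nu(pl_i).$$ Then choices of $f$, of the identification, of $\zeta$ and of $l_1,\dots,l_r$ as above exist, and for all such choices $K\cong(\mathbb Z/p)^{2\alpha}$ and: 1. $L_0(x)L_0(x^{-1})=p^{4\alpha-1}[1]-p^{2\alpha-1}K(x)$. There is $\varepsilon_0\in\{1,-1\}$ such that for every GSHDS $D$ in $G$ with respect to some $n_0$: 2. If $\alpha=1$, then $D\cap L$ is a GSHDS in $L$ (with respect to the same $n_0$). 3. $p^{2\alpha}A(x)=\chi_0(A)K(x)+L_0(x)B(x^{-1})$ with $\chi_0(A)=p^{\alpha-1}\varepsilon_0b_0$, and $p^{2\alpha}B(x)=\chi_0(B)K(x)+pL_0(x)A(x^{-1})$ with $\chi_0(B)=p^{\alpha}\varepsilon_0a_0$; the integers $a_0,b_0$ and all coefficients of $A$ and $B$ are odd. -/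

import Mathlib

noncomputable section

namespace GSHDS

/-- The element `∑ₓ f(x) [x]` of the integral group ring of a finite group. -/
def ofFun {X : Type*} [Finite X] (f : X → ℤ) : AddMonoidAlgebra ℤ X :=
  AddMonoidAlgebra.ofCoeff (Finsupp.equivFunOnFinite.symm f)

open Classical in
/-- The element `D(x) = ∑_{g ∈ D} x^g` attached to a subset `D`. -/
def ofSet {X : Type*} [Finite X] (D : Set X) : AddMonoidAlgebra ℤ X :=
  ofFun fun g => if g ∈ D then 1 else 0

/-- `A(x^n) = ∑_g a_g x^{n g}`. -/
def powMap {X : Type*} [AddCommGroup X] (n : ℤ) (A : AddMonoidAlgebra ℤ X) :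
    AddMonoidAlgebra ℤ X :=
  AddMonoidAlgebra.mapDomain (fun g => n • g) A

/-- The principal character `χ₀`: the sum of all coefficients. -/
def principal {X : Type*} (A : AddMonoidAlgebra ℤ X) : ℤ :=
  A.coeff.sum fun _ a => a

/-- `D` is a generalized skew Hadamard difference set in the finite abelian group `X`, with
respect to the quadratic non-residue `n₀` modulo `exp(X)`. -/
structure IsGSHDS {X : Type*} [AddCommGroup X] [Finite X] (n₀ : ℤ) (D : Set X) : Prop where
  isUnit : IsUnit (n₀ : ZMod (AddMonoid.exponent X))
  nonresidue : ¬ IsSquare (n₀ : ZMod (AddMonoid.exponent X))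
  /-- `D(x) D(x^{n₀}) = (k₀ - λ)[1] + λ X(x)` with `k₀ = |D ∩ D^{(-n₀)}|`. -/
  product : ∃ lam : ℤ, ofSet D * powMap n₀ (ofSet D) =
    (((D ∩ (fun g => (-n₀) • g) '' D).ncard : ℤ) - lam) • (1 : AddMonoidAlgebra ℤ X)
      + lam • ofSet Set.univ
  skew : ofSet D + powMap n₀ (ofSet D) = ofSet Set.univ - 1

/-- `H = (ℤ/p²)^{2α+1}`. -/
abbrev H (p α : ℕ) : Type := Fin (2 * α + 1) → ZMod (p ^ 2)

/-- `G = ℤ/p × H`. -/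
abbrev G (p α : ℕ) : Type := ZMod p × H p α

/-- `L = pH`. -/
abbrev L (p α : ℕ) : AddSubgroup (H p α) := (nsmulAddMonoidHom (α := H p α) p).range

/-- The auxiliary choices, all independent of any difference set: a presentation
`(ℤ/p²)[X]/(f)` of the Galois ring `GR(p², 2α+1)`, an additive identification `κ` of `H` with
it, a primitive `p²`-th root of unity `ζ`, and squares `l₁, …, l_r` of Teichmüller units such that
`p l₁, …, p l_r` represent the orbits of `(ℤ/p)ˣ` on the nonzero elements of `p GR`. -/
structure Frame (p α : ℕ) where
  f : Polynomial (ZMod (p ^ 2))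
  monic : f.Monic
  natDegree_eq : f.natDegree = 2 * α + 1
  irreducible_mod : Irreducible (f.map (ZMod.castHom (dvd_pow_self p two_ne_zero) (ZMod p)))
  κ : H p α ≃+ AdjoinRoot f
  ζ : ℂ
  primitive : IsPrimitiveRoot ζ (p ^ 2)
  S : Finset (AdjoinRoot f)
  square_teichmuller : ∀ l ∈ S, ∃ t : AdjoinRoot f, t ^ (p ^ (2 * α + 1) - 1) = 1 ∧ l = t ^ 2
  represent : ∀ z : AdjoinRoot f, (p : AdjoinRoot f) * z ≠ 0 →
    ∃! l, l ∈ S ∧ ∃ n : ℤ, (p : AdjoinRoot f) * z = n * (p * l)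

namespace Frame

variable {p α : ℕ} (F : Frame p α)

/-- The Galois ring `GR(p², 2α+1)`. -/
abbrev GR : Type := AdjoinRoot F.f

/-- The trace `GR(p², 2α+1) → ℤ/p²`. -/
def tr (x : F.GR) : ZMod (p ^ 2) := Algebra.trace (ZMod (p ^ 2)) F.GR x

/-- The copy of `ℤ/p` in `L`, generated by the element `p · 1` of the Galois ring. -/
def P : AddSubgroup (L p α) :=
  AddSubgroup.zmultiples ⟨F.κ.symm (p : F.GR), ⟨F.κ.symm 1, by
    rw [nsmulAddMonoidHom_apply, ← map_nsmul, nsmul_eq_mul, mul_one]⟩⟩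

/-- `K = L / (ℤ/p)`. -/
abbrev K : Type := L p α ⧸ F.P

/-- The Legendre symbol of `n` if `Tr x = n p` modulo `p²`, and `0` if `p ∤ Tr x`. -/
def sym [Fact p.Prime] (x : F.GR) : ℤ :=
  if p ∣ (F.tr x).val then legendreSym p (((F.tr x).val / p : ℕ) : ℤ) else 0

/-- The element `l (1 + y)` of the Galois ring, for `y` in `L = pH`; with `y = p l'` it is
`l (1 + p l')`. -/
def pt (l : F.GR) (y : L p α) : F.GR := l * (1 + F.κ (y : H p α))

/-- `L₀(x) = ∑_{k ∈ K} λ_k x^k`, where `λ_k = ∑_l sym (l (1 + y))` and `y ∈ L` represents `k`. -/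
def L₀ [Fact p.Prime] : AddMonoidAlgebra ℤ F.K :=
  ofFun fun k => ∑ l ∈ F.S, F.sym (F.pt l (Quotient.out k))

open Classical in
/-- The `±1`-valued function describing `D ∩ H`, as a function on the Galois ring. -/
def d (D : Set (G p α)) (x : F.GR) : ℤ :=
  if ((0 : ZMod p), F.κ.symm x) ∈ D then 1 else -1

/-- `A(x) = ∑_{k ∈ K} a_k x^k`, where `a_k = ∑_l d(l (1 + y))` and `y ∈ L` represents `k`. -/
def A [Fact p.Prime] (D : Set (G p α)) : AddMonoidAlgebra ℤ F.K :=
  ofFun fun k => ∑ l ∈ F.S, F.d D (F.pt l (Quotient.out k))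

/-- `a₀ = ∑_l d(p l)`. -/
def a₀ (D : Set (G p α)) : ℤ := ∑ l ∈ F.S, F.d D (p * l)

/-- The quadratic Gauss sum `∑_{n mod p} (n/p) ζ^{pn}`, a square root of `(-1/p) p`. -/
def gauss [Fact p.Prime] : ℂ :=
  ∑ n : ZMod p, (quadraticChar (ZMod p) n : ℂ) * F.ζ ^ (p * n.val)

/-- The dual set of `D`: the characters `χ` of `G` with `χ(D) = (-1 + √((-1/p) |G|)) / 2`, where
`|G| = p^{4α+3}` and the square root is `p^{2α+1}` times the Gauss sum. -/
def dual [Fact p.Prime] (D : Set (G p α)) : Set (AddChar (G p α) ℂ) :=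
  {χ | ∑ᶠ g ∈ D, χ g = (-1 + (p : ℂ) ^ (2 * α + 1) * F.gauss) / 2}

/-- The characters of `G` whose restriction to `H` is `h ↦ ζ^{Tr(x h)}`; these form a coset of the
group of characters of `G` trivial on `H`. -/
def fibre (x : F.GR) : Set (AddChar (G p α) ℂ) :=
  {χ | ∀ h : H p α, χ ((0 : ZMod p), h) = F.ζ ^ (F.tr (x * F.κ h)).val}

/-- The difference intersection number of the dual of `D` at the coset `fibre x`. -/
def ν [Fact p.Prime] (n₀ : ℤ) (D : Set (G p α)) (x : F.GR) : ℤ :=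
  ((F.dual D ∩ F.fibre x).ncard : ℤ)
    - (((fun χ : AddChar (G p α) ℂ => χ ^ n₀) '' F.dual D ∩ F.fibre x).ncard : ℤ)

/-- `B(x) = ∑_{k ∈ K} b_k x^k`, where `b_k = ∑_l ν(l (1 + y))` and `y ∈ L` represents `k`. -/
def B [Fact p.Prime] (n₀ : ℤ) (D : Set (G p α)) : AddMonoidAlgebra ℤ F.K :=
  ofFun fun k => ∑ l ∈ F.S, F.ν n₀ D (F.pt l (Quotient.out k))

/-- `b₀ = ∑_l ν(p l)`. -/
def b₀ [Fact p.Prime] (n₀ : ℤ) (D : Set (G p α)) : ℤ := ∑ l ∈ F.S, F.ν n₀ D (p * l)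

end Frame

end GSHDS

end

set_option linter.unusedSectionVars false

/-! ### Arithmetic of the Galois ring and its decomposition into orbits. -/

noncomputable section

namespace GSHDS

namespace Frame

variable {p α : ℕ} [Fact p.Prime] (F : Frame p α)

/-! Let `sgn D` be 1 on D, 0 at the identity and -1 elsewhere. At a nontrivial χ, the values χ(D)
and χ(D^(n₀)) have a fixed sum and a fixed product, so the transform 2χ(D)+1 of `sgn D` has a
constant square. Hence a Galois conjugation ζ ↦ ζ^r changes it only by a sign, two such conjugations
leave it alone, and Fourier inversion makes `sgn D` invariant under squares. Thus `sgn D` is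
homogeneous: multiplication by n prime to p multiplies it by (n/p) (`IsGSHDS.sgn_zsmul`). Averaging
over all characters fixes the square as (-1/p)|G| (`IsGSHDS.sgnHat_sq`), so D̄ and D̄^(n₀) are the
characters with value +√ and -√. Summing over the p extensions of a character of H isolates the
restriction e of `sgn D` to H. Writing τ for the quadratic Gauss sum, this says ê = p^{2α} τ ν and,
by inversion, ν̂ = p^{2α+1} τ e (`hat_e`, `hat_ν`).

For homogeneous f the additive character in f̂ can be averaged over the units of ℤ/p², which
replaces it by τ times the symbol σ (`hat_eq`). The ring splits into 0, the elements n p l, and the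
elements n l(1+y). Now S is closed under multiplication up to quadratic residues, (1+y)(1+y') =
1+y+y', and homogeneous functions do not see y modulo ℤ/p. Summed over S, the Fourier transform
therefore becomes a convolution over K with the coefficients of L₀, plus a constant involving c =
∑σ(pl) (`sum_hat_pt`). Applied to e and ν this gives both equations. Applied to translates of σ,
whose transforms are supported on one orbit, it gives c² = p^{2α} and the autocorrelation of L₀. The
sign ε₀ is that of c.

For α = 1, the transform of the restriction of e to L is τ w with w an integer function. On units w
is odd and divisible by p, so w² ≥ p²; Parseval gives mean exactly p². So w² is constant there, the
autocorrelation on L is -1 off the origin, and that characterizes D ∩ L as a GSHDS.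

Parity holds because |S| = (q-1)/(p-1) is odd and ν is a sum of p signs. -/

instance fintypeGR : Fintype F.GR := Fintype.ofEquiv (H p α) F.κ.toEquiv

lemma card_GR : Fintype.card F.GR = p ^ (4 * α + 2) := by
  rw [Fintype.card_congr F.κ.symm.toEquiv, Fintype.card_fun, ZMod.card, Fintype.card_fin, ← pow_mul]
  ring_nf

lemma natCast_sq_eq_zero : (p : F.GR) ^ 2 = 0 := by
  have : ((p ^ 2 : ℕ) : F.GR) = algebraMap (ZMod (p ^ 2)) F.GR ((p ^ 2 : ℕ) : ZMod (p ^ 2)) := by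
    rw [map_natCast]
  rw [← Nat.cast_pow, this, ZMod.natCast_self, map_zero]

end Frame

lemma natCast_mul_eq_zero_iff_exists {p : ℕ} [Fact p.Prime] (a : ZMod (p ^ 2)) :
    (p : ZMod (p ^ 2)) * a = 0 ↔ ∃ b : ZMod (p ^ 2), a = (p : ZMod (p ^ 2)) * b := by
  have hp : p ≠ 0 := (Fact.out : p.Prime).ne_zero
  constructor
  · intro h
    rw [← ZMod.natCast_zmod_val a, ← Nat.cast_mul, ZMod.natCast_eq_zero_iff] at h
    obtain ⟨b, hb⟩ := Nat.dvd_of_mul_dvd_mul_left (Nat.pos_of_ne_zero hp)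
      ((pow_two p).symm.dvd.trans h)
    refine ⟨b, ?_⟩
    rw [← ZMod.natCast_zmod_val a, hb, Nat.cast_mul]
  · rintro ⟨b, rfl⟩
    rw [← mul_assoc, ← pow_two, ← Nat.cast_pow, ZMod.natCast_self, zero_mul]

lemma nsmul_eq_zero_iff_mem_L {p α : ℕ} [Fact p.Prime] (x : H p α) : p • x = 0 ↔ x ∈ L p α := by
  constructor
  · intro h
    have h' : ∀ i, ∃ b : ZMod (p ^ 2), x i = (p : ZMod (p ^ 2)) * b := fun i => by
      rw [← natCast_mul_eq_zero_iff_exists, ← nsmul_eq_mul]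
      exact congrFun h i
    choose b hb using h'
    refine ⟨b, ?_⟩
    ext i
    simp [hb]
  · rintro ⟨b, rfl⟩
    ext i
    simpa using (natCast_mul_eq_zero_iff_exists _).2 ⟨b i, rfl⟩

/-- Multiplication by p on H has equal kernel and image, so |L|² = |H|. -/
lemma card_L (p α : ℕ) [Fact p.Prime] : Nat.card (L p α) = p ^ (2 * α + 1) := by
  have h1 : (nsmulAddMonoidHom (α := H p α) p).ker = L p α := by
    ext x
    rw [AddMonoidHom.mem_ker, nsmulAddMonoidHom_apply, nsmul_eq_zero_iff_mem_L]
  have h2 := AddSubgroup.card_mul_index (nsmulAddMonoidHom (α := H p α) p).ker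
  rw [AddSubgroup.index_ker, h1, Nat.card_eq_fintype_card (α := H p α), Fintype.card_fun, ZMod.card,
    Fintype.card_fin, ← pow_mul] at h2
  refine Nat.mul_self_inj.1 (h2.trans ?_)
  ring

namespace Frame

variable {p α : ℕ} [Fact p.Prime] (F : Frame p α)

/-- Only the additive group matters here, so the statement is transported from H, where it holds
coordinatewise. -/
lemma p_mul_eq_zero_iff (z : F.GR) : (p : F.GR) * z = 0 ↔ ∃ w, z = p * w := by
  have h : (p : F.GR) * z = 0 ↔ p • F.κ.symm z = 0 := by
    rw [← map_nsmul, nsmul_eq_mul, map_eq_zero_iff _ F.κ.symm.injective]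
  rw [h, nsmul_eq_zero_iff_mem_L]
  constructor
  · rintro ⟨w, hw⟩
    refine ⟨F.κ w, ?_⟩
    rw [← nsmul_eq_mul, ← map_nsmul, ← F.κ.apply_symm_apply z, ← hw]
    rfl
  · rintro ⟨w, rfl⟩
    refine ⟨F.κ.symm w, ?_⟩
    rw [nsmulAddMonoidHom_apply, ← map_nsmul, nsmul_eq_mul]

lemma κ_mem (y : L p α) : ∃ w, F.κ (y : H p α) = p * w := by
  obtain ⟨w, hw⟩ := y.2
  exact ⟨F.κ w, by rw [← hw, nsmulAddMonoidHom_apply, map_nsmul, nsmul_eq_mul]⟩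

/-- The element of `L` corresponding to `p w`. -/
def toL (w : F.GR) : L p α :=
  ⟨F.κ.symm (p * w), ⟨F.κ.symm w, by rw [nsmulAddMonoidHom_apply, ← map_nsmul, nsmul_eq_mul]⟩⟩

@[simp] lemma κ_toL (w : F.GR) : F.κ (F.toL w : H p α) = p * w := by simp [toL]

lemma p_mul_κ (y : L p α) : (p : F.GR) * F.κ (y : H p α) = 0 :=
  (F.p_mul_eq_zero_iff _).2 (F.κ_mem y)

lemma κ_mul_κ (y y' : L p α) : F.κ (y : H p α) * F.κ (y' : H p α) = 0 := by
  obtain ⟨w, hw⟩ := F.κ_mem y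
  rw [hw, mul_right_comm, F.p_mul_κ, zero_mul]

lemma intCast_eq_zero_iff (n : ℤ) : (n : F.GR) = 0 ↔ ((p ^ 2 : ℕ) : ℤ) ∣ n := by
  rw [← ZMod.intCast_zmod_eq_zero_iff_dvd]
  constructor
  · intro h
    have h1 : F.κ (n • (fun _ => 1 : H p α)) = 0 := by rw [map_zsmul, zsmul_eq_mul, h, zero_mul]
    have h2 := congrFun ((map_eq_zero_iff _ F.κ.injective).1 h1) 0
    simpa using h2
  · intro h
    have h1 : (n : F.GR) = algebraMap (ZMod (p ^ 2)) F.GR n := (map_intCast _ n).symm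
    rw [h1, h, map_zero]

lemma p_mul_intCast_eq_zero_iff (n : ℤ) : (p : F.GR) * n = 0 ↔ (p : ℤ) ∣ n := by
  have h := F.intCast_eq_zero_iff (p * n)
  push_cast at h
  rw [h, pow_two, mul_dvd_mul_iff_left]
  exact_mod_cast (Fact.out : p.Prime).ne_zero

lemma p_ne_zero : (p : F.GR) ≠ 0 := by
  intro h
  have := (F.p_mul_intCast_eq_zero_iff 1).1 (by rw [h, zero_mul])
  have h2 := Int.natAbs_dvd_natAbs.2 this
  simp only [Int.natAbs_natCast, Int.natAbs_one, Nat.dvd_one] at h2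
  exact (Fact.out : p.Prime).ne_one h2

lemma isUnit_intCast {n : ℤ} (hn : ¬ (p : ℤ) ∣ n) : IsUnit (n : F.GR) := by
  have h1 : IsCoprime ((p ^ 2 : ℕ) : ℤ) n := by
    push_cast
    exact ((Nat.prime_iff_prime_int.1 Fact.out).coprime_iff_not_dvd.2 hn).pow_left
  obtain ⟨a, b, h⟩ := h1
  have h2 := congrArg (Int.cast (R := F.GR)) h
  push_cast at h2
  rw [F.natCast_sq_eq_zero, mul_zero, zero_add] at h2
  exact .of_mul_eq_one_right _ h2

variable {F}

lemma pow_card_of_mem {l : F.GR} (hl : l ∈ F.S) : l ^ (p ^ (2 * α + 1) - 1) = 1 := by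
  obtain ⟨t, ht, rfl⟩ := F.square_teichmuller l hl
  rw [← pow_mul, mul_comm, pow_mul, ht, one_pow]

lemma two_le_card (p α : ℕ) [Fact p.Prime] : 2 ≤ p ^ (2 * α + 1) :=
  (Fact.out : p.Prime).two_le.trans (Nat.le_self_pow (by omega) p)

lemma isUnit_of_mem {l : F.GR} (hl : l ∈ F.S) : IsUnit l := by
  have h := two_le_card p α
  exact .of_pow_eq_one (pow_card_of_mem hl) (by omega)

lemma p_mul_ne_zero {l : F.GR} (hl : IsUnit l) : (p : F.GR) * l ≠ 0 := by
  rw [Ne, hl.mul_left_eq_zero]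
  exact F.p_ne_zero

lemma dvd_sub_of_p_mul_eq {l : F.GR} (hl : IsUnit l) {m n : ℤ}
    (h : (m : F.GR) * (p * l) = n * (p * l)) : (p : ℤ) ∣ m - n := by
  rw [← F.p_mul_intCast_eq_zero_iff, ← hl.mul_left_eq_zero]
  push_cast
  linear_combination h

lemma not_dvd_of_p_mul_eq {l : F.GR} {z : F.GR} (hz : (p : F.GR) * z ≠ 0) {n : ℤ}
    (h : (p : F.GR) * z = n * (p * l)) : ¬ (p : ℤ) ∣ n := by
  rw [← F.p_mul_intCast_eq_zero_iff]
  intro h'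
  apply hz
  rw [h, mul_left_comm, ← mul_assoc, h', zero_mul]

/-- This is the uniqueness half of `represent`: distinct elements of S lie in distinct orbits. -/
lemma eq_of_p_mul_eq {l l' : F.GR} (hl : l ∈ F.S) (hl' : l' ∈ F.S) {m n : ℤ}
    (hm : ¬ (p : ℤ) ∣ m) (h : (m : F.GR) * (p * l) = n * (p * l')) : l = l' := by
  have h1 : (p : F.GR) * (m * l) ≠ 0 := p_mul_ne_zero ((F.isUnit_intCast hm).mul (isUnit_of_mem hl))
  exact (F.represent _ h1).unique ⟨hl, m, by ring⟩ ⟨hl', n, by rw [← h]; ring⟩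

lemma not_dvd_of_mem_Ico {n : ℕ} (hn : n ∈ Finset.Ico 1 p) : ¬ (p : ℤ) ∣ (n : ℤ) := by
  rw [Int.natCast_dvd_natCast]
  rw [Finset.mem_Ico] at hn
  exact fun h => absurd (Nat.le_of_dvd (by omega) h) (by omega)

lemma eq_of_mem_Ico {m n : ℕ} (hm : m ∈ Finset.Ico 1 p) (hn : n ∈ Finset.Ico 1 p)
    (h : (p : ℤ) ∣ (m : ℤ) - n) : m = n := by
  rw [Finset.mem_Ico] at hm hn
  have h2 := Int.eq_zero_of_abs_lt_dvd h (by rw [abs_lt]; omega)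
  omega

lemma exists_rep {z : F.GR} (hz : (p : F.GR) * z ≠ 0) :
    ∃ n ∈ Finset.Ico 1 p, ∃ l ∈ F.S, (p : F.GR) * z = n * (p * l) := by
  obtain ⟨l, ⟨hl, n, hn⟩, -⟩ := F.represent z hz
  have hp : (0 : ℤ) < p := by exact_mod_cast (Fact.out : p.Prime).pos
  have h1 := not_dvd_of_p_mul_eq hz hn
  have h2 := Int.emod_nonneg n hp.ne'
  have h3 := Int.emod_lt_of_pos n hp
  have h4 : n % p ≠ 0 := fun h => h1 (Int.dvd_of_emod_eq_zero h)
  -- Since p² = 0, the element n p l depends only on n modulo p.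
  refine ⟨(n % p).toNat, by rw [Finset.mem_Ico]; omega, l, hl, ?_⟩
  have h5 : ((n % p).toNat : F.GR) = ((n % p : ℤ) : F.GR) := by
    rw [← Int.cast_natCast, Int.toNat_of_nonneg h2]
  rw [h5, hn]
  nth_rewrite 1 [← Int.emod_add_mul_ediv n p]
  push_cast
  linear_combination (((n / p : ℤ) : F.GR) * l) * F.natCast_sq_eq_zero

variable (F)

/-- The residue p x determines n and l. Then x - n l lies in pR, and dividing by the unit n l yields
the unique y. -/
lemma sum_isUnit_part {M : Type*} [AddCommMonoid M] (φ : F.GR → M) [DecidableEq F.GR] :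
    ∑ x with (p : F.GR) * x ≠ 0, φ x =
      ∑ n ∈ Finset.Ico 1 p, ∑ l ∈ F.S, ∑ y : L p α, φ (n * F.pt l y) := by
  rw [← Finset.sum_product', Finset.sum_congr rfl (fun x _ => rfl)]
  simp_rw [← Finset.sum_product (Finset.Ico 1 p ×ˢ F.S) Finset.univ
    (fun x => φ (x.1.1 * F.pt x.1.2 x.2))]
  symm
  have key : ∀ (n : ℕ) (l : F.GR) (y : L p α),
      (p : F.GR) * (n * F.pt l y) = ((n : ℤ) : F.GR) * (p * l) := fun n l y => by
    rw [pt]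
    push_cast
    linear_combination ((n : F.GR) * l) * F.p_mul_κ y
  refine Finset.sum_bij (fun x _ => (x.1.1 : F.GR) * F.pt x.1.2 x.2) ?_ ?_ ?_ ?_
  · rintro ⟨⟨n, l⟩, y⟩ h
    simp only [Finset.mem_product, Finset.mem_univ, and_true] at h
    rw [Finset.mem_filter]
    refine ⟨Finset.mem_univ _, ?_⟩
    rw [key, mul_left_comm]
    exact p_mul_ne_zero ((F.isUnit_intCast (not_dvd_of_mem_Ico h.1)).mul (isUnit_of_mem h.2))
  · rintro ⟨⟨n, l⟩, y⟩ h ⟨⟨n', l'⟩, y'⟩ h' heq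
    simp only [Finset.mem_product, Finset.mem_univ, and_true] at h h'
    dsimp only at heq
    have h1 := congrArg ((p : F.GR) * ·) heq
    rw [key, key] at h1
    obtain rfl : l = l' := eq_of_p_mul_eq h.2 h'.2 (not_dvd_of_mem_Ico h.1) h1
    obtain rfl : n = n' := eq_of_mem_Ico h.1 h'.1 (dvd_sub_of_p_mul_eq (isUnit_of_mem h.2) h1)
    have h2 : IsUnit (n : F.GR) := by
      have := F.isUnit_intCast (not_dvd_of_mem_Ico h.1)
      rwa [Int.cast_natCast] at this
    have h3 := (isUnit_of_mem h.2).mul_left_cancel (h2.mul_left_cancel heq)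
    have h4 : y = y' := Subtype.ext (F.κ.injective (add_left_cancel h3))
    rw [h4]
  · intro x hx
    rw [Finset.mem_filter] at hx
    obtain ⟨n, hn, l, hl, h⟩ := exists_rep hx.2
    have h2 : IsUnit (n : F.GR) := by
      have := F.isUnit_intCast (not_dvd_of_mem_Ico hn)
      rwa [Int.cast_natCast] at this
    obtain ⟨v, hv⟩ := (h2.mul (isUnit_of_mem hl)).exists_right_inv
    obtain ⟨w, hw⟩ := (F.p_mul_eq_zero_iff (x - n * l)).1 (by linear_combination h)
    -- Here x = n l + p w and v = (n l)⁻¹, so x = n l (1 + p w v).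
    refine ⟨⟨⟨n, l⟩, F.toL (w * v)⟩, by simp [hn, hl], ?_⟩
    simp only [pt, κ_toL]
    linear_combination (-1 : F.GR) * hw + (p * w) * hv
  · intros
    rfl

lemma sum_nilpotent_part {M : Type*} [AddCommMonoid M] (φ : F.GR → M) [DecidableEq F.GR] :
    ∑ x with (p : F.GR) * x = 0 ∧ x ≠ 0, φ x =
      ∑ n ∈ Finset.Ico 1 p, ∑ l ∈ F.S, φ (n * (p * l)) := by
  rw [← Finset.sum_product']
  symm
  refine Finset.sum_bij (fun x _ => (x.1 : F.GR) * (p * x.2)) ?_ ?_ ?_ ?_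
  · rintro ⟨n, l⟩ h
    simp only [Finset.mem_product] at h
    simp only [Finset.mem_filter, Finset.mem_univ, true_and]
    constructor
    · linear_combination ((n : F.GR) * l) * F.natCast_sq_eq_zero
    · rw [mul_left_comm]
      have := F.isUnit_intCast (not_dvd_of_mem_Ico h.1)
      rw [Int.cast_natCast] at this
      exact p_mul_ne_zero (this.mul (isUnit_of_mem h.2))
  · rintro ⟨n, l⟩ h ⟨n', l'⟩ h' heq
    simp only [Finset.mem_product] at h h'
    dsimp only at heq
    rw [← Int.cast_natCast, ← Int.cast_natCast n'] at heq
    obtain rfl : l = l' := eq_of_p_mul_eq h.2 h'.2 (not_dvd_of_mem_Ico h.1) heq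
    obtain rfl : n = n' := eq_of_mem_Ico h.1 h'.1 (dvd_sub_of_p_mul_eq (isUnit_of_mem h.2) heq)
    rfl
  · intro x hx
    rw [Finset.mem_filter] at hx
    obtain ⟨-, h1, h2⟩ := hx
    obtain ⟨z, rfl⟩ := (F.p_mul_eq_zero_iff x).1 h1
    obtain ⟨n, hn, l, hl, h⟩ := exists_rep h2
    exact ⟨(n, l), by simp [hn, hl], h.symm⟩
  · intros
    rfl

/-- Summation over the orbits of the integers prime to `p` on the Galois ring. -/
lemma sum_orbits {M : Type*} [Ring M] (φ : F.GR → M) (h0 : φ 0 = 0)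
    (hφ : ∀ (n : ℤ) (x : F.GR), ¬ (p : ℤ) ∣ n → φ (n * x) = φ x) :
    ∑ x, φ x = ((p : M) - 1) * (∑ l ∈ F.S, φ (p * l) + ∑ l ∈ F.S, ∑ y : L p α, φ (F.pt l y)) := by
  classical
  rw [← Finset.sum_filter_add_sum_filter_not Finset.univ (fun x => (p : F.GR) * x ≠ 0),
    F.sum_isUnit_part]
  have h1 : ∑ x with ¬ (p : F.GR) * x ≠ 0, φ x = ∑ x with (p : F.GR) * x = 0 ∧ x ≠ 0, φ x := by
    symm
    apply Finset.sum_subset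
    · intro x
      simp only [Finset.mem_filter, Finset.mem_univ, true_and]
      tauto
    · intro x
      simp only [Finset.mem_filter, Finset.mem_univ, true_and, not_and_or, not_not]
      rintro h (h' | rfl)
      · exact absurd h h'
      · exact h0
  rw [h1, F.sum_nilpotent_part]
  have h2 : ∀ n ∈ Finset.Ico 1 p, ∀ x, φ (n * x) = φ x := fun n hn x => by
    have := hφ n x (not_dvd_of_mem_Ico hn)
    rwa [Int.cast_natCast] at this
  rw [Finset.sum_congr rfl fun n hn => Finset.sum_congr rfl fun l _ => Finset.sum_congr rfl
    fun y _ => h2 n hn _, Finset.sum_congr (s₁ := Finset.Ico 1 p) (f := fun n =>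
    ∑ l ∈ F.S, φ (n * (p * l))) rfl fun n hn => Finset.sum_congr rfl fun l _ => h2 n hn _]
  have hp := (Fact.out : p.Prime).one_le
  simp only [Finset.sum_const, Nat.card_Ico, nsmul_eq_mul]
  rw [Nat.cast_sub hp, Nat.cast_one, mul_add, add_comm]

end Frame

/-! ### Multiplicative structure of the representatives. -/

/-- The quotient (q-1)/(p-1) = 1 + p + ⋯ + p^{2α} has an odd number of odd terms. This is where the
odd degree of the Galois ring enters. -/
lemma exists_odd_pow_eq {p : ℕ} (hp : Odd p) (α : ℕ) :
    ∃ j, Odd j ∧ p ^ (2 * α + 1) = (p - 1) * j + 1 := by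
  obtain ⟨r, rfl⟩ := hp
  induction α with
  | zero => exact ⟨1, odd_one, by simp⟩
  | succ n ih =>
    obtain ⟨j, hj, h⟩ := ih
    -- The next quotient is p² j + (p + 1), with p = 2r + 1.
    refine ⟨(2 * r + 1) ^ 2 * j + 2 * (r + 1), ?_, ?_⟩
    · exact (Odd.mul (Odd.pow ⟨r, rfl⟩) hj).add_even ⟨r + 1, by ring⟩
    · rw [show 2 * (n + 1) + 1 = 2 * n + 1 + 2 by ring, pow_add, h, Nat.add_sub_cancel]
      ring

lemma odd_of_ne_two {p : ℕ} [Fact p.Prime] (hp : p ≠ 2) : Odd p :=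
  (Fact.out : p.Prime).odd_of_ne_two hp

lemma legendreSym_eq_one_or_neg_one {p : ℕ} [Fact p.Prime] {n : ℤ} (hn : ¬ (p : ℤ) ∣ n) :
    legendreSym p n = 1 ∨ legendreSym p n = -1 :=
  legendreSym.eq_one_or_neg_one p (by rwa [Ne, ZMod.intCast_zmod_eq_zero_iff_dvd])

namespace Frame

variable {p α : ℕ} [Fact p.Prime] {F : Frame p α}

/-- Since (q-1)/2 is an odd multiple of (p-1)/2, Euler's criterion makes this power congruent to
(m/p) itself modulo p, and 1 ≢ -1. -/
lemma legendreSym_eq_one_of_pow_eq_one (hp : p ≠ 2) {m : ℤ} (hm : ¬ (p : ℤ) ∣ m)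
    (h : (m : F.GR) ^ ((p ^ (2 * α + 1) - 1) / 2) = 1) : legendreSym p m = 1 := by
  rcases legendreSym_eq_one_or_neg_one hm with h1 | h1
  · exact h1
  exfalso
  obtain ⟨j, hj, hpj⟩ := exists_odd_pow_eq (odd_of_ne_two hp) α
  obtain ⟨r, hr⟩ := odd_of_ne_two hp
  have h2 : (p ^ (2 * α + 1) - 1) / 2 = p / 2 * j := by
    rw [hpj, hr, Nat.add_sub_cancel, Nat.add_sub_cancel, mul_assoc, Nat.mul_div_cancel_left _ two_pos,
      show (2 * r + 1) / 2 = r by omega]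
  have h3 : (((m ^ (p / 2 * j) - 1 : ℤ)) : F.GR) = 0 := by
    push_cast
    rw [← h2, h, sub_self]
  rw [F.intCast_eq_zero_iff] at h3
  have h4 : (p : ℤ) ∣ m ^ (p / 2 * j) - 1 := (Dvd.intro _ (by push_cast; ring)).trans h3
  rw [← ZMod.intCast_zmod_eq_zero_iff_dvd] at h4
  push_cast at h4
  rw [pow_mul, ← legendreSym.eq_pow, h1, Int.cast_neg, Int.cast_one, hj.neg_one_pow] at h4
  have h5 : ((2 : ℕ) : ZMod p) = 0 := by push_cast; linear_combination -h4
  rw [ZMod.natCast_eq_zero_iff] at h5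
  exact hp ((Nat.prime_dvd_prime_iff_eq Fact.out Nat.prime_two).1 h5)

lemma pow_half_of_mem (hp : p ≠ 2) {l : F.GR} (hl : l ∈ F.S) :
    l ^ ((p ^ (2 * α + 1) - 1) / 2) = 1 := by
  obtain ⟨t, ht, rfl⟩ := F.square_teichmuller l hl
  obtain ⟨r, hr⟩ := (odd_of_ne_two hp).pow (n := 2 * α + 1)
  rw [← pow_mul, Nat.mul_div_cancel', ht]
  exact ⟨r, by omega⟩

lemma pow_card_eq_self_of_mem {l : F.GR} (hl : l ∈ F.S) : l ^ p ^ (2 * α + 1) = l := by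
  have h := two_le_card p α
  have h1 := pow_card_of_mem hl
  calc l ^ p ^ (2 * α + 1) = l ^ (p ^ (2 * α + 1) - 1 + 1) := by congr 1; omega
    _ = l := by rw [pow_succ, h1, one_mul]

/-- Each p-th power gains a factor p in a congruence, and q is at least one p-th power, so a ≡ b mod
p becomes an equality modulo p². -/
lemma pow_card_eq_of_p_mul_eq {a b : F.GR} (h : (p : F.GR) * a = p * b) :
    a ^ p ^ (2 * α + 1) = b ^ p ^ (2 * α + 1) := by
  obtain ⟨w, hw⟩ := (F.p_mul_eq_zero_iff (a - b)).1 (by linear_combination h)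
  obtain ⟨v, hv⟩ := dvd_sub_pow_of_dvd_sub (p := p) (Dvd.intro w hw.symm) (2 * α + 1)
  rw [show 2 * α + 1 + 1 = 2 + 2 * α by ring, pow_add (p : F.GR), F.natCast_sq_eq_zero, zero_mul, zero_mul] at hv
  exact sub_eq_zero.1 hv

/-- The product of two elements of `S` is an element of `S` times a quadratic residue. -/
lemma exists_mul_eq (hp : p ≠ 2) {l l' : F.GR} (hl : l ∈ F.S) (hl' : l' ∈ F.S) :
    ∃ l'' ∈ F.S, ∃ m : ℤ, ¬ (p : ℤ) ∣ m ∧ legendreSym p m = 1 ∧ l * l' = m * l'' := by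
  have h1 : (p : F.GR) * (l * l') ≠ 0 := p_mul_ne_zero ((isUnit_of_mem hl).mul (isUnit_of_mem hl'))
  obtain ⟨l'', ⟨hl'', n, hn⟩, -⟩ := F.represent _ h1
  have h2 := not_dvd_of_p_mul_eq h1 hn
  -- Elements of S are fixed by the q-th power, so raising l l' ≡ n l'' mod p to it gives the exact
  -- equality l l' = n^q l''.
  have h3 := pow_card_eq_of_p_mul_eq (a := l * l') (b := n * l'') (by rw [hn]; ring)
  rw [mul_pow, mul_pow, pow_card_eq_self_of_mem hl, pow_card_eq_self_of_mem hl',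
    pow_card_eq_self_of_mem hl''] at h3
  have h4 : ¬ (p : ℤ) ∣ n ^ p ^ (2 * α + 1) := fun h =>
    h2 ((Nat.prime_iff_prime_int.1 Fact.out).dvd_of_dvd_pow h)
  have h5 : l * l' = (n ^ p ^ (2 * α + 1) : ℤ) * l'' := by rw [h3]; push_cast; rfl
  refine ⟨l'', hl'', n ^ p ^ (2 * α + 1), h4, ?_, h5⟩
  refine legendreSym_eq_one_of_pow_eq_one (F := F) hp h4 ?_
  have h6 := congrArg (· ^ ((p ^ (2 * α + 1) - 1) / 2)) h5
  rw [mul_pow, mul_pow, pow_half_of_mem hp hl, pow_half_of_mem hp hl', pow_half_of_mem hp hl'',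
    mul_one, mul_one] at h6
  exact h6.symm

/-- Multiplication by an element of `S` permutes `S` up to quadratic residues. -/
lemma sum_mul_eq {M : Type*} [AddCommMonoid M] (hp : p ≠ 2) {l' : F.GR} (hl' : l' ∈ F.S)
    (φ : F.GR → M) (hφ : ∀ (m : ℤ) (x : F.GR), ¬ (p : ℤ) ∣ m → legendreSym p m = 1 →
      φ (m * x) = φ x) : ∑ l ∈ F.S, φ (l * l') = ∑ l ∈ F.S, φ l := by
  choose! i hi m hm hm1 h using fun l (hl : l ∈ F.S) => exists_mul_eq hp hl hl'
  have hinj : Set.InjOn i F.S := by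
    intro a ha b hb hab
    have h1 := h a ha
    have h2 := h b hb
    rw [← hab] at h2
    have h3 : (m b * a) * l' = (m a * b) * l' := by
      linear_combination (m b : F.GR) * h1 - (m a : F.GR) * h2
    have h4 := (isUnit_of_mem hl').mul_right_cancel h3
    exact eq_of_p_mul_eq ha hb (hm b hb) (n := m a) (by linear_combination (p : F.GR) * h4)
  have himg : F.S.image i = F.S := by
    refine Finset.eq_of_subset_of_card_le ?_ (Finset.card_image_of_injOn hinj).ge
    intro x hx
    obtain ⟨l, hl, rfl⟩ := Finset.mem_image.1 hx
    exact hi l hl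
  calc ∑ l ∈ F.S, φ (l * l') = ∑ l ∈ F.S, φ (i l) :=
        Finset.sum_congr rfl fun l hl => by rw [h l hl, hφ _ _ (hm l hl) (hm1 l hl)]
    _ = ∑ l ∈ F.S.image i, φ l := (Finset.sum_image hinj).symm
    _ = ∑ l ∈ F.S, φ l := by rw [himg]

/-- The q - 1 nonzero elements of pR fall into |S| orbits of length p - 1. -/
lemma odd_card_S (hp : p ≠ 2) : Odd F.S.card := by
  classical
  have h1 := F.sum_nilpotent_part (fun _ => 1)
  have h2 : Finset.univ.filter (fun x : F.GR => (p : F.GR) * x = 0) =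
      (Finset.univ : Finset (L p α)).map
        ((Function.Embedding.subtype _).trans F.κ.toEquiv.toEmbedding) := by
    ext x
    simp only [Finset.mem_filter, Finset.mem_univ, true_and, Finset.mem_map,
      Function.Embedding.trans_apply, Function.Embedding.subtype_apply]
    constructor
    · intro h
      obtain ⟨w, rfl⟩ := (F.p_mul_eq_zero_iff x).1 h
      exact ⟨F.toL w, F.κ_toL w⟩
    · rintro ⟨y, rfl⟩
      exact F.p_mul_κ y
  have h3 : Finset.univ.filter (fun x : F.GR => (p : F.GR) * x = 0 ∧ x ≠ 0) =
      (Finset.univ.filter (fun x : F.GR => (p : F.GR) * x = 0)).erase 0 := by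
    ext x
    simp [and_comm]
  rw [← Finset.card_eq_sum_ones, h3, Finset.card_erase_of_mem (by simp), h2, Finset.card_map,
    Finset.card_univ, ← Nat.card_eq_fintype_card, card_L] at h1
  obtain ⟨j, hj, h4⟩ := exists_odd_pow_eq (odd_of_ne_two hp) α
  rw [h4] at h1
  simp only [Finset.sum_const, Nat.card_Ico, smul_eq_mul, mul_one, Nat.add_sub_cancel] at h1
  have h5 := (Fact.out : p.Prime).two_le
  rw [← Nat.eq_of_mul_eq_mul_left (by omega) h1]
  exact hj

end Frame

end GSHDS

end

/-! ### Reduction modulo p, the trace form and the additive character. -/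

noncomputable section

namespace GSHDS

/-- When ρ carries one basis to the other, it carries the matrix of multiplication by x entrywise to
that of ρ x. -/
lemma map_trace_eq {A B R S ι : Type*} [CommRing A] [CommRing B] [CommRing R] [CommRing S]
    [Algebra A R] [Algebra B S] [Fintype ι] (φ : A →+* B) (ρ : R →+* S)
    (hρ : ∀ a, ρ (algebraMap A R a) = algebraMap B S (φ a)) (b : Module.Basis ι A R)
    (b' : Module.Basis ι B S) (hb : ∀ i, ρ (b i) = b' i) (x : R) :
    φ (Algebra.trace A R x) = Algebra.trace B S (ρ x) := by
  classical
  have key : ∀ z i, b'.repr (ρ z) i = φ (b.repr z i) := by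
    intro z i
    have h : ρ z = ∑ i, φ (b.repr z i) • b' i := by
      conv_lhs => rw [← b.sum_repr z]
      rw [map_sum]
      exact Finset.sum_congr rfl fun i _ => by rw [Algebra.smul_def, map_mul, hρ, hb,
        ← Algebra.smul_def]
    rw [h, b'.repr_sum_self]
  rw [Algebra.trace_eq_matrix_trace b, Algebra.trace_eq_matrix_trace b', Matrix.trace, map_sum,
    Matrix.trace]
  refine Finset.sum_congr rfl fun i _ => ?_
  simp only [Matrix.diag_apply, Algebra.leftMulMatrix_eq_repr_mul]
  rw [← hb, ← map_mul, key]

open Polynomial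

/-- Reduction of coefficients `ℤ/p² → ℤ/p`. -/
abbrev redCoeff (p : ℕ) : ZMod (p ^ 2) →+* ZMod p :=
  ZMod.castHom (dvd_pow_self p two_ne_zero) (ZMod p)

/-- Reduction modulo `p` of `(ℤ/p²)[X]/(f)`. -/
def red {p : ℕ} (f : (ZMod (p ^ 2))[X]) : AdjoinRoot f →+* AdjoinRoot (f.map (redCoeff p)) :=
  AdjoinRoot.map (redCoeff p) _ _ dvd_rfl

section red

variable {p : ℕ} [Fact p.Prime] {f : (ZMod (p ^ 2))[X]}

lemma red_mk (g : (ZMod (p ^ 2))[X]) :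
    red f (AdjoinRoot.mk f g) = AdjoinRoot.mk _ (g.map (redCoeff p)) := by
  rw [red, AdjoinRoot.map, AdjoinRoot.lift_mk, ← eval₂_map, ← AdjoinRoot.algebraMap_eq, ← aeval_def,
    AdjoinRoot.aeval_eq]

lemma redCoeff_eq_zero_iff (a : ZMod (p ^ 2)) :
    redCoeff p a = 0 ↔ ∃ b : ZMod (p ^ 2), a = (p : ZMod (p ^ 2)) * b := by
  constructor
  · intro h
    rw [← ZMod.natCast_zmod_val a, map_natCast, ZMod.natCast_eq_zero_iff] at h
    obtain ⟨b, hb⟩ := h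
    exact ⟨b, by rw [← ZMod.natCast_zmod_val a, hb, Nat.cast_mul]⟩
  · rintro ⟨b, rfl⟩
    rw [map_mul, map_natCast, ZMod.natCast_self, zero_mul]

lemma red_surjective : Function.Surjective (red f) := by
  intro z
  obtain ⟨g, rfl⟩ := AdjoinRoot.mk_surjective z
  obtain ⟨g', rfl⟩ := Polynomial.map_surjective (redCoeff p) (ZMod.castHom_surjective _) g
  exact ⟨AdjoinRoot.mk f g', red_mk g'⟩

lemma red_eq_zero_iff (z : AdjoinRoot f) :
    red f z = 0 ↔ ∃ w, z = (p : AdjoinRoot f) * w := by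
  constructor
  · intro h
    obtain ⟨g, rfl⟩ := AdjoinRoot.mk_surjective z
    rw [red_mk, AdjoinRoot.mk_eq_zero] at h
    obtain ⟨k, hk⟩ := h
    -- With the cofactor lifted to ℤ/p², the difference g - f k has all coefficients divisible by p.
    obtain ⟨k, rfl⟩ := Polynomial.map_surjective (redCoeff p) (ZMod.castHom_surjective _) k
    have h1 : (g - f * k).map (redCoeff p) = 0 := by
      rw [Polynomial.map_sub, Polynomial.map_mul, hk, sub_self]
    have h2 : C (p : ZMod (p ^ 2)) ∣ g - f * k := by
      rw [Polynomial.C_dvd_iff_dvd_coeff]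
      intro i
      obtain ⟨b, hb⟩ := (redCoeff_eq_zero_iff ((g - f * k).coeff i)).1 (by
        rw [← Polynomial.coeff_map, h1, Polynomial.coeff_zero])
      exact ⟨b, hb⟩
    obtain ⟨w, hw⟩ := h2
    refine ⟨AdjoinRoot.mk f w, ?_⟩
    have h3 : g = C (p : ZMod (p ^ 2)) * w + f * k := by rw [← hw]; ring
    rw [h3, map_add, map_mul, map_mul, AdjoinRoot.mk_self, zero_mul, add_zero]
    simp
  · rintro ⟨w, rfl⟩
    rw [map_mul, map_natCast]
    have : ((p : ℕ) : AdjoinRoot (f.map (redCoeff p))) =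
        algebraMap (ZMod p) _ ((p : ℕ) : ZMod p) := (map_natCast _ p).symm
    rw [this, ZMod.natCast_self, map_zero, zero_mul]

lemma redCoeff_trace (hf : f.Monic) (z : AdjoinRoot f) :
    redCoeff p (Algebra.trace (ZMod (p ^ 2)) _ z) = Algebra.trace (ZMod p) _ (red f z) := by
  have hd : (f.map (redCoeff p)).natDegree = f.natDegree := hf.natDegree_map _
  refine map_trace_eq (redCoeff p) (red f) ?_ (AdjoinRoot.powerBasis' hf).basis
    ((AdjoinRoot.powerBasis' (hf.map (redCoeff p))).basis.reindex (finCongr hd)) ?_ z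
  · intro a
    rw [AdjoinRoot.algebraMap_eq, AdjoinRoot.algebraMap_eq, ← AdjoinRoot.mk_C, red_mk, map_C,
      AdjoinRoot.mk_C]
  · intro i
    rw [Module.Basis.reindex_apply, PowerBasis.coe_basis, PowerBasis.coe_basis, map_pow,
      AdjoinRoot.powerBasis'_gen, AdjoinRoot.powerBasis'_gen, red, AdjoinRoot.map_root]
    rfl

/-- The trace of the residue field onto 𝔽_p is surjective, and it is the reduction of the trace
above. -/
lemma exists_redCoeff_trace_ne_zero (hf : f.Monic) (hirr : Irreducible (f.map (redCoeff p))) :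
    ∃ z : AdjoinRoot f, redCoeff p (Algebra.trace (ZMod (p ^ 2)) _ z) ≠ 0 := by
  have : Fact (Irreducible (f.map (redCoeff p))) := ⟨hirr⟩
  have : Module.Finite (ZMod p) (AdjoinRoot (f.map (redCoeff p))) :=
    (hf.map (redCoeff p)).finite_adjoinRoot
  obtain ⟨z, hz⟩ := Algebra.trace_surjective (ZMod p) (AdjoinRoot (f.map (redCoeff p))) 1
  obtain ⟨w, rfl⟩ := red_surjective z
  exact ⟨w, by rw [redCoeff_trace hf, hz]; exact one_ne_zero⟩

end red

namespace Frame

variable {p α : ℕ} [Fact p.Prime] (F : Frame p α)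

@[simp] lemma tr_zero : F.tr 0 = 0 := map_zero _

lemma tr_intCast_mul (n : ℤ) (x : F.GR) : F.tr (n * x) = n * F.tr x := by
  rw [tr, ← zsmul_eq_mul, map_zsmul, zsmul_eq_mul]
  rfl

/-- Such an x is a unit n l plus a nilpotent element of pR. -/
lemma isUnit_of_p_mul_ne_zero {x : F.GR} (hx : (p : F.GR) * x ≠ 0) : IsUnit x := by
  obtain ⟨n, hn, l, hl, h⟩ := exists_rep hx
  have h2 : IsUnit (n : F.GR) := by
    have := F.isUnit_intCast (not_dvd_of_mem_Ico hn)
    rwa [Int.cast_natCast] at this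
  obtain ⟨w, hw⟩ := (F.p_mul_eq_zero_iff (x - n * l)).1 (by linear_combination h)
  have h3 : IsNilpotent (p * w : F.GR) := ⟨2, by rw [mul_pow, F.natCast_sq_eq_zero, zero_mul]⟩
  rw [show x = p * w + n * l by linear_combination hw]
  exact h3.isUnit_add_right_of_commute (h2.mul (isUnit_of_mem hl)) (Commute.all _ _)

/-- A nonzero element is a unit or p times a unit, so some multiple of it is z or p z, where Tr z is
prime to p. This nondegeneracy makes ψ primitive. -/
lemma exists_tr_mul_ne_zero {x : F.GR} (hx : x ≠ 0) : ∃ y, F.tr (x * y) ≠ 0 := by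
  obtain ⟨z, hz⟩ := exists_redCoeff_trace_ne_zero F.monic F.irreducible_mod
  have hz' : (p : ZMod (p ^ 2)) * F.tr z ≠ 0 := by
    rwa [Ne, natCast_mul_eq_zero_iff_exists, ← redCoeff_eq_zero_iff]
  by_cases h : (p : F.GR) * x = 0
  · obtain ⟨w, rfl⟩ := (F.p_mul_eq_zero_iff x).1 h
    obtain ⟨v, hv⟩ := (F.isUnit_of_p_mul_ne_zero hx).exists_right_inv
    refine ⟨v * z, ?_⟩
    have h1 := F.tr_intCast_mul p z
    simp only [Int.cast_natCast] at h1
    rwa [show (p : F.GR) * w * (v * z) = p * z by linear_combination (p * z) * hv, h1]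
  · obtain ⟨v, hv⟩ := (F.isUnit_of_p_mul_ne_zero h).exists_right_inv
    refine ⟨v * z, ?_⟩
    rw [show x * (v * z) = z by linear_combination z * hv]
    exact fun h => hz' (by rw [h, mul_zero])

/-- The additive character `x ↦ ζ^{Tr x}` of the Galois ring. -/
def ψ : AddChar F.GR ℂ :=
  (AddChar.zmodChar (p ^ 2) F.primitive.pow_eq_one).compAddMonoidHom
    (Algebra.trace (ZMod (p ^ 2)) F.GR).toAddMonoidHom

lemma ψ_apply (x : F.GR) : F.ψ x = F.ζ ^ (F.tr x).val := rfl

lemma ψ_isPrimitive : F.ψ.IsPrimitive := by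
  intro a ha h
  obtain ⟨y, hy⟩ := F.exists_tr_mul_ne_zero ha
  apply hy
  have h1 := DFunLike.congr_fun h y
  rw [AddChar.mulShift_apply, ψ_apply, AddChar.one_apply, F.primitive.pow_eq_one_iff_dvd] at h1
  rw [← ZMod.natCast_zmod_val (F.tr (a * y)), ZMod.natCast_eq_zero_iff]
  exact h1

open Classical in
lemma sum_ψ_mul (h : F.GR) : ∑ x, F.ψ (x * h) = if h = 0 then (p : ℂ) ^ (4 * α + 2) else 0 := by
  rw [AddChar.sum_mulShift h F.ψ_isPrimitive, F.card_GR]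
  split_ifs <;> simp

end Frame

end GSHDS

end

/-! ### Quadratic Gauss sums modulo p² and transforms of homogeneous functions. -/

noncomputable section

namespace GSHDS

lemma sum_zmod_eq_sum_range {M : Type*} [AddCommMonoid M] (n : ℕ) [NeZero n] (g : ZMod n → M) :
    ∑ x, g x = ∑ a ∈ Finset.range n, g a := by
  refine Finset.sum_nbij' (fun x => x.val) (fun a => (a : ZMod n)) ?_ ?_ ?_ ?_ ?_
  · exact fun x _ => Finset.mem_range.2 (ZMod.val_lt x)
  · exact fun _ _ => Finset.mem_univ _
  · exact fun x _ => ZMod.natCast_zmod_val x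
  · exact fun a ha => ZMod.val_cast_of_lt (Finset.mem_range.1 ha)
  · exact fun x _ => by rw [ZMod.natCast_zmod_val]

lemma legendreSym_congr {p : ℕ} [Fact p.Prime] {a b : ℤ} (h : (p : ℤ) ∣ a - b) :
    legendreSym p a = legendreSym p b := by
  have h1 : (a : ZMod p) = b := by
    rw [← sub_eq_zero, ← Int.cast_sub, ZMod.intCast_zmod_eq_zero_iff_dvd]
    exact h
  rw [legendreSym, legendreSym, h1]

lemma legendreSym_mul_self {p : ℕ} [Fact p.Prime] {n : ℤ} (hn : ¬ (p : ℤ) ∣ n) :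
    legendreSym p n * legendreSym p n = 1 := by
  rcases legendreSym_eq_one_or_neg_one hn with h | h <;> rw [h] <;> rfl

lemma sq_dvd_mul_self_iff {p : ℕ} [Fact p.Prime] (v : ℕ) : p ^ 2 ∣ v * p ↔ p ∣ v := by
  rw [pow_two, Nat.mul_dvd_mul_iff_right (Fact.out : p.Prime).pos]

namespace Frame

variable {p α : ℕ} [Fact p.Prime] (F : Frame p α)

/-- Any integer N will do, since p N modulo p² determines N modulo p; this frees `sym` from the
canonical representative `val`. -/
lemma sym_of_tr_eq {x : F.GR} {N : ℤ} (h : F.tr x = ((p * N : ℤ) : ZMod (p ^ 2))) :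
    F.sym x = legendreSym p N := by
  rw [← ZMod.natCast_zmod_val (F.tr x), ← Int.cast_natCast, ZMod.intCast_eq_intCast_iff_dvd_sub] at h
  push_cast at h
  have hp : (p : ℤ) ≠ 0 := by exact_mod_cast (Fact.out : p.Prime).ne_zero
  have h1 : p ∣ (F.tr x).val := by
    have h2 : (p : ℤ) ∣ p * N - (F.tr x).val := (Dvd.intro _ (pow_two _).symm).trans h
    exact_mod_cast (dvd_sub_right (Dvd.intro _ rfl)).1 h2
  rw [sym, if_pos h1]
  obtain ⟨v, hv⟩ := h1
  rw [hv] at h ⊢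
  rw [Nat.mul_div_cancel_left _ (Fact.out : p.Prime).pos]
  refine (legendreSym_congr ?_).symm
  rw [pow_two] at h
  push_cast at h
  rwa [← mul_sub, mul_dvd_mul_iff_left hp] at h

lemma sym_of_tr_ne {x : F.GR} (h : ∀ N : ℤ, F.tr x ≠ ((p * N : ℤ) : ZMod (p ^ 2))) :
    F.sym x = 0 := by
  rw [sym, if_neg]
  rintro ⟨v, hv⟩
  apply h v
  rw [← ZMod.natCast_zmod_val (F.tr x), hv]
  push_cast
  rfl

@[simp] lemma sym_zero : F.sym 0 = 0 := by
  rw [F.sym_of_tr_eq (N := 0) (by simp), legendreSym.at_zero]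

/-- Functions on the Galois ring that transform by the Legendre symbol under the integers prime
to `p`. -/
def IsHomogeneous {M : Type*} [Ring M] (f : F.GR → M) : Prop :=
  ∀ (n : ℤ) (x : F.GR), ¬ (p : ℤ) ∣ n → f (n * x) = legendreSym p n * f x

lemma sym_isHomogeneous : F.IsHomogeneous F.sym := by
  intro n x hn
  rw [Int.cast_id]
  by_cases h : ∃ N : ℤ, F.tr x = ((p * N : ℤ) : ZMod (p ^ 2))
  · obtain ⟨N, hN⟩ := h
    rw [F.sym_of_tr_eq hN, F.sym_of_tr_eq (N := n * N), legendreSym.mul]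
    rw [F.tr_intCast_mul, hN]
    push_cast
    ring
  · push Not at h
    rw [F.sym_of_tr_ne h, mul_zero]
    refine F.sym_of_tr_ne fun N hN => ?_
    have h1 : IsCoprime ((p ^ 2 : ℕ) : ℤ) n := by
      push_cast
      exact ((Nat.prime_iff_prime_int.1 Fact.out).coprime_iff_not_dvd.2 hn).pow_left
    obtain ⟨a, b, hab⟩ := h1
    have h2 := congrArg (Int.cast (R := ZMod (p ^ 2))) hab
    push_cast at h2
    have h3 : (p : ZMod (p ^ 2)) ^ 2 = 0 := by exact_mod_cast ZMod.natCast_self (p ^ 2)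
    -- Here b is the inverse of n modulo p².
    refine h (b * N) ?_
    rw [F.tr_intCast_mul] at hN
    push_cast at hN ⊢
    linear_combination (b : ZMod (p ^ 2)) * hN - F.tr x * h2 + (a * F.tr x) * h3

lemma ψ_natCast_mul (n : ℕ) (x : F.GR) : F.ψ (n * x) = F.ψ x ^ n := by
  rw [← nsmul_eq_mul, AddChar.map_nsmul_eq_pow]

lemma ψ_pow_p_eq_one_iff (x : F.GR) :
    F.ψ x ^ p = 1 ↔ ∃ N : ℤ, F.tr x = ((p * N : ℤ) : ZMod (p ^ 2)) := by
  rw [ψ_apply, ← pow_mul, F.primitive.pow_eq_one_iff_dvd, sq_dvd_mul_self_iff]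
  constructor
  · rintro ⟨v, hv⟩
    refine ⟨v, ?_⟩
    rw [← ZMod.natCast_zmod_val (F.tr x), hv]
    push_cast
    rfl
  · rintro ⟨N, h⟩
    rw [← ZMod.natCast_zmod_val (F.tr x), ← Int.cast_natCast,
      ZMod.intCast_eq_intCast_iff_dvd_sub] at h
    push_cast at h
    have h2 : (p : ℤ) ∣ p * N - (F.tr x).val := (Dvd.intro _ (pow_two _).symm).trans h
    exact_mod_cast (dvd_sub_right (Dvd.intro _ rfl)).1 h2

lemma ψ_pow_p_sq (x : F.GR) : (F.ψ x ^ p) ^ p = 1 := by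
  rw [ψ_apply, ← pow_mul, ← pow_mul, ← pow_two, mul_comm, pow_mul,
    F.primitive.pow_eq_one, one_pow]

lemma primitive_pow_p : IsPrimitiveRoot (F.ζ ^ p) p :=
  F.primitive.pow (pow_pos (Fact.out : p.Prime).pos 2) (pow_two p)

/-- The additive character `n ↦ ζ^{pn}` of `ℤ/p`. -/
def ψp : AddChar (ZMod p) ℂ := AddChar.zmodChar p F.primitive_pow_p.pow_eq_one

lemma ψp_apply (n : ZMod p) : F.ψp n = F.ζ ^ (p * n.val) := by
  rw [ψp, AddChar.zmodChar_apply, pow_mul]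

/-- The quadratic character of `ℤ/p` with complex values. -/
def quadC (p : ℕ) [Fact p.Prime] : MulChar (ZMod p) ℂ :=
  (quadraticChar (ZMod p)).ringHomComp (Int.castRingHom ℂ)

lemma quadC_apply (n : ZMod p) : quadC p n = quadraticChar (ZMod p) n := rfl

lemma quadC_intCast (n : ℤ) : quadC p n = legendreSym p n := rfl

lemma gauss_eq : F.gauss = gaussSum (quadC p) F.ψp := by
  rw [gauss, gaussSum]
  exact Finset.sum_congr rfl fun n _ => by rw [ψp_apply, quadC_apply]

lemma quadC_ne_one (hp : p ≠ 2) : quadC p ≠ 1 := by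
  obtain ⟨a, ha⟩ := quadraticChar_exists_neg_one' (F := ZMod p) (by rwa [ZMod.ringChar_zmod_n])
  intro h
  have h1 := DFunLike.congr_fun h (a : ZMod p)
  rw [quadC_apply, ha, MulChar.one_apply_coe] at h1
  norm_num at h1

lemma gauss_sq (hp : p ≠ 2) : F.gauss ^ 2 = legendreSym p (-1) * p := by
  have h1 : (quadC p).IsQuadratic := (quadraticChar_isQuadratic (ZMod p)).comp _
  have h2 : F.ψp.IsPrimitive :=
    AddChar.zmodChar_primitive_of_primitive_root p F.primitive_pow_p
  rw [gauss_eq, gaussSum_sq (χ := quadC p) (quadC_ne_one hp) h1 h2, ZMod.card]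
  rw [← quadC_intCast, Int.cast_neg, Int.cast_one]

lemma gauss_ne_zero (hp : p ≠ 2) : F.gauss ≠ 0 := by
  intro h
  have h1 := F.gauss_sq hp
  rw [h] at h1
  have h2 : ¬ (p : ℤ) ∣ -1 := by
    rw [Int.dvd_neg, Int.natCast_dvd, Int.natAbs_one, Nat.dvd_one]
    exact (Fact.out : p.Prime).ne_one
  have h3 : (p : ℂ) ≠ 0 := by exact_mod_cast (Fact.out : p.Prime).ne_zero
  rcases legendreSym_eq_one_or_neg_one h2 with h | h <;> rw [h] at h1 <;> simp [h3, h3.symm] at h1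

lemma sum_legendreSym_mul_pow (hp : p ≠ 2) (N : ℤ) :
    ∑ a ∈ Finset.range p, (legendreSym p a : ℂ) * F.ψp N ^ a = legendreSym p N * F.gauss := by
  have h1 : ∑ a ∈ Finset.range p, (legendreSym p a : ℂ) * F.ψp N ^ a =
      gaussSum (quadC p) (F.ψp.mulShift N) := by
    rw [gaussSum, sum_zmod_eq_sum_range]
    refine Finset.sum_congr rfl fun a _ => ?_
    rw [← quadC_intCast, Int.cast_natCast, AddChar.mulShift_apply, mul_comm (N : ZMod p),
      ← nsmul_eq_mul, AddChar.map_nsmul_eq_pow]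
  rw [h1, gauss_eq]
  by_cases hN : (p : ℤ) ∣ N
  · have h2 := (ZMod.intCast_zmod_eq_zero_iff_dvd N p).2 hN
    rw [h2, (legendreSym.eq_zero_iff p N).2 h2, Int.cast_zero, zero_mul, gaussSum]
    simp only [AddChar.mulShift_apply, zero_mul, AddChar.map_zero_eq_one, mul_one]
    exact MulChar.sum_eq_zero_of_ne_one (quadC_ne_one hp)
  · have h2 : IsUnit (N : ZMod p) := by
      rw [isUnit_iff_ne_zero, Ne, ZMod.intCast_zmod_eq_zero_iff_dvd]
      exact hN
    have h3 := gaussSum_mulShift (quadC p) F.ψp h2.unit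
    rw [IsUnit.unit_spec, quadC_intCast] at h3
    rw [← h3, ← mul_assoc, ← Int.cast_mul, legendreSym_mul_self hN, Int.cast_one, one_mul]

/-- The quadratic Gauss sum modulo `p²`. -/
lemma sum_legendreSym_mul_ψ (hp : p ≠ 2) (x : F.GR) :
    ∑ a ∈ Finset.range p, ∑ b ∈ Finset.range p, (legendreSym p a : ℂ) * F.ψ ((a + p * b : ℕ) * x) =
      p * F.gauss * F.sym x := by
  have h1 : ∀ a b : ℕ, F.ψ ((a + p * b : ℕ) * x) = F.ψ x ^ a * (F.ψ x ^ p) ^ b := fun a b => by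
    rw [ψ_natCast_mul, pow_add, pow_mul]
  -- The sum factors. The sum over b of ψ(x)^{pb} is p if p divides Tr x and 0 otherwise; in the
  -- first case ψ(x) is a p-th root of unity and the sum over a is an ordinary Gauss sum.
  simp_rw [h1, ← mul_assoc, ← Finset.mul_sum]
  rw [← Finset.sum_mul]
  by_cases h : ∃ N : ℤ, F.tr x = ((p * N : ℤ) : ZMod (p ^ 2))
  · rw [(F.ψ_pow_p_eq_one_iff x).2 h]
    have h' := h
    rw [← ψ_pow_p_eq_one_iff, ψ_apply, ← pow_mul, F.primitive.pow_eq_one_iff_dvd,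
      sq_dvd_mul_self_iff] at h'
    obtain ⟨v, hv⟩ := h'
    have h2 : F.ψ x = F.ψp (v : ℤ) := by
      have h3 : F.ψp ((v : ℤ) : ZMod p) = F.ψp 1 ^ v := by
        rw [← AddChar.map_nsmul_eq_pow, nsmul_eq_mul, mul_one, Int.cast_natCast]
      have : Fact (1 < p) := ⟨(Fact.out : p.Prime).one_lt⟩
      rw [h3, ψ_apply, hv, ψp_apply, ZMod.val_one, mul_one, pow_mul]
    rw [h2, F.sum_legendreSym_mul_pow hp, F.sym_of_tr_eq (N := v)]
    · simp
      ring
    · rw [← ZMod.natCast_zmod_val (F.tr x), hv]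
      push_cast
      rfl
  · have h2 : F.ψ x ^ p ≠ 1 := fun h' => h ((F.ψ_pow_p_eq_one_iff x).1 h')
    push Not at h
    rw [F.sym_of_tr_ne h, Int.cast_zero, mul_zero, geom_sum_eq h2, F.ψ_pow_p_sq, sub_self, zero_div,
      mul_zero]

/-- The Fourier transform on the Galois ring. -/
def hat (f : F.GR → ℂ) (h : F.GR) : ℂ := ∑ x, f x * F.ψ (x * h)

lemma hat_hat (f : F.GR → ℂ) (h : F.GR) :
    F.hat (F.hat f) h = (p : ℂ) ^ (4 * α + 2) * f (-h) := by
  classical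
  simp only [hat, Finset.sum_mul]
  rw [Finset.sum_comm]
  have h1 : ∀ x y : F.GR, f x * F.ψ (x * y) * F.ψ (y * h) = f x * F.ψ (y * (x + h)) := fun x y => by
    rw [mul_assoc, ← AddChar.map_add_eq_mul, mul_add, mul_comm x y]
  simp_rw [h1, ← Finset.mul_sum, F.sum_ψ_mul]
  rw [Finset.sum_eq_single (-h)]
  · rw [if_pos (by ring), mul_comm]
  · intro x _ hx
    rw [if_neg (fun h' => hx (eq_neg_of_add_eq_zero_left h')), mul_zero]
  · exact fun h' => absurd (Finset.mem_univ _) h'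

lemma sum_intCast_mul {M : Type*} [AddCommMonoid M] {n : ℤ} (hn : ¬ (p : ℤ) ∣ n) (g : F.GR → M) :
    ∑ x, g (n * x) = ∑ x, g x :=
  Equiv.sum_comp (Units.mulLeft (F.isUnit_intCast hn).unit) g

variable {F}

lemma IsHomogeneous.hat {f : F.GR → ℂ} (hf : F.IsHomogeneous f) : F.IsHomogeneous (F.hat f) := by
  intro n h hn
  rw [Frame.hat, Frame.hat, ← F.sum_intCast_mul hn (fun x => f x * F.ψ (x * h)), Finset.mul_sum]
  refine Finset.sum_congr rfl fun x _ => ?_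
  have h1 := congrArg (Int.cast (R := ℂ)) (legendreSym_mul_self hn)
  push_cast at h1
  rw [hf n x hn, mul_left_comm x, mul_assoc (n : F.GR)]
  linear_combination (-(f x * F.ψ (n * (x * h)))) * h1

/-- Substituting (a + p b) x for x leaves the transform unchanged and multiplies f by (a/p).
Averaging over the p(p-1) unit classes replaces ψ by the Gauss sum modulo p², that is, by p τ σ. -/
lemma hat_eq_sum_sym (hp : p ≠ 2) {f : F.GR → ℂ} (hf : F.IsHomogeneous f) (h : F.GR) :
    ((p : ℂ) - 1) * F.hat f h = F.gauss * ∑ x, f x * F.sym (x * h) := by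
  have hp0 : (p : ℂ) ≠ 0 := by exact_mod_cast (Fact.out : p.Prime).ne_zero
  apply mul_left_cancel₀ hp0
  have h1 : ∀ a ∈ Finset.Ico 1 p, ∀ b : ℕ, F.hat f h =
      ∑ x, f x * ((legendreSym p a : ℂ) * F.ψ ((a + p * b : ℕ) * (x * h))) := by
    intro a ha b
    have h2 : ¬ (p : ℤ) ∣ ((a + p * b : ℕ) : ℤ) := by
      push_cast
      rw [Int.dvd_add_left (Dvd.intro _ rfl)]
      exact not_dvd_of_mem_Ico ha
    rw [Frame.hat, ← F.sum_intCast_mul h2]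
    refine Finset.sum_congr rfl fun x _ => ?_
    rw [hf _ _ h2, legendreSym_congr (b := (a : ℤ)) (by push_cast; simp), Int.cast_natCast, mul_assoc _ x h]
    ring
  have h3 : ∑ a ∈ Finset.Ico 1 p, ∑ b ∈ Finset.range p, F.hat f h = p * ((p - 1) * F.hat f h) := by
    have := (Fact.out : p.Prime).one_le
    simp only [Finset.sum_const, Finset.card_range, Nat.card_Ico, nsmul_eq_mul]
    rw [Nat.cast_sub this, Nat.cast_one]
    ring
  rw [← h3, Finset.sum_congr rfl fun a ha => Finset.sum_congr rfl fun b _ => h1 a ha b]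
  have h4 : ∀ g : ℕ → ℂ, g 0 = 0 → ∑ a ∈ Finset.Ico 1 p, g a = ∑ a ∈ Finset.range p, g a := by
    intro g hg
    rw [Finset.range_eq_Ico, Finset.sum_eq_sum_Ico_succ_bot (Fact.out : p.Prime).pos, hg, zero_add]
  -- The term a = 0 may be included because its symbol is 0.
  rw [h4 _ (by simp)]
  simp_rw [Finset.sum_comm (s := Finset.range p) (t := Finset.univ), ← Finset.mul_sum]
  rw [Finset.mul_sum, Finset.mul_sum]
  refine Finset.sum_congr rfl fun x _ => ?_
  have h5 := F.sum_legendreSym_mul_ψ hp (x * h)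
  simp_rw [← Finset.mul_sum] at h5
  rw [h5]
  ring

/-- The Fourier transform of a homogeneous function as a sum over orbits. -/
lemma hat_eq (hp : p ≠ 2) {f : F.GR → ℂ} (hf : F.IsHomogeneous f) (h : F.GR) :
    F.hat f h = F.gauss * (∑ l ∈ F.S, f (p * l) * F.sym (p * l * h) +
      ∑ l ∈ F.S, ∑ y : L p α, f (F.pt l y) * F.sym (F.pt l y * h)) := by
  have hp1 : (p : ℂ) - 1 ≠ 0 := by
    rw [sub_ne_zero]
    exact_mod_cast (Fact.out : p.Prime).ne_one
  apply mul_left_cancel₀ hp1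
  -- The product of two homogeneous functions is constant on orbits, so the sum over the ring
  -- becomes p - 1 times a sum over representatives.
  rw [hat_eq_sum_sym hp hf, F.sum_orbits (fun x => f x * (F.sym (x * h) : ℂ))]
  · ring
  · simp
  · intro n x hn
    rw [hf n x hn, mul_assoc (n : F.GR), F.sym_isHomogeneous n _ hn]
    have h1 := congrArg (Int.cast (R := ℂ)) (legendreSym_mul_self hn)
    push_cast at h1 ⊢
    linear_combination (f x * F.sym (x * h)) * h1

end Frame

end GSHDS

end

/-! ### Descent to K, and the correlations of the symbol. -/

noncomputable section

namespace GSHDS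

section GroupRing

variable {X : Type*}

@[simp] lemma coeff_ofFun [Finite X] (f : X → ℤ) (x : X) : (ofFun f).coeff x = f x := rfl

lemma ofFun_eq_sum [Fintype X] (f : X → ℤ) : ofFun f = ∑ x, AddMonoidAlgebra.single x (f x) := by
  classical
  ext x
  simp [AddMonoidAlgebra.coeff_sum, Finsupp.single_apply]

lemma principal_ofFun [Fintype X] (f : X → ℤ) : principal (ofFun f) = ∑ x, f x := by
  rw [principal, Finsupp.sum_fintype _ _ (fun _ => rfl)]
  rfl

lemma powMap_single [AddCommGroup X] (n : ℤ) (x : X) (a : ℤ) :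
    powMap n (AddMonoidAlgebra.single x a) = AddMonoidAlgebra.single (n • x) a :=
  AddMonoidAlgebra.mapDomain_single

lemma powMap_sum [AddCommGroup X] {ι : Type*} (n : ℤ) (s : Finset ι)
    (f : ι → AddMonoidAlgebra ℤ X) : powMap n (∑ i ∈ s, f i) = ∑ i ∈ s, powMap n (f i) :=
  map_sum (⟨⟨powMap n, AddMonoidAlgebra.mapDomain_zero _⟩, AddMonoidAlgebra.mapDomain_add _⟩ :
    AddMonoidAlgebra ℤ X →+ AddMonoidAlgebra ℤ X) f s

lemma ofFun_mul_powMap_neg_one [Fintype X] [AddCommGroup X] (u v : X → ℤ) :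
    ofFun u * powMap (-1) (ofFun v) = ofFun fun k => ∑ k', u (k + k') * v k' := by
  classical
  rw [ofFun_eq_sum u, ofFun_eq_sum v, ofFun_eq_sum]
  have h1 : powMap (-1) (∑ x, AddMonoidAlgebra.single x (v x)) =
      ∑ x, AddMonoidAlgebra.single (-x) (v x) := by
    rw [powMap_sum]
    simp [powMap_single]
  rw [h1, Finset.sum_mul_sum, Finset.sum_comm]
  simp_rw [AddMonoidAlgebra.single_mul_single]
  have h2 : ∀ k' : X, ∑ x, AddMonoidAlgebra.single (x + -k') (u x * v k') =
      ∑ k, AddMonoidAlgebra.single k (u (k + k') * v k') := fun k' => by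
    rw [← Equiv.sum_comp (Equiv.addRight k')]
    simp
  simp_rw [h2]
  rw [Finset.sum_comm]
  refine Finset.sum_congr rfl fun k _ => ?_
  exact (map_sum (AddMonoidAlgebra.singleAddHom k) _ _).symm

lemma sum_eq_card_nsmul_sum_quotient [Fintype X] [AddCommGroup X] {M : Type*} [AddCommMonoid M]
    (P : AddSubgroup X) [Fintype (X ⧸ P)] (g : X → M) (hg : ∀ y, ∀ z ∈ P, g (y + z) = g y) :
    ∑ y, g y = Nat.card P • ∑ k : X ⧸ P, g (Quotient.out k) := by
  classical
  rw [← Finset.sum_fiberwise (g := (QuotientAddGroup.mk : X → X ⧸ P)), Finset.smul_sum]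
  refine Finset.sum_congr rfl fun k _ => ?_
  have h1 : Finset.univ.filter (fun y : X => (QuotientAddGroup.mk y : X ⧸ P) = k) =
      (Finset.univ : Finset P).map ((Function.Embedding.subtype (· ∈ P)).trans
        (addLeftEmbedding (Quotient.out k))) := by
    ext y
    simp only [Finset.mem_filter, Finset.mem_univ, true_and, Finset.mem_map,
      Function.Embedding.trans_apply, Function.Embedding.subtype_apply, addLeftEmbedding_apply]
    constructor
    · rintro rfl
      refine ⟨⟨-Quotient.out (QuotientAddGroup.mk y : X ⧸ P) + y, ?_⟩, add_neg_cancel_left _ _⟩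
      rw [← QuotientAddGroup.eq]
      exact QuotientAddGroup.out_eq' _
    · rintro ⟨z, rfl⟩
      rw [QuotientAddGroup.mk_add_of_mem _ z.2]
      exact QuotientAddGroup.out_eq' _
  rw [h1, Finset.sum_map]
  simp only [Function.Embedding.trans_apply, Function.Embedding.subtype_apply,
    addLeftEmbedding_apply]
  have h2 : ∀ z : P, g (Quotient.out k + z) = g (Quotient.out k) := fun z => hg _ z z.2
  simp_rw [h2]
  rw [Finset.sum_const, Finset.card_univ, ← Nat.card_eq_fintype_card]

end GroupRing

namespace Frame

variable {p α : ℕ} [Fact p.Prime] (F : Frame p α)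

instance fintypeK : Fintype F.K := Fintype.ofFinite _

lemma mem_P_iff (y : L p α) : y ∈ F.P ↔ ∃ n : ℤ, F.κ (y : H p α) = n * p := by
  rw [P, AddSubgroup.mem_zmultiples_iff]
  refine exists_congr fun n => ?_
  rw [Subtype.ext_iff, ← F.κ.injective.eq_iff, AddSubgroup.coe_zsmul, map_zsmul,
    AddEquiv.apply_symm_apply, zsmul_eq_mul, eq_comm]

lemma card_P : Nat.card F.P = p := by
  rw [P, Nat.card_zmultiples]
  refine addOrderOf_eq_prime ?_ ?_
  · ext1
    rw [AddSubgroup.coe_nsmul, ← map_nsmul, nsmul_eq_mul, ← pow_two, F.natCast_sq_eq_zero, map_zero]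
    rfl
  · intro h
    have h1 := congrArg (fun y : L p α => F.κ (y : H p α)) h
    simp only [AddEquiv.apply_symm_apply, ZeroMemClass.coe_zero, map_zero] at h1
    exact F.p_ne_zero h1

lemma card_K : Nat.card F.K = p ^ (2 * α) := by
  have h := AddSubgroup.card_eq_card_quotient_mul_card_addSubgroup F.P
  rw [card_L, F.card_P, pow_succ] at h
  exact (Nat.eq_of_mul_eq_mul_right (Fact.out : p.Prime).pos h).symm

lemma sum_L_eq_sum_K {M : Type*} [Ring M] (g : L p α → M)
    (hg : ∀ y, ∀ z ∈ F.P, g (y + z) = g y) :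
    ∑ y, g y = p * ∑ k : F.K, g (Quotient.out k) := by
  rw [sum_eq_card_nsmul_sum_quotient F.P g hg, F.card_P, nsmul_eq_mul]

variable {F}

lemma pt_mul_pt (l l' : F.GR) (y y' : L p α) :
    F.pt l y * F.pt l' y' = F.pt (l * l') (y + y') := by
  simp only [pt, AddSubgroup.coe_add, map_add]
  linear_combination (l * l') * F.κ_mul_κ y y'

lemma p_mul_mul_pt (l l' : F.GR) (y : L p α) : p * l * F.pt l' y = p * (l * l') := by
  rw [pt]
  linear_combination (l * l') * F.p_mul_κ y

lemma pt_intCast_mul (n : ℤ) (l : F.GR) (y : L p α) : F.pt (n * l) y = n * F.pt l y := by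
  rw [pt, pt, mul_assoc]

/-- For z = n p one has l(1 + y + z) = (1 + p n) l(1 + y), because p y = 0, and 1 + p n is a
quadratic residue. Hence the coefficients of L₀, A and B depend only on classes in K. -/
lemma IsHomogeneous.pt_add {M : Type*} [Ring M] {f : F.GR → M} (hf : F.IsHomogeneous f) (l : F.GR)
    (y : L p α) {z : L p α} (hz : z ∈ F.P) : f (F.pt l (y + z)) = f (F.pt l y) := by
  obtain ⟨n, hn⟩ := (F.mem_P_iff z).1 hz
  have h1 : F.pt l (y + z) = ((1 + p * n : ℤ) : F.GR) * F.pt l y := by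
    simp only [pt, AddSubgroup.coe_add, map_add, hn]
    push_cast
    linear_combination (-(l * n)) * F.p_mul_κ y
  have h2 : (p : ℤ) ∣ (1 + p * n) - 1 := by simp
  rw [h1, hf, legendreSym_congr h2, legendreSym.at_one, Int.cast_one, one_mul]
  intro h
  have h3 : (p : ℤ) ∣ 1 := by simpa using (Int.dvd_add_left (Dvd.intro _ rfl)).1 h
  rw [Int.natCast_dvd, Int.natAbs_one, Nat.dvd_one] at h3
  exact (Fact.out : p.Prime).ne_one h3

lemma IsHomogeneous.pt_congr {M : Type*} [Ring M] {f : F.GR → M} (hf : F.IsHomogeneous f) (l : F.GR)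
    {y y' : L p α} (h : (QuotientAddGroup.mk y : F.K) = QuotientAddGroup.mk y') :
    f (F.pt l y) = f (F.pt l y') := by
  rw [QuotientAddGroup.eq] at h
  rw [← hf.pt_add l y h, add_neg_cancel_left]

lemma IsHomogeneous.intCast {M : Type*} [Ring M] {f : F.GR → ℤ} (hf : F.IsHomogeneous f) :
    F.IsHomogeneous (fun x => (f x : M)) := by
  intro n x hn
  dsimp only
  rw [hf n x hn]
  push_cast
  rfl

variable (F)

/-- The coefficient `∑_l sym (l (1 + y))` of `L₀`. -/
def lam (y : L p α) : ℤ := ∑ l ∈ F.S, F.sym (F.pt l y)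

/-- The sum `∑_l sym (p l)`, a quadratic Gauss sum of the residue field divided by that of
`ℤ/p`. -/
def gaussRatio : ℤ := ∑ l ∈ F.S, F.sym (p * l)

variable {F}

lemma sum_sym_pt_mul (hp : p ≠ 2) {l' : F.GR} (hl' : l' ∈ F.S) (y : L p α) :
    ∑ l ∈ F.S, F.sym (F.pt (l * l') y) = F.lam y :=
  sum_mul_eq hp hl' (fun x => F.sym (F.pt x y)) fun m x hm h => by
    rw [pt_intCast_mul, F.sym_isHomogeneous m _ hm, h, Int.cast_one, one_mul]

lemma sum_sym_p_mul_mul (hp : p ≠ 2) {l' : F.GR} (hl' : l' ∈ F.S) :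
    ∑ l ∈ F.S, F.sym (p * (l * l')) = F.gaussRatio :=
  sum_mul_eq hp hl' (fun x => F.sym (p * x)) fun m x hm h => by
    rw [mul_left_comm, F.sym_isHomogeneous m _ hm, h, Int.cast_one, one_mul]

/-- For fixed l, the products l l' run through S up to residues, and the factors 1 + y multiply by
adding their y. So the unit part of `hat_eq` becomes a convolution over L with `lam`, while the
nilpotent part no longer sees y'. -/
lemma sum_hat_pt (hp : p ≠ 2) {f : F.GR → ℂ} (hf : F.IsHomogeneous f) (y' : L p α) :
    ∑ l' ∈ F.S, F.hat f (F.pt l' y') = F.gauss * (F.gaussRatio * ∑ l ∈ F.S, f (p * l) +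
      ∑ y, (∑ l ∈ F.S, f (F.pt l y)) * F.lam (y + y')) := by
  simp_rw [hat_eq hp hf]
  rw [← Finset.mul_sum, Finset.sum_add_distrib]
  congr 2
  · rw [Finset.sum_comm, Finset.mul_sum]
    refine Finset.sum_congr rfl fun l hl => ?_
    rw [← Finset.mul_sum, ← sum_sym_p_mul_mul hp hl, mul_comm]
    push_cast
    congr 1
    exact Finset.sum_congr rfl fun l' _ => by rw [p_mul_mul_pt, mul_comm l]
  · rw [Finset.sum_comm]
    simp_rw [Finset.sum_mul]
    rw [Finset.sum_comm (s := Finset.univ)]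
    refine Finset.sum_congr rfl fun l hl => ?_
    rw [Finset.sum_comm]
    refine Finset.sum_congr rfl fun y _ => ?_
    rw [← Finset.mul_sum, ← sum_sym_pt_mul hp hl]
    push_cast
    congr 1
    exact Finset.sum_congr rfl fun l' _ => by rw [pt_mul_pt, mul_comm l]

/-- At p l' the nilpotent part dies since p² = 0, and the unit part forgets y. -/
lemma sum_hat_p_mul (hp : p ≠ 2) {f : F.GR → ℂ} (hf : F.IsHomogeneous f) :
    ∑ l' ∈ F.S, F.hat f (p * l') =
      F.gauss * F.gaussRatio * ∑ y : L p α, ∑ l ∈ F.S, f (F.pt l y) := by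
  simp_rw [hat_eq hp hf]
  rw [← Finset.mul_sum, mul_assoc, Finset.mul_sum, Finset.mul_sum]
  have h1 : ∀ l l' : F.GR, (p : F.GR) * l * (p * l') = 0 := fun l l' => by
    linear_combination (l * l') * F.natCast_sq_eq_zero
  simp_rw [h1, sym_zero, Int.cast_zero, mul_zero, Finset.sum_const_zero, zero_add]
  rw [← Finset.mul_sum, ← Finset.mul_sum, Finset.sum_comm]
  congr 1
  rw [Finset.sum_comm (s := Finset.univ), Finset.mul_sum]
  refine Finset.sum_congr rfl fun l hl => ?_
  rw [Finset.sum_comm, Finset.mul_sum]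
  refine Finset.sum_congr rfl fun y _ => ?_
  rw [← Finset.mul_sum, ← sum_sym_p_mul_mul hp hl, mul_comm]
  push_cast
  congr 1
  exact Finset.sum_congr rfl fun l' _ => by rw [mul_comm, p_mul_mul_pt]

lemma not_dvd_neg_one : ¬ (p : ℤ) ∣ -1 := by
  rw [Int.dvd_neg, Int.natCast_dvd, Int.natAbs_one, Nat.dvd_one]
  exact (Fact.out : p.Prime).ne_one

open Classical in
/-- The Fourier transform of `x ↦ sym (x z)`. -/
lemma hat_sym_mul (hp : p ≠ 2) (z h : F.GR) :
    p * F.gauss * legendreSym p (-1) * F.hat (fun x => (F.sym (x * z) : ℂ)) h =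
      (p : ℂ) ^ (4 * α + 2) * ∑ a ∈ Finset.range p, ∑ b ∈ Finset.range p,
        (legendreSym p a : ℂ) * if h = (a + p * b : ℕ) * z then 1 else 0 := by
  -- The Gauss sum formula is read backwards: the symbol is expanded into additive characters at -x
  -- z, so that summing over x leaves a delta at h = (a + p b) z.
  have h1 : ∀ x : F.GR, p * F.gauss * legendreSym p (-1) * F.sym (x * z) =
      ∑ a ∈ Finset.range p, ∑ b ∈ Finset.range p,
        (legendreSym p a : ℂ) * F.ψ ((a + p * b : ℕ) * -(x * z)) := fun x => by
    have h2 := F.sym_isHomogeneous (-1) (x * z) not_dvd_neg_one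
    rw [Int.cast_neg, Int.cast_one, neg_one_mul] at h2
    rw [F.sum_legendreSym_mul_ψ hp, h2]
    push_cast
    ring
  rw [Frame.hat, Finset.mul_sum, Finset.mul_sum]
  simp_rw [← mul_assoc _ (F.sym _ : ℂ), h1, Finset.sum_mul]
  rw [Finset.sum_comm]
  refine Finset.sum_congr rfl fun a _ => ?_
  rw [Finset.sum_comm, Finset.mul_sum]
  refine Finset.sum_congr rfl fun b _ => ?_
  have h3 : ∀ x : F.GR, (legendreSym p a : ℂ) * F.ψ ((a + p * b : ℕ) * -(x * z)) * F.ψ (x * h) =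
      legendreSym p a * F.ψ (x * (h - (a + p * b : ℕ) * z)) := fun x => by
    rw [mul_assoc, ← AddChar.map_add_eq_mul]
    congr 2
    ring
  simp_rw [h3]
  rw [← Finset.mul_sum, F.sum_ψ_mul]
  simp_rw [sub_eq_zero]
  split_ifs <;> ring

lemma sym_mul_isHomogeneous (z : F.GR) : F.IsHomogeneous (fun x => (F.sym (x * z) : ℂ)) := by
  intro n x hn
  dsimp only
  rw [mul_assoc, F.sym_isHomogeneous n _ hn]
  push_cast
  rfl

lemma exists_mem_S (F : Frame p α) : ∃ l, l ∈ F.S := by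
  obtain ⟨l, ⟨hl, -⟩, -⟩ := F.represent 1 (p_mul_ne_zero isUnit_one)
  exact ⟨l, hl⟩

/-- For `l, l₀ ∈ S` the elements `l` and `a l₀` agree modulo `p` only if `l = l₀` and `a = 1`. -/
lemma eq_and_eq_one {l l₀ : F.GR} (hl : l ∈ F.S) (hl₀ : l₀ ∈ F.S) {a b : ℕ}
    (ha : a ∈ Finset.range p) (h : (p : F.GR) * l = p * ((a + p * b : ℕ) * l₀)) :
    l = l₀ ∧ a = 1 := by
  have h1 : ((1 : ℤ) : F.GR) * (p * l) = (a : ℤ) * (p * l₀) := by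
    push_cast at h ⊢
    linear_combination h + (b * l₀) * F.natCast_sq_eq_zero
  have h2 : l = l₀ := eq_of_p_mul_eq hl hl₀ (by
    have := not_dvd_neg_one (p := p); rwa [Int.dvd_neg] at this) h1
  refine ⟨h2, ?_⟩
  subst h2
  have h3 := dvd_sub_of_p_mul_eq (isUnit_of_mem hl) h1
  have h4 := Int.eq_zero_of_abs_lt_dvd h3 (by
    have := Finset.mem_range.1 ha
    have := (Fact.out : p.Prime).two_le
    rw [abs_lt]; omega)
  omega

/-- Apply `sum_hat_p_mul` to the symbol shifted by p l₀. Its transform is supported on the orbit of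
p l₀, while the other side contains the square of `gaussRatio`. -/
lemma gaussRatio_sq (hp : p ≠ 2) : F.gaussRatio ^ 2 = p ^ (2 * α) := by
  classical
  obtain ⟨l₀, hl₀⟩ := F.exists_mem_S
  have h1 := sum_hat_p_mul hp (sym_mul_isHomogeneous (p * l₀ : F.GR))
  have h2 : ∀ y : L p α, ∑ l ∈ F.S, (F.sym (F.pt l y * (p * l₀)) : ℂ) = F.gaussRatio := fun y => by
    rw [← sum_sym_p_mul_mul hp hl₀]
    push_cast
    exact Finset.sum_congr rfl fun l _ => by rw [mul_comm, p_mul_mul_pt, mul_comm l]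
  simp_rw [h2] at h1
  rw [Finset.sum_const, Finset.card_univ, ← Nat.card_eq_fintype_card, card_L, nsmul_eq_mul] at h1
  have h3 := congrArg (p * F.gauss * legendreSym p (-1) * ·) h1
  rw [Finset.mul_sum, Finset.sum_congr rfl fun l _ => hat_sym_mul hp (p * l₀ : F.GR) (p * l),
    ← Finset.mul_sum] at h3
  -- Only l = l₀, a = 1 contribute; b is free because (1 + p b) p l₀ = p l₀, whence the value p.
  have h4 : ∑ l ∈ F.S, ∑ a ∈ Finset.range p, ∑ b ∈ Finset.range p, (legendreSym p a : ℂ) *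
      (if (p : F.GR) * l = (a + p * b : ℕ) * (p * l₀) then 1 else 0) = p := by
    rw [Finset.sum_eq_single_of_mem l₀ hl₀, Finset.sum_eq_single_of_mem 1
      (Finset.mem_range.2 (Fact.out : p.Prime).one_lt)]
    · have h5 : ∀ b : ℕ, (p : F.GR) * l₀ = (1 + p * b : ℕ) * (p * l₀) := fun b => by
        push_cast
        linear_combination (-(b * l₀)) * F.natCast_sq_eq_zero
      rw [Finset.sum_congr rfl fun b _ => by rw [if_pos (h5 b)]]
      simp
    · intro a ha ha1
      refine Finset.sum_eq_zero fun b _ => ?_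
      rw [if_neg, mul_zero]
      exact fun h => ha1 (eq_and_eq_one hl₀ hl₀ ha (by rw [h]; ring)).2
    · intro l hl hne
      refine Finset.sum_eq_zero fun a ha => Finset.sum_eq_zero fun b _ => ?_
      rw [if_neg, mul_zero]
      exact fun h => hne (eq_and_eq_one hl hl₀ ha (by rw [h]; ring)).1
  rw [h4] at h3
  have h6 := congrArg (Int.cast (R := ℂ)) (legendreSym_mul_self (not_dvd_neg_one (p := p)))
  have hp0 : (p : ℂ) ≠ 0 := by exact_mod_cast (Fact.out : p.Prime).ne_zero
  have h7 : (F.gaussRatio : ℂ) ^ 2 = p ^ (2 * α) := by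
    apply mul_left_cancel₀ (pow_ne_zero (2 * α + 3) hp0)
    push_cast at h3 h6
    linear_combination (-1 : ℂ) * h3 - (p * legendreSym p (-1) * F.gaussRatio ^ 2 * p ^ (2 * α + 1)) * F.gauss_sq hp - (p ^ 2 * F.gaussRatio ^ 2 * p ^ (2 * α + 1)) * h6
  exact_mod_cast h7

/-- Apply `sum_hat_pt` to the symbol shifted by l₀(1 + y₀). The transform is a delta on an orbit,
the convolution is the correlation of `lam`, and the subtracted term is p² `gaussRatio`². -/
lemma sum_lam_mul_lam (hp : p ≠ 2) (y₀ y' : L p α) [Decidable (y' - y₀ ∈ F.P)] :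
    (p : ℤ) ^ 2 * ∑ y, F.lam (y + y₀) * F.lam (y + y') =
      p ^ (4 * α + 2) * (if y' - y₀ ∈ F.P then 1 else 0) - p ^ (2 * α + 2) := by
  classical
  obtain ⟨l₀, hl₀⟩ := F.exists_mem_S
  have h1 := sum_hat_pt hp (sym_mul_isHomogeneous (F.pt l₀ y₀)) y'
  have h2 : ∀ y : L p α, ∑ l ∈ F.S, (F.sym (F.pt l y * F.pt l₀ y₀) : ℂ) = F.lam (y + y₀) :=
    fun y => by
    rw [← sum_sym_pt_mul hp hl₀]
    push_cast
    exact Finset.sum_congr rfl fun l _ => by rw [pt_mul_pt]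
  have h2' : ∑ l ∈ F.S, (F.sym (p * l * F.pt l₀ y₀) : ℂ) = F.gaussRatio := by
    rw [← sum_sym_p_mul_mul hp hl₀]
    push_cast
    exact Finset.sum_congr rfl fun l _ => by rw [p_mul_mul_pt]
  simp_rw [h2, h2'] at h1
  have h3 := congrArg (p * F.gauss * legendreSym p (-1) * ·) h1
  rw [Finset.mul_sum, Finset.sum_congr rfl fun l _ => hat_sym_mul hp (F.pt l₀ y₀) (F.pt l y'),
    ← Finset.mul_sum] at h3
  have hpp : ∀ (l : F.GR) (y : L p α), (p : F.GR) * F.pt l y = p * l := fun l y => by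
    rw [pt]
    linear_combination l * F.p_mul_κ y
  have key : ∀ (l : F.GR) (n : ℕ), F.pt l y' = n * F.pt l₀ y₀ → p * l = p * (n * l₀) :=
    fun l n h => by rw [← hpp l y', h, mul_left_comm, hpp, mul_left_comm]
  have h4 : ∑ l ∈ F.S, ∑ a ∈ Finset.range p, ∑ b ∈ Finset.range p, (legendreSym p a : ℂ) *
      (if F.pt l y' = (a + p * b : ℕ) * F.pt l₀ y₀ then 1 else 0) =
        if y' - y₀ ∈ F.P then 1 else 0 := by
    rw [Finset.sum_eq_single_of_mem l₀ hl₀, Finset.sum_eq_single_of_mem 1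
      (Finset.mem_range.2 (Fact.out : p.Prime).one_lt)]
    -- The surviving condition is y' - y₀ = b p, which has exactly one solution b modulo p when y' -
    -- y₀ lies in `P`, and none otherwise.
    · have h5 : ∀ b : ℕ, F.pt l₀ y' = (1 + p * b : ℕ) * F.pt l₀ y₀ ↔
          F.κ ((y' - y₀ : L p α) : H p α) = b * p := fun b => by
        rw [← (isUnit_of_mem hl₀).mul_right_inj (c := (b : F.GR) * p), AddSubgroup.coe_sub, map_sub,
          ← sub_eq_zero, ← sub_eq_zero (b := l₀ * ((b : F.GR) * p)), pt, pt]
        push_cast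
        rw [show l₀ * (1 + F.κ (y' : H p α)) - (1 + p * b) * (l₀ * (1 + F.κ (y₀ : H p α))) =
          l₀ * (F.κ (y' : H p α) - F.κ (y₀ : H p α)) - l₀ * (b * p) by
            linear_combination (-(b * l₀)) * F.p_mul_κ y₀]
      simp_rw [h5, Nat.cast_one, legendreSym.at_one, Int.cast_one, one_mul]
      by_cases hP : y' - y₀ ∈ F.P
      · rw [if_pos hP]
        obtain ⟨n, hn⟩ := (F.mem_P_iff _).1 hP
        have hp' : (0 : ℤ) < p := by exact_mod_cast (Fact.out : p.Prime).pos
        have h7 := Int.emod_nonneg n hp'.ne'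
        have h8 := Int.emod_lt_of_pos n hp'
        have h6 : ∀ b : ℕ, b ∈ Finset.range p →
            (((n : F.GR) * p = b * p) ↔ b = (n % p).toNat) := fun b hb => by
          have h9 : ((n : F.GR) * p = b * p) ↔ (p : ℤ) ∣ n - b := by
            rw [← F.p_mul_intCast_eq_zero_iff, ← sub_eq_zero, ← sub_mul, mul_comm]
            push_cast
            rfl
          have hb' : (b : ℤ) < p := by exact_mod_cast Finset.mem_range.1 hb
          rw [h9, Int.dvd_iff_emod_eq_zero, ← Int.emod_eq_emod_iff_emod_sub_eq_zero,
             Int.emod_eq_of_lt (Int.natCast_nonneg b) hb']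
          omega
        rw [hn, Finset.sum_congr rfl fun b hb => by rw [if_congr (h6 b hb) rfl rfl],
          Finset.sum_ite_eq_of_mem' _ _ _ (Finset.mem_range.2 (by omega))]
      · rw [if_neg hP]
        refine Finset.sum_eq_zero fun b _ => if_neg fun h => hP ((F.mem_P_iff _).2 ⟨b, ?_⟩)
        rw [h, Int.cast_natCast]
    · intro a ha ha1
      refine Finset.sum_eq_zero fun b _ => ?_
      rw [if_neg, mul_zero]
      exact fun h => ha1 (eq_and_eq_one hl₀ hl₀ ha (key _ _ h)).2
    · intro l hl hne
      refine Finset.sum_eq_zero fun a ha => Finset.sum_eq_zero fun b _ => ?_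
      rw [if_neg, mul_zero]
      exact fun h => hne (eq_and_eq_one hl hl₀ ha (key _ _ h)).1
  rw [h4] at h3
  have h6 := congrArg (Int.cast (R := ℂ)) (legendreSym_mul_self (not_dvd_neg_one (p := p)))
  have hc := congrArg (Int.cast (R := ℂ)) (gaussRatio_sq (F := F) hp)
  push_cast at h3 h6 hc
  have h7 : (p : ℂ) ^ 2 * ∑ y, (F.lam (y + y₀) : ℂ) * F.lam (y + y') =
      p ^ (4 * α + 2) * (if y' - y₀ ∈ F.P then 1 else 0) - p ^ (2 * α + 2) := by
    set T := ∑ y, (F.lam (y + y₀) : ℂ) * F.lam (y + y') with hT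
    linear_combination (-1 : ℂ) * h3 - (p * legendreSym p (-1) * (F.gaussRatio ^ 2 + T)) * F.gauss_sq hp - (p ^ 2 * (F.gaussRatio ^ 2 + T)) * h6 - p ^ 2 * hc
  split_ifs at h7 ⊢ <;> exact_mod_cast h7

end Frame

end GSHDS

end

/-! ### Identities in the group ring of K. -/

noncomputable section

namespace GSHDS

section GroupRing

variable {X : Type*}

lemma ofFun_add [Finite X] (f g : X → ℤ) : ofFun (fun x => f x + g x) = ofFun f + ofFun g := by
  ext x
  simp

lemma ofFun_sub [Finite X] (f g : X → ℤ) : ofFun (fun x => f x - g x) = ofFun f - ofFun g := by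
  ext x
  simp

lemma ofFun_smul [Finite X] (n : ℤ) (f : X → ℤ) : ofFun (fun x => n * f x) = n • ofFun f := by
  ext x
  simp

lemma ofSet_univ [Finite X] : ofSet (Set.univ : Set X) = ofFun fun _ => 1 := by
  simp [ofSet]

open Classical in
lemma one_eq_ofFun [Finite X] [AddCommGroup X] :
    (1 : AddMonoidAlgebra ℤ X) = ofFun fun x => if x = 0 then 1 else 0 := by
  ext x
  rw [AddMonoidAlgebra.one_def]
  simp [Finsupp.single_apply, eq_comm]

end GroupRing

namespace Frame

variable {p α : ℕ} [Fact p.Prime] {F : Frame p α}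

variable (F) in
/-- The element `∑_k (∑_l f(l (1 + y_k))) x^k` of the group ring of `K`. -/
def collect (f : F.GR → ℤ) : AddMonoidAlgebra ℤ F.K :=
  ofFun fun k => ∑ l ∈ F.S, f (F.pt l (Quotient.out k))

lemma lam_congr {y y' : L p α} (h : (QuotientAddGroup.mk y : F.K) = QuotientAddGroup.mk y') :
    F.lam y = F.lam y' :=
  Finset.sum_congr rfl fun _ _ => F.sym_isHomogeneous.pt_congr _ h

lemma mk_out_add_out (k k' : F.K) :
    (QuotientAddGroup.mk (Quotient.out k + Quotient.out k') : F.K) = k + k' := by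
  rw [QuotientAddGroup.mk_add]
  congr 1 <;> exact QuotientAddGroup.out_eq' _

lemma lam_out_add (k k' : F.K) :
    F.lam (Quotient.out (k + k')) = F.lam (Quotient.out k + Quotient.out k') :=
  lam_congr ((QuotientAddGroup.out_eq' _).trans (mk_out_add_out k k').symm)

lemma L₀_eq : F.L₀ = ofFun fun k : F.K => F.lam (Quotient.out k) := rfl

lemma mk_add_of_mem (y : L p α) {z : L p α} (hz : z ∈ F.P) :
    (QuotientAddGroup.mk (y + z) : F.K) = QuotientAddGroup.mk y :=
  QuotientAddGroup.mk_add_of_mem y hz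

open Classical in
lemma sum_K_lam_mul_lam (hp : p ≠ 2) (hα : 1 ≤ α) (k : F.K) :
    ∑ k' : F.K, F.lam (Quotient.out (k + k')) * F.lam (Quotient.out k') =
      p ^ (4 * α - 1) * (if k = 0 then 1 else 0) - p ^ (2 * α - 1) := by
  have h1 := sum_lam_mul_lam (F := F) hp 0 (Quotient.out k)
  rw [F.sum_L_eq_sum_K] at h1
  · have h2 : (Quotient.out k - 0 ∈ F.P) ↔ k = 0 := by
      rw [sub_zero, ← QuotientAddGroup.eq_zero_iff]
      exact Eq.congr_left (QuotientAddGroup.out_eq' k)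
    simp_rw [if_congr h2 rfl rfl, add_zero] at h1
    obtain ⟨β, rfl⟩ := Nat.exists_eq_add_of_le' hα
    have hp0 : (p : ℤ) ≠ 0 := by exact_mod_cast (Fact.out : p.Prime).ne_zero
    -- Two factors p come from `sum_lam_mul_lam`, the third from the cosets of `P`; α ≥ 1 keeps the
    -- truncated exponents honest.
    apply mul_left_cancel₀ (pow_ne_zero 3 hp0)
    rw [show 4 * (β + 1) - 1 = 4 * β + 3 by omega, show 2 * (β + 1) - 1 = 2 * β + 1 by omega]
    have h3 : ∀ k' : F.K, F.lam (Quotient.out (k + k')) * F.lam (Quotient.out k') =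
        F.lam (Quotient.out k') * F.lam (Quotient.out k' + Quotient.out k) := fun k' => by
      rw [lam_out_add, add_comm (Quotient.out k), mul_comm]
    simp_rw [h3]
    linear_combination h1
  · intro y z hz
    rw [add_zero, add_zero, add_right_comm, lam_congr (mk_add_of_mem y hz),
      lam_congr (mk_add_of_mem _ hz)]

lemma L₀_mul_powMap (hp : p ≠ 2) (hα : 1 ≤ α) :
    F.L₀ * powMap (-1) F.L₀ = (p ^ (4 * α - 1) : ℤ) • (1 : AddMonoidAlgebra ℤ F.K)
      - (p ^ (2 * α - 1) : ℤ) • ofSet (Set.univ : Set F.K) := by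
  classical
  rw [L₀_eq, ofFun_mul_powMap_neg_one]
  simp_rw [sum_K_lam_mul_lam hp hα]
  rw [ofSet_univ, one_eq_ofFun, ← ofFun_smul, ← ofFun_smul, ← ofFun_sub]
  simp_rw [mul_one]
  congr!

/-- The square of the total is the sum of all autocorrelations, p^{4α-1} - p^{2α} p^{2α-1} = 0. -/
lemma sum_lam_eq_zero (hp : p ≠ 2) (hα : 1 ≤ α) : ∑ k : F.K, F.lam (Quotient.out k) = 0 := by
  classical
  have h1 : ∑ k : F.K, ∑ k' : F.K, F.lam (Quotient.out (k + k')) * F.lam (Quotient.out k') =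
      (∑ k : F.K, F.lam (Quotient.out k)) * ∑ k : F.K, F.lam (Quotient.out k) := by
    rw [Finset.sum_comm, Finset.mul_sum]
    refine Finset.sum_congr rfl fun k' _ => ?_
    rw [← Finset.sum_mul]
    congr 1
    exact Equiv.sum_comp (Equiv.addRight k') fun k => F.lam (Quotient.out k)
  simp_rw [sum_K_lam_mul_lam hp hα] at h1
  rw [Finset.sum_sub_distrib, ← Finset.mul_sum, Finset.sum_ite_eq' Finset.univ (0 : F.K),
    if_pos (Finset.mem_univ _), Finset.sum_const, Finset.card_univ, ← Nat.card_eq_fintype_card,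
    F.card_K, nsmul_eq_mul] at h1
  have h2 : (p : ℤ) ^ (4 * α - 1) * 1 - ((p ^ (2 * α) : ℕ) : ℤ) * p ^ (2 * α - 1) = 0 := by
    push_cast
    rw [← pow_add, show 2 * α + (2 * α - 1) = 4 * α - 1 by omega]
    ring
  rw [h2] at h1
  exact mul_self_eq_zero.1 h1.symm

/-- This is `sum_hat_pt` with the Gauss sum cancelled; the factor p in front of L₀ is the order of
`P`. It serves both pairs (e, ν) and (ν, e). -/
lemma smul_collect_eq (hp : p ≠ 2) {f g : F.GR → ℤ} (hf : F.IsHomogeneous f) (C : ℤ)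
    (h : ∀ x, F.hat (fun x => (f x : ℂ)) x = C * F.gauss * g x) :
    C • F.collect g = (F.gaussRatio * ∑ l ∈ F.S, f (p * l)) • ofSet (Set.univ : Set F.K) +
      (p : ℤ) • (F.L₀ * powMap (-1) (F.collect f)) := by
  rw [L₀_eq, collect, collect, ofFun_mul_powMap_neg_one, ofSet_univ, ← ofFun_smul, ← ofFun_smul,
    ← ofFun_smul, ← ofFun_add]
  congr 1
  funext k
  have h1 := sum_hat_pt hp hf.intCast (Quotient.out k)
  simp_rw [h] at h1
  rw [← Finset.mul_sum, mul_comm (C : ℂ), mul_assoc] at h1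
  replace h1 := mul_left_cancel₀ (F.gauss_ne_zero hp) h1
  have h2 : C * ∑ l ∈ F.S, g (F.pt l (Quotient.out k)) = F.gaussRatio * ∑ l ∈ F.S, f (p * l) +
      ∑ y, (∑ l ∈ F.S, f (F.pt l y)) * F.lam (y + Quotient.out k) := by
    exact_mod_cast h1
  rw [h2, F.sum_L_eq_sum_K]
  · rw [mul_one]
    congr 2
    exact Finset.sum_congr rfl fun k' _ => by rw [lam_out_add, add_comm (Quotient.out k), mul_comm]
  · intro y z hz
    rw [add_right_comm, lam_congr (mk_add_of_mem _ hz)]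
    congr 1
    exact Finset.sum_congr rfl fun l _ => hf.pt_add l y hz

/-- The coefficients of L₀ sum to 0, so χ₀ retains only the constant term, multiplied by |K| =
p^{2α}. -/
lemma principal_collect (hp : p ≠ 2) (hα : 1 ≤ α) {f g : F.GR → ℤ} (hf : F.IsHomogeneous f) (C : ℤ)
    (h : ∀ x, F.hat (fun x => (f x : ℂ)) x = C * F.gauss * g x) :
    C * principal (F.collect g) = p ^ (2 * α) * (F.gaussRatio * ∑ l ∈ F.S, f (p * l)) := by
  have h1 := smul_collect_eq hp hf C h
  rw [L₀_eq, collect, collect, ofFun_mul_powMap_neg_one, ofSet_univ, ← ofFun_smul, ← ofFun_smul,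
    ← ofFun_smul, ← ofFun_add] at h1
  have h2 := congrArg principal h1
  rw [principal_ofFun, principal_ofFun, ← Finset.mul_sum] at h2
  rw [collect, principal_ofFun, h2, Finset.sum_add_distrib, Finset.sum_const, Finset.card_univ,
    ← Nat.card_eq_fintype_card, F.card_K, nsmul_eq_mul, ← Finset.mul_sum, Finset.sum_comm]
  have h3 : ∀ k' : F.K, ∑ k : F.K, F.lam (Quotient.out (k + k')) *
      ∑ l ∈ F.S, f (F.pt l (Quotient.out k')) = 0 := fun k' => by
    have h4 : ∑ k : F.K, F.lam (Quotient.out (k + k')) = ∑ k : F.K, F.lam (Quotient.out k) :=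
      Equiv.sum_comp (Equiv.addRight k') fun k => F.lam (Quotient.out k)
    rw [← Finset.sum_mul, h4, sum_lam_eq_zero hp hα, zero_mul]
  rw [Finset.sum_eq_zero fun k' _ => h3 k']
  push_cast
  ring

variable (F) in
lemma exists_sign (hp : p ≠ 2) : ∃ ε₀ : ℤ, (ε₀ = 1 ∨ ε₀ = -1) ∧ F.gaussRatio = p ^ α * ε₀ := by
  have h := gaussRatio_sq (F := F) hp
  rw [mul_comm 2 α, pow_mul, sq_eq_sq_iff_eq_or_eq_neg] at h
  rcases h with h | h
  · exact ⟨1, Or.inl rfl, by rw [h, mul_one]⟩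
  · exact ⟨-1, Or.inr rfl, by rw [h, mul_neg_one]⟩

end Frame

end GSHDS

end

/-! ### Character values and multipliers of a GSHDS. -/

noncomputable section

namespace GSHDS

open Polynomial in
-- The Galois conjugation ζ ↦ ζ^r in integral form: ζ and ζ^r have the same minimal polynomial.
lemma aeval_pow_eq_zero {n r : ℕ} (hn : 0 < n) {ζ : ℂ} (hζ : IsPrimitiveRoot ζ n)
    (hr : r.Coprime n) {Q : ℤ[X]} (h : aeval ζ Q = 0) : aeval (ζ ^ r) Q = 0 := by
  have h1 : minpoly ℤ ζ ∣ Q := minpoly.isIntegrallyClosed_dvd (hζ.isIntegral hn) h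
  rw [hζ.minpoly_eq_pow_coprime hr] at h1
  exact aeval_eq_zero_of_dvd_aeval_eq_zero h1 (minpoly.aeval ℤ (ζ ^ r))

section Character

variable {X : Type*} [AddCommGroup X] [Fintype X]

/-- Evaluation of the integral group ring at a character. -/
def evalChar (χ : AddChar X ℂ) : AddMonoidAlgebra ℤ X →ₐ[ℤ] ℂ :=
  AddMonoidAlgebra.lift ℤ ℂ X χ.toMonoidHom

lemma evalChar_single (χ : AddChar X ℂ) (x : X) (a : ℤ) :
    evalChar χ (AddMonoidAlgebra.single x a) = a * χ x := by
  rw [evalChar, AddMonoidAlgebra.lift_single, zsmul_eq_mul]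
  rfl

lemma evalChar_ofFun (χ : AddChar X ℂ) (f : X → ℤ) : evalChar χ (ofFun f) = ∑ g, f g * χ g := by
  rw [ofFun_eq_sum, map_sum]
  exact Finset.sum_congr rfl fun g _ => evalChar_single χ g _

/-- Orthogonality of characters: multiply by χ(-T g₀) and sum over χ. -/
lemma eq_zero_of_forall_sum_eq_zero {T : X → X} (hT : Function.Injective T) {c : X → ℂ}
    (h : ∀ χ : AddChar X ℂ, ∑ g, c g * χ (T g) = 0) (g₀ : X) : c g₀ = 0 := by
  classical
  have h1 : ∑ χ : AddChar X ℂ, (∑ g, c g * χ (T g)) * χ (-T g₀) = 0 :=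
    Finset.sum_eq_zero fun χ _ => by rw [h χ, zero_mul]
  simp_rw [Finset.sum_mul, mul_assoc, ← AddChar.map_add_eq_mul] at h1
  rw [Finset.sum_comm] at h1
  simp_rw [← Finset.mul_sum, AddChar.sum_apply_eq_ite, ← sub_eq_add_neg, sub_eq_zero,
    hT.eq_iff] at h1
  simpa using h1

end Character

section Multiplier

variable {X : Type*} [AddCommGroup X] {p : ℕ} [Fact p.Prime]

lemma zsmul_congr_of_exponent (hX : AddMonoid.exponent X = p ^ 2) {a b : ℤ}
    (h : (p : ℤ) ^ 2 ∣ a - b) (g : X) : a • g = b • g := by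
  rw [← sub_eq_zero, ← sub_smul]
  obtain ⟨c, hc⟩ := h
  have h1 : (p ^ 2 : ℕ) • g = 0 := by rw [← hX]; exact AddMonoid.exponent_nsmul_eq_zero g
  rw [hc, mul_comm, mul_zsmul]
  have h2 : ((p : ℤ) ^ 2) • g = 0 := by rw [← Nat.cast_pow, natCast_zsmul, h1]
  rw [h2, zsmul_zero]

lemma exists_inverse_sq {n : ℤ} (hn : ¬ (p : ℤ) ∣ n) : ∃ m : ℤ, (p : ℤ) ^ 2 ∣ m * n - 1 := by
  obtain ⟨a, b, h⟩ : IsCoprime ((p : ℤ) ^ 2) n :=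
    ((Nat.prime_iff_prime_int.1 Fact.out).coprime_iff_not_dvd.2 hn).pow_left
  exact ⟨b, -a, by linear_combination h⟩

lemma zsmul_injective_of_exponent (hX : AddMonoid.exponent X = p ^ 2) {n : ℤ}
    (hn : ¬ (p : ℤ) ∣ n) : Function.Injective (fun g : X => n • g) := by
  obtain ⟨m, hm⟩ := exists_inverse_sq hn
  intro a b hab
  have h1 : ∀ g : X, m • n • g = g := fun g => by
    rw [← mul_zsmul, mul_comm, mul_comm n, zsmul_congr_of_exponent hX hm, one_zsmul]
  rw [← h1 a, ← h1 b]
  exact congrArg (m • ·) hab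

/-- A quadratic residue modulo `p` becomes the square of a unit modulo `p²` after
multiplication with such a square. -/
lemma exists_sq_of_legendreSym_eq_one (hp : p ≠ 2) {n : ℤ} (hn : legendreSym p n = 1) :
    ∃ a b : ℤ, ¬ (p : ℤ) ∣ a ∧ ¬ (p : ℤ) ∣ b ∧ (p : ℤ) ^ 2 ∣ n * b ^ 2 - a ^ 2 := by
  have hn0 : ¬ (p : ℤ) ∣ n := by
    intro h
    rw [← ZMod.intCast_zmod_eq_zero_iff_dvd, ← legendreSym.eq_zero_iff, hn] at h
    exact one_ne_zero h
  have hpr := Nat.prime_iff_prime_int.1 (Fact.out : p.Prime)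
  rw [legendreSym.eq_one_iff p (by rwa [Ne, ZMod.intCast_zmod_eq_zero_iff_dvd])] at hn
  obtain ⟨c, hc⟩ := hn
  obtain ⟨c, rfl⟩ := ZMod.intCast_surjective c
  have h1 : (p : ℤ) ∣ n - c ^ 2 := by
    rw [← ZMod.intCast_zmod_eq_zero_iff_dvd]
    push_cast
    rw [hc]
    ring
  have hc0 : ¬ (p : ℤ) ∣ c := fun h => hn0 ((dvd_sub_left (h.trans (dvd_pow_self c two_ne_zero))).1 h1)
  have h2 := dvd_sub_pow_of_dvd_sub h1 1
  rw [pow_one] at h2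
  obtain ⟨r, hr⟩ := odd_of_ne_two hp
  -- From n ≡ c² mod p follows n^p ≡ (c^p)² mod p², and n^p = n (n^r)² with r = (p-1)/2.
  refine ⟨c ^ p, n ^ r, fun h => hc0 (hpr.dvd_of_dvd_pow h), fun h => hn0 (hpr.dvd_of_dvd_pow h), ?_⟩
  have h3 : n * (n ^ r) ^ 2 - (c ^ p) ^ 2 = n ^ p - (c ^ 2) ^ p := by
    rw [← pow_mul c, ← pow_mul c, mul_comm 2 p, ← pow_mul, ← pow_succ', mul_comm r, ← hr]
  rw [h3]
  exact h2

end Multiplier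

/-- The function that is `1` on `D`, `0` at the identity and `-1` elsewhere. -/
def sgn {X : Type*} [AddCommGroup X] (D : Set X) (g : X) : ℤ :=
  open Classical in if g = 0 then 0 else if g ∈ D then 1 else -1

/-- The Fourier transform of `sgn D`. -/
def sgnHat {X : Type*} [AddCommGroup X] [Fintype X] (D : Set X) (χ : AddChar X ℂ) : ℂ :=
  ∑ g, sgn D g * χ g

namespace IsGSHDS

variable {X : Type*} [AddCommGroup X] [Fintype X] {p : ℕ} [Fact p.Prime] {n₀ : ℤ} {D : Set X}

lemma not_dvd (hD : IsGSHDS n₀ D) (hX : AddMonoid.exponent X = p ^ 2) : ¬ (p : ℤ) ∣ n₀ := by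
  intro h
  have h1 := hD.isUnit
  rw [hX] at h1
  have h2 := h1.map (redCoeff p)
  rw [map_intCast, (ZMod.intCast_zmod_eq_zero_iff_dvd n₀ p).2 h] at h2
  exact not_isUnit_zero h2

/-- A residue modulo p prime to p is already a square modulo p², contrary to the choice of n₀. -/
lemma legendreSym_eq (hD : IsGSHDS n₀ D) (hp : p ≠ 2) (hX : AddMonoid.exponent X = p ^ 2) :
    legendreSym p n₀ = -1 := by
  refine (legendreSym_eq_one_or_neg_one (hD.not_dvd hX)).resolve_left fun h => ?_
  obtain ⟨a, b, -, hb, hab⟩ := exists_sq_of_legendreSym_eq_one hp h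
  apply hD.nonresidue
  rw [hX]
  obtain ⟨m, hm⟩ := exists_inverse_sq hb
  refine ⟨((a * m : ℤ) : ZMod (p ^ 2)), ?_⟩
  rw [← Int.cast_mul, ZMod.intCast_eq_intCast_iff_dvd_sub]
  push_cast
  obtain ⟨u, hu⟩ := hab
  obtain ⟨v, hv⟩ := hm
  refine ⟨-m ^ 2 * u + n₀ * (m * b + 1) * v, ?_⟩
  linear_combination (-m ^ 2) * hu + (n₀ * (m * b + 1)) * hv

open Classical in
lemma indicator_add (hD : IsGSHDS n₀ D) (hX : AddMonoid.exponent X = p ^ 2) (g : X) :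
    ((if n₀ • g ∈ D then 1 else 0) + (if g ∈ D then 1 else 0) : ℤ) = 1 - if g = 0 then 1 else 0 := by
  have hinj := zsmul_injective_of_exponent (X := X) hX (hD.not_dvd hX)
  have h1 := congrArg (fun A => A.coeff (n₀ • g)) hD.skew
  have h2 : (powMap n₀ (ofSet D)).coeff (n₀ • g) = if g ∈ D then 1 else 0 := by
    rw [powMap, AddMonoidAlgebra.mapDomain]
    exact Finsupp.mapDomain_apply hinj _ g
  rw [ofSet_univ, one_eq_ofFun] at h1
  simp only [AddMonoidAlgebra.coeff_add, AddMonoidAlgebra.coeff_sub, Finsupp.add_apply,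
    Finsupp.sub_apply, h2, coeff_ofFun] at h1
  have h3 : n₀ • g = 0 ↔ g = 0 := ⟨fun h => hinj (by simpa using h), fun h => by rw [h, zsmul_zero]⟩
  simp only [h3] at h1
  exact h1

lemma zero_notMem (hD : IsGSHDS n₀ D) (hX : AddMonoid.exponent X = p ^ 2) : (0 : X) ∉ D := by
  intro h
  have h1 := hD.indicator_add hX 0
  simp [h] at h1

lemma sgn_zsmul_self (hD : IsGSHDS n₀ D) (hX : AddMonoid.exponent X = p ^ 2) (g : X) :
    sgn D (n₀ • g) = -sgn D g := by
  classical
  have hinj := zsmul_injective_of_exponent (X := X) hX (hD.not_dvd hX)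
  have h3 : n₀ • g = 0 ↔ g = 0 := ⟨fun h => hinj (by simpa using h), fun h => by rw [h, zsmul_zero]⟩
  have h1 := hD.indicator_add hX g
  simp only [sgn, h3]
  split_ifs at h1 ⊢ <;> simp_all

open Classical in
lemma sgn_eq (hD : IsGSHDS n₀ D) (hX : AddMonoid.exponent X = p ^ 2) (g : X) :
    sgn D g = 2 * (if g ∈ D then 1 else 0) - 1 + if g = 0 then 1 else 0 := by
  rw [sgn]
  by_cases h : g = 0
  · subst h
    simp [hD.zero_notMem hX]
  · simp only [h, if_false]
    split_ifs <;> rfl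

open Classical in
lemma sgnHat_eq (hD : IsGSHDS n₀ D) (hX : AddMonoid.exponent X = p ^ 2) (χ : AddChar X ℂ) :
    sgnHat D χ = 2 * (∑ g, (if g ∈ D then 1 else 0 : ℤ) * χ g) - (∑ g, χ g) + 1 := by
  rw [sgnHat, Finset.mul_sum, ← Finset.sum_sub_distrib]
  have h1 : (1 : ℂ) = ∑ g : X, (if g = 0 then 1 else 0 : ℤ) * χ g := by simp
  rw [h1, ← Finset.sum_add_distrib]
  refine Finset.sum_congr rfl fun g _ => ?_
  rw [hD.sgn_eq hX g]
  push_cast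
  ring

/-- For χ ≠ 1 the numbers χ(D) and χ(D^(n₀)) have sum -1 and product k₀ - λ, so (2χ(D) + 1)² is the
discriminant of a fixed quadratic. -/
lemma sgnHat_sq_const (hD : IsGSHDS n₀ D) (hX : AddMonoid.exponent X = p ^ 2) :
    ∃ N : ℂ, ∀ χ : AddChar X ℂ, χ ≠ 1 → sgnHat D χ ^ 2 = N := by
  classical
  obtain ⟨lam, h⟩ := hD.product
  refine ⟨1 - 4 * (((D ∩ (fun g => (-n₀) • g) '' D).ncard : ℤ) - lam : ℤ), fun χ hχ => ?_⟩
  have h0 : ∑ g, χ g = 0 := AddChar.sum_eq_zero_of_ne_one hχ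
  have h1 := congrArg (evalChar χ) h
  have h2 := congrArg (evalChar χ) hD.skew
  have h3 : evalChar χ (ofSet Set.univ) = 0 := by
    rw [ofSet_univ, evalChar_ofFun]
    simpa using h0
  rw [map_mul, map_add, map_zsmul, map_zsmul, map_one, h3] at h1
  rw [map_add, map_sub, map_one, h3] at h2
  have h4 := hD.sgnHat_eq hX χ
  rw [h0, ← evalChar_ofFun, ← ofSet] at h4
  rw [zsmul_eq_mul, smul_zero] at h1
  rw [h4]
  linear_combination (-4 : ℂ) * h1 + 4 * (evalChar χ (ofSet D)) * h2

open Polynomial in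
-- The values at χ and χ^r differ by a sign δ. Conjugating this relation by ζ ↦ ζ^r shows that
-- passing to χ^{r²} costs δ² = 1.
lemma sgnHat_pow_sq (hD : IsGSHDS n₀ D) (hX : AddMonoid.exponent X = p ^ 2) {r : ℕ}
    (hr : ¬ (p : ℤ) ∣ r) (χ : AddChar X ℂ) : ∑ g, sgn D g * χ (r ^ 2 • g) = sgnHat D χ := by
  by_cases hχ : χ = 1
  · subst hχ
    simp [sgnHat]
  obtain ⟨N, hN⟩ := hD.sgnHat_sq_const hX
  have hpos : 0 < p ^ 2 := pow_pos (Fact.out : p.Prime).pos 2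
  have : NeZero (p ^ 2) := ⟨hpos.ne'⟩
  have hζ := Complex.isPrimitiveRoot_exp (p ^ 2) hpos.ne'
  set ζ := Complex.exp (2 * Real.pi * Complex.I / (p ^ 2 : ℕ))
  have hcop : r.Coprime (p ^ 2) := by
    rw [Int.natCast_dvd_natCast] at hr
    exact (((Fact.out : p.Prime).coprime_iff_not_dvd.2 hr).pow_left 2).symm
  have h1 : ∀ g, ∃ j : ℕ, χ g = ζ ^ j := fun g => by
    have h2 : χ g ^ (p ^ 2) = 1 := by
      rw [← AddChar.map_nsmul_eq_pow, ← hX, AddMonoid.exponent_nsmul_eq_zero,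
        AddChar.map_zero_eq_one]
    obtain ⟨j, -, hj⟩ := hζ.eq_pow_of_pow_eq_one h2
    exact ⟨j, hj.symm⟩
  choose j hj using h1
  -- An integral polynomial whose value at ζ^m is the transform of `sgn D` at χ^m.
  let Q : ℤ[X] := ∑ g, C (sgn D g) * Polynomial.X ^ (j g)
  have hQ : ∀ m : ℕ, aeval (ζ ^ m) Q = ∑ g, sgn D g * χ (m • g) := fun m => by
    simp only [Q, map_sum, map_mul, aeval_C, map_pow, aeval_X]
    refine Finset.sum_congr rfl fun g _ => ?_
    rw [AddChar.map_nsmul_eq_pow, hj, ← pow_mul, ← pow_mul, mul_comm m]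
    rfl
  have hQ1 : aeval ζ Q = sgnHat D χ := by
    have := hQ 1
    simpa [sgnHat] using this
  have hQr : aeval (ζ ^ r) Q = sgnHat D (χ ^ r) := by
    rw [hQ r, sgnHat]
    exact Finset.sum_congr rfl fun g _ => by rw [AddChar.pow_apply, AddChar.map_nsmul_eq_pow]
  have hχr : χ ^ r ≠ 1 := by
    intro h
    apply hχ
    ext g
    obtain ⟨m, hm⟩ := exists_inverse_sq hr
    have h2 := DFunLike.congr_fun h (m • g)
    rw [AddChar.pow_apply, ← AddChar.map_nsmul_eq_pow, AddChar.one_apply, ← natCast_zsmul,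
      ← mul_zsmul, mul_comm, zsmul_congr_of_exponent hX (by rwa [mul_comm] at hm), one_zsmul] at h2
    rw [h2, AddChar.one_apply]
  obtain ⟨δ, hδ, hδ2⟩ : ∃ δ : ℤ, sgnHat D (χ ^ r) = δ * sgnHat D χ ∧ δ * δ = 1 := by
    rcases sq_eq_sq_iff_eq_or_eq_neg.1 ((hN _ hχr).trans (hN _ hχ).symm) with h | h
    · exact ⟨1, by simp [h], rfl⟩
    · exact ⟨-1, by simp [h], rfl⟩
  have h3 := aeval_pow_eq_zero hpos hζ hcop (Q := expand ℤ r Q - C δ * Q) (by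
    rw [map_sub, map_mul, expand_aeval, aeval_C, hQr, hQ1, hδ]
    exact sub_self _)
  rw [map_sub, map_mul, expand_aeval, aeval_C, hQr, hδ, ← pow_mul, ← pow_two, hQ] at h3
  have h4 : (δ : ℂ) * δ = 1 := by exact_mod_cast hδ2
  have h5 : (algebraMap ℤ ℂ) δ = δ := rfl
  rw [h5] at h3
  linear_combination h3 + sgnHat D χ * h4

lemma sgn_sq_zsmul (hD : IsGSHDS n₀ D) (hX : AddMonoid.exponent X = p ^ 2) {r : ℤ}
    (hr : ¬ (p : ℤ) ∣ r) (g : X) : sgn D (r ^ 2 • g) = sgn D g := by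
  suffices h : ∀ s : ℕ, ¬ (p : ℤ) ∣ s → ∀ g, sgn D (s ^ 2 • g) = sgn D g by
    have h1 := h r.natAbs (by rwa [Int.natCast_natAbs, dvd_abs]) g
    rw [← natCast_zsmul] at h1
    push_cast at h1
    rwa [sq_abs] at h1
  intro s hs g
  have hs2 : ¬ (p : ℤ) ∣ ((s ^ 2 : ℕ) : ℤ) := by
    push_cast
    exact fun h => hs ((Nat.prime_iff_prime_int.1 Fact.out).dvd_of_dvd_pow h)
  have hinj : Function.Injective (fun g : X => s ^ 2 • g) := by
    have := zsmul_injective_of_exponent (X := X) hX hs2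
    simpa only [natCast_zsmul] using this
  have hbij := Finite.injective_iff_bijective.1 hinj
  have h1 := eq_zero_of_forall_sum_eq_zero hinj
    (c := fun g => (sgn D (s ^ 2 • g) : ℂ) - sgn D g) (fun χ => by
      simp_rw [sub_mul]
      rw [Finset.sum_sub_distrib, hD.sgnHat_pow_sq hX hs, sgnHat, sub_eq_zero]
      exact (Equiv.ofBijective _ hbij).sum_comp (fun g => (sgn D g : ℂ) * χ g)) g
  exact_mod_cast sub_eq_zero.1 h1

/-- Residues are quotients of squares modulo p² and so act trivially. For a nonresidue n the product
n₀ n is a residue, and n₀ itself flips the sign. -/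
lemma sgn_zsmul (hD : IsGSHDS n₀ D) (hp : p ≠ 2) (hX : AddMonoid.exponent X = p ^ 2) {n : ℤ}
    (hn : ¬ (p : ℤ) ∣ n) (g : X) : sgn D (n • g) = legendreSym p n * sgn D g := by
  have key : ∀ m : ℤ, legendreSym p m = 1 → ∀ g, sgn D (m • g) = sgn D g := by
    intro m hm g
    obtain ⟨a, b, ha, hb, hab⟩ := exists_sq_of_legendreSym_eq_one hp hm
    rw [← hD.sgn_sq_zsmul hX hb, ← mul_zsmul, mul_comm, zsmul_congr_of_exponent hX (by simpa [mul_comm] using hab),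
      hD.sgn_sq_zsmul hX ha]
  rcases legendreSym_eq_one_or_neg_one hn with h | h
  · rw [key n h, h, one_mul]
  · have h1 := key (n₀ * n) (by rw [legendreSym.mul, h, hD.legendreSym_eq hp hX]; rfl) g
    rw [mul_zsmul, hD.sgn_zsmul_self hX] at h1
    rw [h, ← h1]
    ring

lemma sgnHat_one (hD : IsGSHDS n₀ D) (hX : AddMonoid.exponent X = p ^ 2) : sgnHat D 1 = 0 := by
  have hinj := zsmul_injective_of_exponent (X := X) hX (hD.not_dvd hX)
  have h1 := (Equiv.ofBijective _ (Finite.injective_iff_bijective.1 hinj)).sum_comp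
    (fun g => (sgn D g : ℂ))
  simp only [Equiv.ofBijective_apply, hD.sgn_zsmul_self hX] at h1
  simp only [sgnHat, AddChar.one_apply, mul_one]
  push_cast at h1
  rw [Finset.sum_neg_distrib] at h1
  linear_combination (-1 / 2 : ℂ) * h1

lemma sgnHat_zpow (hD : IsGSHDS n₀ D) (hp : p ≠ 2) (hX : AddMonoid.exponent X = p ^ 2) {n : ℤ}
    (hn : ¬ (p : ℤ) ∣ n) (χ : AddChar X ℂ) :
    sgnHat D (χ ^ n) = legendreSym p n * sgnHat D χ := by
  have hinj := zsmul_injective_of_exponent (X := X) hX hn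
  have h1 := (Equiv.ofBijective _ (Finite.injective_iff_bijective.1 hinj)).sum_comp
    (fun g => (sgn D g : ℂ) * χ g)
  simp only [Equiv.ofBijective_apply, hD.sgn_zsmul hp hX hn] at h1
  rw [sgnHat, sgnHat, ← h1, Finset.mul_sum]
  refine Finset.sum_congr rfl fun g _ => ?_
  have h2 := congrArg (Int.cast (R := ℂ)) (legendreSym_mul_self hn)
  push_cast at h2 ⊢
  rw [AddChar.zpow_apply, AddChar.map_zsmul_eq_zpow]
  linear_combination (-(sgn D g * χ g ^ n)) * h2

lemma sgn_mul_self (D : Set X) {g : X} (hg : g ≠ 0) : sgn D g * sgn D g = 1 := by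
  rw [sgn, if_neg hg]
  split_ifs <;> rfl

/-- The constant is found by averaging: the sum of the squares over all χ is |X| ∑ sgn(g) sgn(-g) =
|X| (-1/p)(|X| - 1), and the trivial character contributes 0. -/
lemma sgnHat_sq (hD : IsGSHDS n₀ D) (hp : p ≠ 2) (hX : AddMonoid.exponent X = p ^ 2)
    {χ : AddChar X ℂ} (hχ : χ ≠ 1) : sgnHat D χ ^ 2 = legendreSym p (-1) * Fintype.card X := by
  classical
  obtain ⟨N, hN⟩ := hD.sgnHat_sq_const hX
  rw [hN χ hχ]
  have hcard : ((Fintype.card X : ℂ) - 1) ≠ 0 := by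
    intro h
    rw [sub_eq_zero, Nat.cast_eq_one, Fintype.card_eq_one_iff_nonempty_unique] at h
    obtain ⟨u⟩ := h
    apply hχ
    ext g
    rw [Subsingleton.elim g 0, AddChar.map_zero_eq_one, AddChar.map_zero_eq_one]
  have h1 : ∑ χ : AddChar X ℂ, sgnHat D χ ^ 2 = (Fintype.card X - 1) * N := by
    rw [← Finset.add_sum_erase _ _ (Finset.mem_univ (1 : AddChar X ℂ)), hD.sgnHat_one hX,
      Finset.sum_congr rfl fun χ hχ => hN χ (Finset.ne_of_mem_erase hχ), Finset.sum_const,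
      Finset.card_erase_of_mem (Finset.mem_univ _), Finset.card_univ, AddChar.card_eq, nsmul_eq_mul,
      Nat.cast_sub Fintype.card_pos]
    simp
  have h2 : ∑ χ : AddChar X ℂ, sgnHat D χ ^ 2 =
      Fintype.card X * ∑ g : X, (sgn D g : ℂ) * sgn D (-g) := by
    simp only [sgnHat, pow_two, Finset.sum_mul_sum]
    rw [Finset.sum_comm, Finset.mul_sum]
    refine Finset.sum_congr rfl fun g _ => ?_
    rw [Finset.sum_comm, Finset.sum_eq_single (-g)]
    · have h3 : ∀ χ : AddChar X ℂ, (sgn D g : ℂ) * χ g * (sgn D (-g) * χ (-g)) =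
          sgn D g * sgn D (-g) * χ 0 := fun χ => by
        rw [← add_neg_cancel g, AddChar.map_add_eq_mul]
        ring
      simp_rw [h3]
      rw [← Finset.mul_sum, AddChar.sum_apply_eq_ite, if_pos rfl]
      ring
    · intro b _ hb
      have h3 : ∀ χ : AddChar X ℂ, (sgn D g : ℂ) * χ g * (sgn D b * χ b) =
          sgn D g * sgn D b * χ (g + b) := fun χ => by
        rw [AddChar.map_add_eq_mul]
        ring
      simp_rw [h3]
      rw [← Finset.mul_sum, AddChar.sum_apply_eq_ite, if_neg, mul_zero]
      exact fun h => hb (eq_neg_of_add_eq_zero_right h)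
    · exact fun h => absurd (Finset.mem_univ _) h
  have h3 : ∑ g : X, (sgn D g : ℂ) * sgn D (-g) = legendreSym p (-1) * (Fintype.card X - 1) := by
    have h4 : ∀ g : X, (sgn D g : ℂ) * sgn D (-g) =
        legendreSym p (-1) * (1 - if g = 0 then 1 else 0) := fun g => by
      have h5 := hD.sgn_zsmul hp hX Frame.not_dvd_neg_one g
      rw [neg_one_zsmul] at h5
      rw [h5]
      by_cases hg : g = 0
      · simp [hg, sgn]
      · have h6 := congrArg (Int.cast (R := ℂ)) (sgn_mul_self D hg)
        push_cast at h6 ⊢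
        rw [if_neg hg]
        linear_combination (legendreSym p (-1) : ℂ) * h6
    simp_rw [h4]
    rw [← Finset.mul_sum, Finset.sum_sub_distrib]
    simp
  rw [h1, h3] at h2
  apply mul_left_cancel₀ hcard
  linear_combination h2

end IsGSHDS

end GSHDS

end

/-! ### The dual set, and the transform pair e, ν. -/

noncomputable section

namespace GSHDS

lemma exponent_G (p α : ℕ) [Fact p.Prime] : AddMonoid.exponent (G p α) = p ^ 2 := by
  refine Nat.dvd_antisymm ?_ ?_
  · rw [AddMonoid.exponent_dvd_iff_forall_nsmul_eq_zero]
    rintro ⟨a, h⟩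
    refine Prod.ext ?_ (funext fun i => ?_)
    · simp
    · simp
  · have h1 := AddMonoid.exponent_nsmul_eq_zero (G := G p α) (0, fun _ => 1)
    have h2 := congrFun (congrArg Prod.snd h1) 0
    rw [← ZMod.natCast_eq_zero_iff]
    simpa using h2

lemma card_G (p α : ℕ) [Fact p.Prime] : Fintype.card (G p α) = p ^ (4 * α + 3) := by
  rw [Fintype.card_prod, Fintype.card_fun, ZMod.card, ZMod.card, Fintype.card_fin, ← pow_mul,
    ← pow_succ']
  congr 1
  ring

namespace Frame

variable {p α : ℕ} [Fact p.Prime] {F : Frame p α} {n₀ : ℤ} {D : Set (G p α)}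

variable (F) in
/-- The function `sgn D` on the Galois ring. -/
def e (D : Set (G p α)) (x : F.GR) : ℤ := sgn D ((0 : ZMod p), F.κ.symm x)

lemma e_isHomogeneous (hp : p ≠ 2) (hD : IsGSHDS n₀ D) : F.IsHomogeneous (F.e D) := by
  intro n x hn
  have h1 : ((0 : ZMod p), F.κ.symm (n * x)) = n • ((0 : ZMod p), F.κ.symm x) := by
    rw [Prod.smul_mk, smul_zero, ← map_zsmul, zsmul_eq_mul]
  rw [e, h1, hD.sgn_zsmul hp (exponent_G p α) hn, Int.cast_id]
  rfl

lemma e_eq_d (D : Set (G p α)) {x : F.GR} (hx : x ≠ 0) : F.e D x = F.d D x := by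
  classical
  rw [e, sgn, if_neg, d]
  intro h
  apply hx
  rw [← map_eq_zero_iff _ F.κ.symm.injective]
  exact congrArg Prod.snd h

lemma p_mul_pt (l : F.GR) (y : L p α) : (p : F.GR) * F.pt l y = p * l := by
  rw [pt]
  linear_combination l * F.p_mul_κ y

lemma pt_ne_zero {l : F.GR} (hl : l ∈ F.S) (y : L p α) : F.pt l y ≠ 0 := by
  intro h
  have h1 := p_mul_pt l y
  rw [h, mul_zero] at h1
  exact p_mul_ne_zero (isUnit_of_mem hl) h1.symm

lemma A_eq_collect (D : Set (G p α)) : F.A D = F.collect (F.e D) := by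
  rw [A, collect]
  congr 1
  funext k
  exact Finset.sum_congr rfl fun l hl => (e_eq_d D (pt_ne_zero hl _)).symm

lemma a₀_eq (D : Set (G p α)) : F.a₀ D = ∑ l ∈ F.S, F.e D (p * l) :=
  Finset.sum_congr rfl fun _ hl => (e_eq_d D (p_mul_ne_zero (isUnit_of_mem hl))).symm

variable (F) in
/-- The value `√((-1/p) |G|)` of the transform of `sgn D` at the dual of `D`. -/
def root : ℂ := (p : ℂ) ^ (2 * α + 1) * F.gauss

lemma root_ne_zero (hp : p ≠ 2) : F.root ≠ 0 := by
  have hp0 : (p : ℂ) ≠ 0 := by exact_mod_cast (Fact.out : p.Prime).ne_zero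
  exact mul_ne_zero (pow_ne_zero _ hp0) (F.gauss_ne_zero hp)

lemma root_sq (hp : p ≠ 2) : F.root ^ 2 = legendreSym p (-1) * Fintype.card (G p α) := by
  rw [root, mul_pow, F.gauss_sq hp, card_G]
  push_cast
  ring

/-- Keeps the trivial character out of the dual set: there χ(D) = (|G| - 1)/2, which would force the
root to be |G|. -/
lemma root_ne_card (hp : p ≠ 2) : F.root ≠ Fintype.card (G p α) := by
  intro h
  have h1 := F.root_sq hp
  rw [h, pow_two] at h1
  have h0 : (Fintype.card (G p α) : ℂ) ≠ 0 := by exact_mod_cast Fintype.card_ne_zero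
  have h2 : ((Fintype.card (G p α) : ℤ) : ℂ) = legendreSym p (-1) := by
    push_cast
    exact mul_right_cancel₀ h0 h1
  have h3 : (Fintype.card (G p α) : ℤ) = legendreSym p (-1) := by exact_mod_cast h2
  have h4 : 2 ≤ Fintype.card (G p α) := by
    rw [card_G]
    exact (Fact.out : p.Prime).two_le.trans (Nat.le_self_pow (by omega) p)
  rcases legendreSym_eq_one_or_neg_one (not_dvd_neg_one (p := p)) with h | h <;>
    rw [h] at h3 <;> omega

lemma mem_dual_iff (hp : p ≠ 2) (hD : IsGSHDS n₀ D) (χ : AddChar (G p α) ℂ) :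
    χ ∈ F.dual D ↔ sgnHat D χ = F.root := by
  classical
  have h1 : ∑ᶠ g ∈ D, χ g = ∑ g, (if g ∈ D then 1 else 0 : ℤ) * χ g := by
    rw [finsum_mem_eq_sum_of_inter_support_eq (t := Finset.univ.filter (· ∈ D)) _ (by simp),
      Finset.sum_filter]
    exact Finset.sum_congr rfl fun g _ => by split_ifs <;> simp
  have h2 := hD.sgnHat_eq (exponent_G p α) χ
  rw [dual, Set.mem_ofPred_eq, h1, ← root]
  by_cases hχ : χ = 1
  · subst hχ
    have h3 := hD.sgnHat_one (exponent_G p α)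
    rw [h3] at h2 ⊢
    simp only [AddChar.one_apply, Finset.sum_const, Finset.card_univ, nsmul_eq_mul, mul_one] at h2 ⊢
    refine iff_of_false (fun h => ?_) (root_ne_zero hp).symm
    rw [h] at h2
    exact F.root_ne_card hp (by linear_combination -h2)
  · rw [AddChar.sum_eq_zero_of_ne_one hχ] at h2
    rw [h2]
    constructor
    · intro h
      rw [h]
      ring
    · intro h
      linear_combination (1 / 2 : ℂ) * h

lemma sgnHat_eq_or (hp : p ≠ 2) (hD : IsGSHDS n₀ D) {χ : AddChar (G p α) ℂ} (hχ : χ ≠ 1) :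
    sgnHat D χ = F.root ∨ sgnHat D χ = -F.root :=
  sq_eq_sq_iff_eq_or_eq_neg.1 ((hD.sgnHat_sq hp (exponent_G p α) hχ).trans (F.root_sq hp).symm)

/-- The power n₀ is invertible on characters and negates the transform, n₀ being a nonresidue. -/
lemma mem_image_dual_iff (hp : p ≠ 2) (hD : IsGSHDS n₀ D) (χ : AddChar (G p α) ℂ) :
    χ ∈ (fun χ : AddChar (G p α) ℂ => χ ^ n₀) '' F.dual D ↔ sgnHat D χ = -F.root := by
  have hX := exponent_G p α
  have hn := hD.not_dvd hX
  have hl := hD.legendreSym_eq hp hX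
  constructor
  · rintro ⟨χ', h, rfl⟩
    rw [mem_dual_iff hp hD] at h
    rw [hD.sgnHat_zpow hp hX hn, hl, h]
    simp
  · intro h
    obtain ⟨m, hm⟩ := exists_inverse_sq hn
    have hmn : (χ ^ m) ^ n₀ = χ := by
      ext g
      rw [← zpow_mul, AddChar.zpow_apply, ← AddChar.map_zsmul_eq_zpow,
        zsmul_congr_of_exponent hX hm, one_zsmul]
    refine ⟨χ ^ m, ?_, hmn⟩
    rw [mem_dual_iff hp hD]
    have h1 := hD.sgnHat_zpow hp hX hn (χ ^ m)
    rw [hmn, hl, h] at h1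
    push_cast at h1
    linear_combination h1

variable (F) in
/-- The sign `±1` of a nontrivial character with respect to the dual of `D`. -/
def charSign (n₀ : ℤ) (D : Set (G p α)) (χ : AddChar (G p α) ℂ) : ℤ :=
  open Classical in (if χ ∈ F.dual D then 1 else 0) -
    (if χ ∈ (fun χ : AddChar (G p α) ℂ => χ ^ n₀) '' F.dual D then 1 else 0)

lemma sgnHat_eq_charSign (hp : p ≠ 2) (hD : IsGSHDS n₀ D) (χ : AddChar (G p α) ℂ) :
    sgnHat D χ = F.root * F.charSign n₀ D χ := by
  have h0 := F.root_ne_zero hp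
  have h1 : F.root ≠ -F.root := fun h => h0 (by linear_combination (1 / 2 : ℂ) * h)
  rw [charSign, mem_dual_iff hp hD, mem_image_dual_iff hp hD]
  by_cases hχ : χ = 1
  · rw [hχ, hD.sgnHat_one (exponent_G p α), if_neg h0.symm,
      if_neg (fun h => h0 (neg_eq_zero.1 h.symm))]
    simp
  · rcases sgnHat_eq_or (F := F) hp hD hχ with h | h <;> rw [h]
    · rw [if_pos rfl, if_neg h1]
      simp
    · rw [if_pos rfl, if_neg h1.symm]
      simp

lemma odd_charSign (hp : p ≠ 2) (hD : IsGSHDS n₀ D) {χ : AddChar (G p α) ℂ} (hχ : χ ≠ 1) :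
    Odd (F.charSign n₀ D χ) := by
  have h0 := F.root_ne_zero hp
  have h1 : F.root ≠ -F.root := fun h => h0 (by linear_combination (1 / 2 : ℂ) * h)
  rw [charSign, mem_dual_iff hp hD, mem_image_dual_iff hp hD]
  rcases sgnHat_eq_or (F := F) hp hD hχ with h | h <;> rw [h]
  · rw [if_pos rfl, if_neg h1]
    decide
  · rw [if_pos rfl, if_neg h1.symm]
    decide

variable (F) in
/-- The character `(a, h) ↦ θ(a) ψ(x h)` of `G`. -/
def extChar (x : F.GR) (θ : AddChar (ZMod p) ℂ) : AddChar (G p α) ℂ :=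
  θ.compAddMonoidHom (AddMonoidHom.fst _ _) *
    (F.ψ.mulShift x).compAddMonoidHom (F.κ.toAddMonoidHom.comp (AddMonoidHom.snd _ _))

lemma extChar_apply (x : F.GR) (θ : AddChar (ZMod p) ℂ) (g : G p α) :
    F.extChar x θ g = θ g.1 * F.ψ (x * F.κ g.2) := rfl

lemma extChar_injective (x : F.GR) : Function.Injective (F.extChar x) := by
  intro θ θ' h
  ext a
  have h1 := DFunLike.congr_fun h (a, 0)
  simpa [extChar_apply] using h1

lemma mem_fibre_iff (x : F.GR) (χ : AddChar (G p α) ℂ) :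
    χ ∈ F.fibre x ↔ ∃ θ, F.extChar x θ = χ := by
  constructor
  · intro h
    refine ⟨χ.compAddMonoidHom (AddMonoidHom.inl _ _), ?_⟩
    ext ⟨a, b⟩
    have h1 : ((a, b) : G p α) = (a, 0) + (0, b) := by simp
    conv_rhs => rw [h1, AddChar.map_add_eq_mul, h b]
    rfl
  · rintro ⟨θ, rfl⟩ b
    rw [extChar_apply, AddChar.map_zero_eq_one, one_mul]
    rfl

lemma sum_fibre {M : Type*} [AddCommMonoid M] (x : F.GR) [DecidablePred (· ∈ F.fibre x)]
    (Φ : AddChar (G p α) ℂ → M) : ∑ χ with χ ∈ F.fibre x, Φ χ = ∑ θ, Φ (F.extChar x θ) := by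
  classical
  rw [← Finset.sum_image (f := Φ) (s := Finset.univ) (g := F.extChar x)
    (fun _ _ _ _ h => extChar_injective x h)]
  refine Finset.sum_congr ?_ fun _ _ => rfl
  ext χ
  simp [mem_fibre_iff]

lemma ν_eq (x : F.GR) : F.ν n₀ D x = ∑ θ, F.charSign n₀ D (F.extChar x θ) := by
  classical
  have key : ∀ T : Set (AddChar (G p α) ℂ), ((T ∩ F.fibre x).ncard : ℤ) =
      ∑ χ with χ ∈ F.fibre x, if χ ∈ T then 1 else 0 := fun T => by
    rw [← Finset.sum_filter, Finset.sum_const, Finset.filter_filter, nsmul_eq_mul, mul_one,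
      ← Set.ncard_coe_finset]
    congr 2
    ext χ
    simp [and_comm]
  rw [← sum_fibre, ν, key, key, ← Finset.sum_sub_distrib]
  rfl

/-- Summing the transform over the p extensions of a character of H kills every g outside H, leaving
p times the transform on H. The same sum is `root` times ν. -/
lemma hat_e (hp : p ≠ 2) (hD : IsGSHDS n₀ D) (x : F.GR) :
    F.hat (fun x => (F.e D x : ℂ)) x = ((p ^ (2 * α) : ℤ) : ℂ) * F.gauss * F.ν n₀ D x := by
  classical
  have hp0 : (p : ℂ) ≠ 0 := by exact_mod_cast (Fact.out : p.Prime).ne_zero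
  have h1 : F.root * F.ν n₀ D x = ∑ θ, sgnHat D (F.extChar x θ) := by
    rw [ν_eq]
    push_cast
    rw [Finset.mul_sum]
    exact Finset.sum_congr rfl fun θ _ => (sgnHat_eq_charSign hp hD _).symm
  have h2 : ∑ θ, sgnHat D (F.extChar x θ) = p * F.hat (fun x => (F.e D x : ℂ)) x := by
    simp only [sgnHat, extChar_apply]
    rw [Finset.sum_comm, Fintype.sum_prod_type, Finset.sum_eq_single 0]
    · rw [hat, Finset.mul_sum, ← F.κ.toEquiv.sum_comp]
      refine Finset.sum_congr rfl fun b _ => ?_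
      have h3 : ∀ θ : AddChar (ZMod p) ℂ, (sgn D ((0 : ZMod p), b) : ℂ) * (θ 0 * F.ψ (x * F.κ b)) =
          sgn D ((0 : ZMod p), b) * F.ψ (x * F.κ b) := fun θ => by
        rw [AddChar.map_zero_eq_one, one_mul]
      simp_rw [h3]
      rw [Finset.sum_const, Finset.card_univ, AddChar.card_eq, ZMod.card, nsmul_eq_mul]
      simp only [AddEquiv.toEquiv_eq_coe, EquivLike.coe_coe, e, AddEquiv.symm_apply_apply]
      rw [mul_comm x]
    · intro a _ ha
      refine Finset.sum_eq_zero fun b _ => ?_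
      have h3 : ∀ θ : AddChar (ZMod p) ℂ, (sgn D (a, b) : ℂ) * (θ a * F.ψ (x * F.κ b)) =
          sgn D (a, b) * F.ψ (x * F.κ b) * θ a := fun θ => by ring
      simp_rw [h3]
      rw [← Finset.mul_sum, AddChar.sum_apply_eq_ite, if_neg ha, mul_zero]
    · exact fun h => absurd (Finset.mem_univ _) h
  apply mul_left_cancel₀ hp0
  rw [← h2, ← h1, root]
  push_cast
  ring

lemma ν_isHomogeneous (hp : p ≠ 2) (hD : IsGSHDS n₀ D) : F.IsHomogeneous (F.ν n₀ D) := by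
  intro n x hn
  have h1 := ((e_isHomogeneous (F := F) hp hD).intCast (M := ℂ)).hat n x hn
  rw [hat_e hp hD, hat_e hp hD] at h1
  have hp0 : (p : ℂ) ≠ 0 := by exact_mod_cast (Fact.out : p.Prime).ne_zero
  have h0 : ((p ^ (2 * α) : ℤ) : ℂ) * F.gauss ≠ 0 := by
    push_cast
    exact mul_ne_zero (pow_ne_zero _ hp0) (F.gauss_ne_zero hp)
  rw [mul_left_comm] at h1
  exact_mod_cast mul_left_cancel₀ h0 h1

/-- Fourier inversion of `hat_e`; the sign (-1/p) from e(-x) cancels the one in τ² = (-1/p) p. -/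
lemma hat_ν (hp : p ≠ 2) (hD : IsGSHDS n₀ D) (x : F.GR) :
    F.hat (fun x => (F.ν n₀ D x : ℂ)) x = ((p ^ (2 * α + 1) : ℤ) : ℂ) * F.gauss * F.e D x := by
  have hp0 : (p : ℂ) ≠ 0 := by exact_mod_cast (Fact.out : p.Prime).ne_zero
  have h0 : (p : ℂ) ^ (2 * α) * F.gauss ≠ 0 :=
    mul_ne_zero (pow_ne_zero _ hp0) (F.gauss_ne_zero hp)
  apply mul_left_cancel₀ h0
  have h1 := F.hat_hat (fun x => (F.e D x : ℂ)) x
  have h2 : F.hat (F.hat fun x => (F.e D x : ℂ)) x =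
      (p : ℂ) ^ (2 * α) * F.gauss * F.hat (fun x => (F.ν n₀ D x : ℂ)) x := by
    rw [hat, hat, Finset.mul_sum]
    refine Finset.sum_congr rfl fun y _ => ?_
    rw [hat_e hp hD]
    push_cast
    ring
  have h3 := e_isHomogeneous (F := F) hp hD (-1) x not_dvd_neg_one
  push_cast at h3
  rw [neg_one_mul] at h3
  rw [← h2, h1, h3]
  push_cast
  linear_combination (-(p ^ (4 * α + 1) * F.e D x : ℂ)) * F.gauss_sq hp

lemma odd_sum_of_odd {ι : Type*} {s : Finset ι} {f : ι → ℤ} (hs : Odd s.card)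
    (hf : ∀ i ∈ s, Odd (f i)) : Odd (∑ i ∈ s, f i) := by
  have h1 : Even (∑ i ∈ s, (f i - 1)) := by
    rw [even_iff_two_dvd]
    exact Finset.dvd_sum fun i hi => even_iff_two_dvd.1 ((hf i hi).sub_odd odd_one)
  have h2 : ∑ i ∈ s, f i = ∑ i ∈ s, (f i - 1) + s.card := by
    rw [Finset.sum_sub_distrib]
    simp
  rw [h2]
  exact h1.add_odd (by exact_mod_cast hs)

/-- For x ≠ 0 all p extensions are nontrivial, so ν is a sum of p odd numbers. -/
lemma odd_ν (hp : p ≠ 2) (hD : IsGSHDS n₀ D) {x : F.GR} (hx : x ≠ 0) : Odd (F.ν n₀ D x) := by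
  rw [ν_eq]
  refine odd_sum_of_odd ?_ fun θ _ => odd_charSign hp hD fun h => ?_
  · rw [Finset.card_univ, AddChar.card_eq, ZMod.card]
    exact odd_of_ne_two hp
  · apply F.ψ_isPrimitive hx
    ext y
    have h1 := DFunLike.congr_fun h (0, F.κ.symm y)
    simpa [extChar_apply] using h1

lemma odd_d (D : Set (G p α)) (x : F.GR) : Odd (F.d D x) := by
  classical
  rw [d]
  split_ifs <;> decide

end Frame

end GSHDS

end

/-! ### Intersection with L in the case α = 1. -/

noncomputable section

namespace GSHDS

section Construction

variable {X : Type*} [AddCommGroup X] [Fintype X]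

lemma powMap_ofFun {n m : ℤ} (hm : ∀ x : X, m • n • x = x) (f : X → ℤ) :
    powMap n (ofFun f) = ofFun fun x => f (m • x) := by
  have hinj : Function.Injective (fun x : X => n • x) := fun a b hab => by
    rw [← hm a, ← hm b]
    exact congrArg (m • ·) hab
  have hsurj := Finite.injective_iff_surjective.1 hinj
  ext x
  obtain ⟨x, rfl⟩ := hsurj x
  rw [powMap, AddMonoidAlgebra.mapDomain]
  refine (Finsupp.mapDomain_apply hinj _ x).trans ?_
  rw [coeff_ofFun, coeff_ofFun, hm]

lemma powMap_neg_one_ofFun (f : X → ℤ) : powMap (-1) (ofFun f) = ofFun fun x => f (-x) := by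
  rw [powMap_ofFun (m := -1) (fun x => by simp)]
  simp

open Classical in
lemma two_mul_indicator {D : Set X} (h0 : (0 : X) ∉ D) (g : X) :
    2 * (if g ∈ D then 1 else 0) = sgn D g + 1 - if g = 0 then 1 else 0 := by
  rw [sgn]
  by_cases h : g = 0
  · subst h
    simp [h0]
  · simp only [h, if_false]
    split_ifs <;> rfl

/-- A set whose sign function is skew and has constant autocorrelation is a generalized skew
Hadamard difference set. -/
lemma IsGSHDS.of_autocorrelation [Nontrivial X] {D : Set X} {n₀ m s : ℤ}
    (hunit : IsUnit (n₀ : ZMod (AddMonoid.exponent X)))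
    (hnon : ¬ IsSquare (n₀ : ZMod (AddMonoid.exponent X)))
    (hmn : ∀ x : X, m • n₀ • x = x) (hskew : ∀ x : X, sgn D (n₀ • x) = -sgn D x)
    (h0 : (0 : X) ∉ D) (hs : s * s = 1) (hneg : ∀ x : X, sgn D (-x) = s * sgn D x)
    (hac : ∀ k : X, k ≠ 0 → ∑ k', sgn D (k + k') * sgn D k' = -1) : IsGSHDS n₀ D := by
  classical
  have hnm : ∀ x : X, n₀ • m • x = x := fun x => by rw [smul_comm, hmn]
  have hskew' : ∀ x : X, sgn D (m • x) = -sgn D x := fun x => by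
    rw [← neg_neg (sgn D (m • x)), ← hskew, hnm]
  have hm0 : ∀ x : X, m • x = 0 ↔ x = 0 := fun x =>
    ⟨fun h => by rw [← hnm x, h, smul_zero], fun h => by rw [h, smul_zero]⟩
  have hsum : ∑ g : X, sgn D g = 0 := by
    have hinj : Function.Injective (fun x : X => n₀ • x) := fun a b hab => by
      rw [← hmn a, ← hmn b]
      exact congrArg (m • ·) hab
    have h1 := (Equiv.ofBijective _ (Finite.injective_iff_bijective.1 hinj)).sum_comp
      (fun g => sgn D g)
    simp only [Equiv.ofBijective_apply, hskew, Finset.sum_neg_distrib] at h1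
    omega
  -- Factoring out the inversion turns the product D(x) D(x^{n₀}) into a correlation sum.
  have hpow : powMap n₀ (ofSet D) = powMap (-1) (ofFun fun x => if m • (-x) ∈ D then 1 else 0) := by
    rw [ofSet, powMap_ofFun hmn, powMap_neg_one_ofFun]
    simp
  have hprod : ofSet D * powMap n₀ (ofSet D) = ofFun fun k => ∑ k', (if k + k' ∈ D then 1 else 0) *
      (if m • (-k') ∈ D then 1 else 0) := by
    rw [hpow, ofSet, ofFun_mul_powMap_neg_one]
  have hcoeff : ∀ k : X, k ≠ 0 → 4 * ∑ k' : X, ((if k + k' ∈ D then 1 else 0) *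
      (if m • (-k') ∈ D then 1 else 0) : ℤ) = s + Fintype.card X - 2 := by
    intro k hk
    -- Expand with 2·1_D = sgn + 1 - δ₀ in both factors; the corrections sit at k' = -k and k' = 0,
    -- which are different points.
    have h1 : ∀ k' : X, 4 * ((if k + k' ∈ D then 1 else 0) * (if m • (-k') ∈ D then 1 else 0) : ℤ) =
        -s * (sgn D (k + k') * sgn D k') + sgn D (k + k') - s * sgn D k' + 1
          - (if k' = -k then 1 - s * sgn D k' else 0)
          - (if k' = 0 then sgn D (k + k') + 1 else 0) := fun k' => by
      have h2 := two_mul_indicator h0 (k + k')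
      have h3 := two_mul_indicator h0 (m • (-k'))
      rw [hskew', hneg] at h3
      simp only [hm0, neg_eq_zero] at h3
      have h4 : k + k' = 0 ↔ k' = -k := ⟨eq_neg_of_add_eq_zero_right, fun h => by rw [h]; simp⟩
      simp only [h4] at h2
      have h5 : (if k' = -k then (1 : ℤ) else 0) * (if k' = 0 then 1 else 0) = 0 := by
        by_cases h : k' = 0
        · rw [if_neg, zero_mul]
          rw [h]
          exact fun h' => hk (neg_eq_zero.1 h'.symm)
        · rw [if_neg h, mul_zero]
      have h6 : (if k' = -k then (1 : ℤ) - s * sgn D k' else 0) =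
        (if k' = -k then 1 else 0) * (1 - s * sgn D k') := by split_ifs <;> simp
      have h7 : (if k' = 0 then sgn D (k + k') + 1 else 0) =
        (if k' = 0 then 1 else 0) * (sgn D (k + k') + 1) := by split_ifs <;> simp
      rw [h6, h7]
      generalize (if k' = -k then (1 : ℤ) else 0) = u at *
      generalize (if k' = 0 then (1 : ℤ) else 0) = v at *
      generalize (if k + k' ∈ D then (1 : ℤ) else 0) = a at *
      generalize (if m • (-k') ∈ D then (1 : ℤ) else 0) = b at *
      linear_combination (2 * b) * h2 + (sgn D (k + k') + 1 - u) * h3 + h5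
    have h8 : ∑ k' : X, sgn D (k + k') = 0 := by
      rw [← hsum]
      exact Equiv.sum_comp (Equiv.addLeft k) (fun g => sgn D g)
    rw [Finset.mul_sum]
    simp_rw [h1]
    simp only [Finset.sum_sub_distrib, Finset.sum_add_distrib, ← Finset.mul_sum, hac k hk, h8, hsum,
      Finset.sum_ite_eq', Finset.mem_univ, if_true, Finset.sum_const, Finset.card_univ,
      nsmul_eq_mul, hneg, add_zero]
    linear_combination (sgn D k) * hs
  refine ⟨hunit, hnon, ?_, ?_⟩
  -- λ is the coefficient at any nonzero point; the coefficient at 0 is k₀.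
  · obtain ⟨k₁, hk₁⟩ := exists_ne (0 : X)
    refine ⟨∑ k' : X, ((if k₁ + k' ∈ D then 1 else 0) * (if m • (-k') ∈ D then 1 else 0) : ℤ), ?_⟩
    have hk0 : ∑ k' : X, ((if 0 + k' ∈ D then 1 else 0) * (if m • (-k') ∈ D then 1 else 0) : ℤ) =
        ((D ∩ (fun g => (-n₀) • g) '' D).ncard : ℤ) := by
      have h1 : D ∩ (fun g => (-n₀) • g) '' D =
          (Finset.univ.filter fun k' => k' ∈ D ∧ m • (-k') ∈ D : Finset X) := by
        ext x
        simp only [Set.mem_inter_iff, Set.mem_image, Finset.coe_filter, Finset.mem_univ, true_and,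
          Set.mem_ofPred_eq]
        refine and_congr_right fun _ => ⟨?_, fun h => ⟨_, h, ?_⟩⟩
        · rintro ⟨g, hg, rfl⟩
          rwa [neg_smul, neg_neg, hmn]
        · rw [neg_smul, hnm, neg_neg]
      rw [h1, Set.ncard_coe_finset, Finset.card_filter]
      push_cast
      refine Finset.sum_congr rfl fun k' _ => ?_
      rw [zero_add]
      split_ifs <;> simp_all
    rw [hprod, ← hk0, ofSet_univ, one_eq_ofFun, ← ofFun_smul, ← ofFun_smul, ← ofFun_add]
    congr 1
    funext k
    by_cases hk : k = 0
    · subst hk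
      simp
    · rw [if_neg hk]
      have := hcoeff k hk
      have := hcoeff k₁ hk₁
      omega
  · have hpow' : powMap n₀ (ofSet D) = ofFun fun x => if m • x ∈ D then 1 else 0 := by
      rw [ofSet, powMap_ofFun hmn]
    rw [hpow', ofSet_univ, one_eq_ofFun, ofSet, ← ofFun_add, ← ofFun_sub]
    congr 1
    funext x
    have h1 := two_mul_indicator h0 x
    have h2 := two_mul_indicator h0 (m • x)
    rw [hskew'] at h2
    simp only [hm0] at h2
    omega

end Construction

lemma exponent_L (p α : ℕ) [Fact p.Prime] : AddMonoid.exponent (L p α) = p := by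
  have h1 : AddMonoid.exponent (L p α) ∣ p := by
    rw [AddMonoid.exponent_dvd_iff_forall_nsmul_eq_zero]
    intro y
    ext1
    rw [AddSubgroup.coe_nsmul, (nsmul_eq_zero_iff_mem_L _).2 y.2]
    rfl
  refine ((Nat.dvd_prime Fact.out).1 h1).resolve_left fun h => ?_
  rw [AddMonoid.exp_eq_one_iff] at h
  have h2 := card_L p α
  rw [Nat.card_eq_one_iff_unique.2 ⟨h, ⟨0⟩⟩] at h2
  have := Frame.two_le_card p α
  omega

namespace Frame

variable {p α : ℕ} [Fact p.Prime] {F : Frame p α} {n₀ : ℤ} {D : Set (G p α)}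

/-- The autocorrelation of a homogeneous function through its Fourier transform. -/
lemma sum_hat_sq_mul_ψ {f : F.GR → ℂ} (hf : F.IsHomogeneous f) (j : F.GR) :
    ∑ h, F.hat f h ^ 2 * F.ψ (h * j) =
      (p : ℂ) ^ (4 * α + 2) * legendreSym p (-1) * ∑ x, f x * f (x + j) := by
  classical
  simp only [hat, pow_two, Finset.sum_mul_sum]
  simp only [Finset.sum_mul]
  rw [Finset.sum_comm, Finset.mul_sum]
  refine Finset.sum_congr rfl fun x _ => ?_
  rw [Finset.sum_comm]
  have h1 : ∀ y h : F.GR, f x * F.ψ (x * h) * (f y * F.ψ (y * h)) * F.ψ (h * j) =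
      f x * f y * F.ψ (h * (x + y + j)) := fun y h => by
    rw [show h * (x + y + j) = x * h + y * h + h * j by ring, AddChar.map_add_eq_mul,
      AddChar.map_add_eq_mul]
    ring
  simp_rw [h1, ← Finset.mul_sum, F.sum_ψ_mul]
  rw [Finset.sum_eq_single (-(x + j))]
  · have h2 := hf (-1) (x + j) not_dvd_neg_one
    rw [Int.cast_neg, Int.cast_one, neg_one_mul] at h2
    rw [if_pos (by ring), h2]
    ring
  · intro y _ hy
    rw [if_neg, mul_zero]
    intro h
    exact hy (by linear_combination h)
  · exact fun h => absurd (Finset.mem_univ _) h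

variable (F) in
/-- The restriction of `e` to the maximal ideal, extended by zero. -/
def eL (D : Set (G p α)) (x : F.GR) : ℤ :=
  open Classical in if (p : F.GR) * x = 0 then F.e D x else 0

variable (F) in
/-- The Fourier transform of `eL`, up to the Gauss sum. -/
def w (D : Set (G p α)) (h : F.GR) : ℤ := ∑ l ∈ F.S, F.e D (p * l) * F.sym (p * l * h)

lemma eL_isHomogeneous (hp : p ≠ 2) (hD : IsGSHDS n₀ D) : F.IsHomogeneous (F.eL D) := by
  classical
  intro n x hn
  have h1 : (p : F.GR) * (n * x) = 0 ↔ (p : F.GR) * x = 0 := by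
    rw [mul_left_comm, (F.isUnit_intCast hn).mul_right_eq_zero]
  rw [eL, eL]
  simp only [h1]
  split_ifs
  · exact e_isHomogeneous hp hD n x hn
  · rw [mul_zero]

lemma p_mul_p_mul (x : F.GR) : (p : F.GR) * (p * x) = 0 := by
  linear_combination x * F.natCast_sq_eq_zero

lemma hat_eL (hp : p ≠ 2) (hD : IsGSHDS n₀ D) (h : F.GR) :
    F.hat (fun x => (F.eL D x : ℂ)) h = F.gauss * F.w D h := by
  classical
  rw [hat_eq hp (eL_isHomogeneous hp hD).intCast, w]
  congr 1
  have h1 : ∑ l ∈ F.S, ∑ y : L p α, (F.eL D (F.pt l y) : ℂ) * F.sym (F.pt l y * h) = 0 := by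
    refine Finset.sum_eq_zero fun l hl => Finset.sum_eq_zero fun y _ => ?_
    rw [eL, if_neg, Int.cast_zero, zero_mul]
    rw [p_mul_pt]
    exact p_mul_ne_zero (isUnit_of_mem hl)
  rw [h1, add_zero]
  push_cast
  refine Finset.sum_congr rfl fun l _ => ?_
  rw [eL, if_pos (p_mul_p_mul l)]

lemma w_of_p_mul_eq_zero (D : Set (G p α)) {h : F.GR} (hh : (p : F.GR) * h = 0) : F.w D h = 0 := by
  refine Finset.sum_eq_zero fun l _ => ?_
  rw [show (p : F.GR) * l * h = 0 by linear_combination l * hh, sym_zero, mul_zero]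

/-- By `hat_e`, w equals p^{2α} ν minus a sum over L of a function invariant under `P`, and both are
divisible by p. -/
lemma p_dvd_w (hp : p ≠ 2) (hα : 1 ≤ α) (hD : IsGSHDS n₀ D) (h : F.GR) : (p : ℤ) ∣ F.w D h := by
  have h1 := hat_e (F := F) hp hD h
  have he := e_isHomogeneous (F := F) hp hD
  rw [hat_eq hp he.intCast, mul_comm _ F.gauss, mul_assoc] at h1
  have h2 := mul_left_cancel₀ (F.gauss_ne_zero hp) h1
  have h3 : F.w D h + ∑ l ∈ F.S, ∑ y : L p α, F.e D (F.pt l y) * F.sym (F.pt l y * h) =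
      p ^ (2 * α) * F.ν n₀ D h := by
    rw [w]
    exact_mod_cast h2
  have hs : F.IsHomogeneous (fun x => F.sym (x * h)) := by
    intro n x hn
    dsimp only
    rw [mul_assoc, F.sym_isHomogeneous n _ hn]
  have h4 : (p : ℤ) ∣ ∑ l ∈ F.S, ∑ y : L p α, F.e D (F.pt l y) * F.sym (F.pt l y * h) := by
    refine Finset.dvd_sum fun l _ => ?_
    rw [F.sum_L_eq_sum_K]
    · exact Dvd.intro _ rfl
    · intro y z hz
      have h5 := hs.pt_add l y hz
      rw [he.pt_add l y hz, h5]
  rw [← dvd_add_left h4, h3]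
  exact (dvd_pow_self _ (by omega)).mul_right _

/-- Modulo 2 the signs e(pl) may be replaced by 1, which leaves ±`gaussRatio`; its square is a power
of p. -/
lemma odd_w (hp : p ≠ 2) {h : F.GR} (hh : (p : F.GR) * h ≠ 0) : Odd (F.w D h) := by
  obtain ⟨n, hn, l', hl', hnl⟩ := exists_rep hh
  have hn' := not_dvd_of_mem_Ico hn
  have h1 : ∑ l ∈ F.S, F.sym (p * l * h) = legendreSym p n * F.gaussRatio := by
    rw [← sum_sym_p_mul_mul hp hl', Finset.mul_sum]
    refine Finset.sum_congr rfl fun l _ => ?_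
    have h2 := F.sym_isHomogeneous n (p * (l * l')) hn'
    rw [Int.cast_id] at h2
    rw [← h2]
    congr 1
    push_cast
    linear_combination l * hnl
  have h3 : Odd F.gaussRatio := by
    have h4 : Odd (F.gaussRatio ^ 2) := by
      rw [gaussRatio_sq hp]
      exact Odd.pow (by exact_mod_cast odd_of_ne_two hp)
    exact (Int.odd_pow.1 h4).resolve_right two_ne_zero
  have h5 : Odd (∑ l ∈ F.S, F.sym (p * l * h)) := by
    rw [h1]
    refine Odd.mul ?_ h3
    rcases legendreSym_eq_one_or_neg_one hn' with h | h <;> rw [h] <;> decide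
  have h6 : F.w D h = ∑ l ∈ F.S, F.sym (p * l * h) +
      ∑ l ∈ F.S, (F.e D (p * l) - 1) * F.sym (p * l * h) := by
    rw [w, ← Finset.sum_add_distrib]
    exact Finset.sum_congr rfl fun l _ => by ring
  rw [h6]
  refine h5.add_even ?_
  rw [even_iff_two_dvd]
  refine Finset.dvd_sum fun l hl => Dvd.dvd.mul_right ?_ _
  rw [e_eq_d D (p_mul_ne_zero (isUnit_of_mem hl)), ← even_iff_two_dvd]
  exact (odd_d D _).sub_odd odd_one

lemma sum_nilpotent {M : Type*} [AddCommMonoid M] [DecidableEq F.GR] (φ : F.GR → M) :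
    ∑ x with (p : F.GR) * x = 0, φ x = ∑ y : L p α, φ (F.κ (y : H p α)) := by
  symm
  refine Finset.sum_bij (fun y _ => F.κ (y : H p α)) ?_ ?_ ?_ ?_
  · exact fun y _ => Finset.mem_filter.2 ⟨Finset.mem_univ _, F.p_mul_κ y⟩
  · exact fun y _ y' _ h => Subtype.ext (F.κ.injective h)
  · intro x hx
    obtain ⟨w, rfl⟩ := (F.p_mul_eq_zero_iff x).1 (Finset.mem_filter.1 hx).2
    exact ⟨F.toL w, Finset.mem_univ _, F.κ_toL w⟩
  · exact fun _ _ => rfl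

/-- `sum_hat_sq_mul_ψ` for `eL`, with the square of the Gauss sum divided out. -/
lemma sum_w_sq_mul_ψ (hp : p ≠ 2) (hD : IsGSHDS n₀ D) (j : F.GR) :
    p * ∑ h, (F.w D h : ℂ) ^ 2 * F.ψ (h * j) =
      (p : ℂ) ^ (4 * α + 2) * ∑ x, (F.eL D x : ℂ) * F.eL D (x + j) := by
  have h1 := sum_hat_sq_mul_ψ (eL_isHomogeneous (F := F) hp hD).intCast j
  simp_rw [hat_eL hp hD, mul_pow, F.gauss_sq hp] at h1
  simp_rw [mul_assoc] at h1
  rw [← Finset.mul_sum, ← Finset.mul_sum] at h1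
  have h6 := congrArg (Int.cast (R := ℂ)) (legendreSym_mul_self (not_dvd_neg_one (p := p)))
  push_cast at h6
  set A := ∑ h, (F.w D h : ℂ) ^ 2 * F.ψ (h * j)
  set B := ∑ x, (F.eL D x : ℂ) * F.eL D (x + j)
  linear_combination (legendreSym p (-1) : ℂ) * h1 + (p ^ (4 * α + 2) * B - p * A) * h6

lemma e_mul_self (D : Set (G p α)) {x : F.GR} (hx : x ≠ 0) : F.e D x * F.e D x = 1 := by
  classical
  rw [e_eq_d D hx, d]
  split_ifs <;> rfl

lemma sum_eL_mul_eL (D : Set (G p α)) (k : L p α) :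
    ∑ x, F.eL D x * F.eL D (x + F.κ (k : H p α)) =
      ∑ y : L p α, F.e D (F.κ (y : H p α)) * F.e D (F.κ ((y + k : L p α) : H p α)) := by
  classical
  rw [← sum_nilpotent (F := F) (fun x => F.e D x * F.e D (x + F.κ (k : H p α))) |>.trans
    (Finset.sum_congr rfl fun y _ => by rw [AddSubgroup.coe_add, map_add]), Finset.sum_filter]
  refine Finset.sum_congr rfl fun x _ => ?_
  by_cases h : (p : F.GR) * x = 0
  · rw [if_pos h, eL, if_pos h, eL, if_pos (by rw [mul_add, h, F.p_mul_κ, add_zero])]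
  · rw [if_neg h, eL, if_neg h, zero_mul]

lemma card_nilpotent [DecidableEq F.GR] :
    (Finset.univ.filter fun x : F.GR => (p : F.GR) * x = 0).card = p ^ (2 * α + 1) := by
  rw [Finset.card_eq_sum_ones, sum_nilpotent, ← Finset.card_eq_sum_ones, Finset.card_univ,
    ← Nat.card_eq_fintype_card, card_L]

end Frame

namespace Frame

variable {p : ℕ} [Fact p.Prime] {F : Frame p 1} {n₀ : ℤ} {D : Set (G p 1)}

/-- On units w is an odd multiple of p, so w² ≥ p². By Parseval the mean of w² over the units is
p^{2α} = p², so every inequality is an equality. -/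
lemma w_sq (hp : p ≠ 2) (hD : IsGSHDS n₀ D) {h : F.GR} (hh : (p : F.GR) * h ≠ 0) :
    F.w D h ^ 2 = p ^ 2 := by
  classical
  have hp0 : (p : ℤ) ≠ 0 := by exact_mod_cast (Fact.out : p.Prime).ne_zero
  have h1 := sum_w_sq_mul_ψ (F := F) hp hD 0
  simp_rw [mul_zero, AddChar.map_zero_eq_one, mul_one] at h1
  have h2 : (p : ℤ) * ∑ h, F.w D h ^ 2 = p ^ (4 * 1 + 2) * ∑ x, F.eL D x * F.eL D (x + 0) := by
    exact_mod_cast h1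
  have h3 := sum_eL_mul_eL (F := F) D 0
  rw [ZeroMemClass.coe_zero, map_zero] at h3
  rw [h3] at h2
  have h4 : ∑ y : L p 1, F.e D (F.κ (y : H p 1)) * F.e D (F.κ ((y + 0 : L p 1) : H p 1)) =
      p ^ 3 - 1 := by
    have h5 : ∀ y : L p 1, F.e D (F.κ (y : H p 1)) * F.e D (F.κ ((y + 0 : L p 1) : H p 1)) =
        1 - if y = 0 then 1 else 0 := fun y => by
      rw [add_zero]
      by_cases hy : y = 0
      · subst hy
        simp [e, sgn]
      · rw [if_neg hy, e_mul_self, sub_zero]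
        rw [Ne, map_eq_zero_iff _ F.κ.injective]
        exact fun h => hy (Subtype.ext h)
    simp_rw [h5]
    rw [Finset.sum_sub_distrib, Finset.sum_const, Finset.card_univ, ← Nat.card_eq_fintype_card,
      card_L, Finset.sum_ite_eq' Finset.univ (0 : L p 1)]
    simp
  rw [h4] at h2
  have h6 : ∑ h with (p : F.GR) * h ≠ 0, (F.w D h ^ 2 - (p : ℤ) ^ 2) = 0 := by
    have h7 : ∑ h with (p : F.GR) * h ≠ 0, F.w D h ^ 2 = ∑ h, F.w D h ^ 2 := by
      refine Finset.sum_subset (Finset.filter_subset _ _) fun h _ hf => ?_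
      rw [Finset.mem_filter, not_and, not_not] at hf
      rw [w_of_p_mul_eq_zero D (hf (Finset.mem_univ _)), zero_pow two_ne_zero]
    have h8 : (((Finset.univ.filter fun x : F.GR => (p : F.GR) * x ≠ 0).card : ℕ) : ℤ) =
        p ^ 6 - p ^ 3 := by
      have h9 := Finset.card_filter_add_card_filter_not (s := (Finset.univ : Finset F.GR))
        (fun x : F.GR => (p : F.GR) * x = 0)
      rw [card_nilpotent, Finset.card_univ, F.card_GR] at h9
      have h10 := congrArg (Nat.cast (R := ℤ)) h9
      push_cast at h10
      linear_combination h10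
    rw [Finset.sum_sub_distrib, h7, Finset.sum_const, nsmul_eq_mul, h8]
    apply mul_left_cancel₀ hp0
    linear_combination h2
  have h11 : ∀ h ∈ Finset.univ.filter (fun x : F.GR => (p : F.GR) * x ≠ 0),
      0 ≤ F.w D h ^ 2 - (p : ℤ) ^ 2 := by
    intro h hf
    obtain ⟨c, hc⟩ := p_dvd_w hp le_rfl hD h
    have hodd := odd_w (D := D) hp (Finset.mem_filter.1 hf).2
    have hc0 : c ≠ 0 := by
      rintro rfl
      rw [hc, mul_zero] at hodd
      exact absurd hodd (by decide)
    have hc1 : 0 < c ^ 2 := by positivity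
    rw [hc, mul_pow]
    nlinarith [sq_nonneg (p : ℤ)]
  have h12 := (Finset.sum_eq_zero_iff_of_nonneg h11).1 h6 h
    (Finset.mem_filter.2 ⟨Finset.mem_univ _, hh⟩)
  exact sub_eq_zero.1 h12

/-- Now w² is p² times the indicator of the units. Its transform at nilpotent j ≠ 0 is -p² p³, since
ψ(h j) sums to 0 over the ring and to p³ over the nonunits. -/
lemma autocorrelation_eL (hp : p ≠ 2) (hD : IsGSHDS n₀ D) {j : F.GR} (hj : (p : F.GR) * j = 0)
    (hj0 : j ≠ 0) : ∑ x, F.eL D x * F.eL D (x + j) = -1 := by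
  classical
  have hp0 : (p : ℂ) ≠ 0 := by exact_mod_cast (Fact.out : p.Prime).ne_zero
  have h1 := sum_w_sq_mul_ψ (F := F) hp hD j
  have h2 : ∑ h, (F.w D h : ℂ) ^ 2 * F.ψ (h * j) =
      p ^ 2 * ∑ h with ¬ (p : F.GR) * h = 0, F.ψ (h * j) := by
    rw [Finset.mul_sum, Finset.sum_filter]
    refine Finset.sum_congr rfl fun h _ => ?_
    by_cases hh : (p : F.GR) * h = 0
    · rw [if_neg (not_not.2 hh), w_of_p_mul_eq_zero D hh]
      simp
    · rw [if_pos hh]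
      congr 1
      exact_mod_cast w_sq hp hD hh
  have h3 : ∑ h with (p : F.GR) * h = 0, F.ψ (h * j) = p ^ 3 := by
    have h4 : ∀ h ∈ Finset.univ.filter (fun h : F.GR => (p : F.GR) * h = 0), F.ψ (h * j) = 1 := by
      intro h hf
      obtain ⟨v, rfl⟩ := (F.p_mul_eq_zero_iff h).1 (Finset.mem_filter.1 hf).2
      rw [mul_right_comm, hj, zero_mul, AddChar.map_zero_eq_one]
    rw [Finset.sum_congr rfl h4, Finset.sum_const, card_nilpotent, nsmul_eq_mul]
    push_cast
    ring
  have h5 := Finset.sum_filter_add_sum_filter_not Finset.univ (fun h : F.GR => (p : F.GR) * h = 0)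
    (fun h => F.ψ (h * j))
  rw [h3, F.sum_ψ_mul, if_neg hj0] at h5
  rw [h2] at h1
  have h6 : ∑ x, (F.eL D x : ℂ) * F.eL D (x + j) = -1 := by
    apply mul_left_cancel₀ (pow_ne_zero 6 hp0)
    linear_combination (-1 : ℂ) * h1 + (p ^ 3 : ℂ) * h5
  exact_mod_cast h6

/-- The intersection with `L` of a generalized skew Hadamard difference set is one, for
`α = 1`. -/
lemma isGSHDS_L (F : Frame p 1) (hp : p ≠ 2) (hD : IsGSHDS n₀ D) :
    IsGSHDS n₀ {y : L p 1 | ((0 : ZMod p), (y : H p 1)) ∈ D} := by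
  classical
  have hX := exponent_G p 1
  have hn := hD.not_dvd hX
  set DL : Set (L p 1) := {y : L p 1 | ((0 : ZMod p), (y : H p 1)) ∈ D} with hDL
  have hsgn : ∀ y : L p 1, sgn DL y = sgn D ((0 : ZMod p), (y : H p 1)) := fun y => by
    have h1 : (((0 : ZMod p), (y : H p 1)) : G p 1) = 0 ↔ y = 0 := by
      rw [Prod.mk_eq_zero, and_iff_right rfl]
      exact ZeroMemClass.coe_eq_zero
    rw [sgn, sgn]
    by_cases h : y = 0
    · rw [if_pos h, if_pos (h1.2 h)]
    · rw [if_neg h, if_neg fun h' => h (h1.1 h')]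
      rfl
  have hsmul : ∀ (n : ℤ) (y : L p 1), ¬ (p : ℤ) ∣ n → sgn DL (n • y) = legendreSym p n * sgn DL y := by
    intro n y hn
    rw [hsgn, hsgn, ← hD.sgn_zsmul hp hX hn, Prod.smul_mk, smul_zero, AddSubgroup.coe_zsmul]
  have : Nontrivial (L p 1) := by
    rw [← Finite.one_lt_card_iff_nontrivial, card_L]
    exact two_le_card p 1
  obtain ⟨m, hm⟩ := exists_inverse_sq hn
  refine IsGSHDS.of_autocorrelation (m := m) (s := legendreSym p (-1)) ?_ ?_ ?_ ?_ ?_ ?_ ?_ ?_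
  · rw [exponent_L, isUnit_iff_ne_zero, Ne, ZMod.intCast_zmod_eq_zero_iff_dvd]
    exact hn
  · rw [exponent_L]
    exact (legendreSym.eq_neg_one_iff p).1 (hD.legendreSym_eq hp hX)
  · intro y
    have h1 : ∀ h : H p 1, m • n₀ • h = h := fun h => by
      have h2 := zsmul_congr_of_exponent hX hm ((0 : ZMod p), h)
      rw [one_zsmul, mul_smul] at h2
      exact congrArg Prod.snd h2
    exact Subtype.ext (h1 y)
  · intro y
    rw [hsmul _ _ hn, hD.legendreSym_eq hp hX, neg_one_mul]
  · exact hD.zero_notMem hX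
  · exact legendreSym_mul_self not_dvd_neg_one
  · intro y
    rw [← hsmul _ _ not_dvd_neg_one, neg_one_zsmul]
  · intro k hk
    have h1 := autocorrelation_eL (F := F) hp hD (F.p_mul_κ k) (by
      rw [Ne, map_eq_zero_iff _ F.κ.injective]
      exact fun h => hk (Subtype.ext h))
    rw [sum_eL_mul_eL] at h1
    rw [← h1]
    refine Finset.sum_congr rfl fun y _ => ?_
    rw [hsgn, hsgn, e, e, AddEquiv.symm_apply_apply, AddEquiv.symm_apply_apply, mul_comm,
      add_comm k]

end Frame

end GSHDS

end

/-! ### Existence of the auxiliary choices, and the structure of K. -/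

noncomputable section

namespace GSHDS

section Existence

open Polynomial

lemma exists_monic_irreducible (p n : ℕ) [Fact p.Prime] (hn : n ≠ 0) :
    ∃ g : (ZMod p)[X], g.Monic ∧ g.natDegree = n ∧ Irreducible g := by
  obtain ⟨a, ha⟩ := Field.exists_primitive_element (ZMod p) (GaloisField p n)
  have hai : IsIntegral (ZMod p) a := Algebra.IsIntegral.isIntegral a
  refine ⟨minpoly (ZMod p) a, minpoly.monic hai, ?_, minpoly.irreducible hai⟩
  rw [(Field.primitive_element_iff_minpoly_natDegree_eq (ZMod p) a).1 ha, GaloisField.finrank p hn]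

lemma exists_monic_irreducible_mod (p n : ℕ) [Fact p.Prime] (hn : n ≠ 0) :
    ∃ f : (ZMod (p ^ 2))[X], f.Monic ∧ f.natDegree = n ∧ Irreducible (f.map (redCoeff p)) := by
  obtain ⟨g, hg, hd, hirr⟩ := exists_monic_irreducible p n hn
  have hl : g ∈ lifts (redCoeff p) := by
    obtain ⟨f, rfl⟩ := Polynomial.map_surjective (redCoeff p) (ZMod.castHom_surjective _) g
    exact ⟨f, rfl⟩
  obtain ⟨f, hf, hfd, hfm⟩ := lifts_and_natDegree_eq_and_monic hl hg
  exact ⟨f, hfm, hfd.trans hd, by rwa [hf]⟩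

variable {p α : ℕ} [Fact p.Prime] {f : (ZMod (p ^ 2))[X]}

lemma natCast_sq_adjoinRoot (f : (ZMod (p ^ 2))[X]) : (p : AdjoinRoot f) ^ 2 = 0 := by
  have : ((p ^ 2 : ℕ) : AdjoinRoot f) =
      algebraMap (ZMod (p ^ 2)) (AdjoinRoot f) ((p ^ 2 : ℕ) : ZMod (p ^ 2)) := by
    rw [map_natCast]
  rw [← Nat.cast_pow, this, ZMod.natCast_self, map_zero]

lemma p_mul_eq_of_red_eq {a b : AdjoinRoot f} (h : red f a = red f b) :
    (p : AdjoinRoot f) * a = p * b := by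
  obtain ⟨w, hw⟩ := (red_eq_zero_iff (a - b)).1 (by rw [map_sub, h, sub_self])
  linear_combination (p : AdjoinRoot f) * hw + w * natCast_sq_adjoinRoot f

lemma card_residueField (hf : f.Monic) (hd : f.natDegree = 2 * α + 1) :
    Nat.card (AdjoinRoot (f.map (redCoeff p))) = p ^ (2 * α + 1) := by
  have b := (AdjoinRoot.powerBasis' (hf.map (redCoeff p))).basis
  rw [Nat.card_congr b.equivFun.toEquiv, Nat.card_fun, Nat.card_zmod, Nat.card_eq_fintype_card,
    Fintype.card_fin, AdjoinRoot.powerBasis'_dim, hf.natDegree_map, hd]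

/-- Take z^q for any lift z: it has the same reduction, and z^{q-1} ≡ 1 mod p gives (z^{q-1})^q = 1
modulo p². -/
lemma exists_teichmuller (hf : f.Monic) (hd : f.natDegree = 2 * α + 1)
    (hirr : Irreducible (f.map (redCoeff p))) {s : AdjoinRoot (f.map (redCoeff p))} (hs : s ≠ 0) :
    ∃ t : AdjoinRoot f, t ^ (p ^ (2 * α + 1) - 1) = 1 ∧ red f t = s := by
  have : Fact (Irreducible (f.map (redCoeff p))) := ⟨hirr⟩
  have hcard := card_residueField (p := p) hf hd
  have : Finite (AdjoinRoot (f.map (redCoeff p))) :=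
    Nat.finite_of_card_ne_zero (by rw [hcard]; exact pow_ne_zero _ (Fact.out : p.Prime).ne_zero)
  have : Fintype (AdjoinRoot (f.map (redCoeff p))) := Fintype.ofFinite _
  rw [Nat.card_eq_fintype_card] at hcard
  obtain ⟨z, rfl⟩ := red_surjective s
  refine ⟨z ^ p ^ (2 * α + 1), ?_, by rw [map_pow, ← hcard, FiniteField.pow_card]⟩
  have h1 : red f (z ^ (p ^ (2 * α + 1) - 1) - 1) = 0 := by
    rw [map_sub, map_pow, map_one, ← hcard, FiniteField.pow_card_sub_one_eq_one _ hs, sub_self]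
  obtain ⟨w, hw⟩ := (red_eq_zero_iff _).1 h1
  obtain ⟨v, hv⟩ := dvd_sub_pow_of_dvd_sub (p := p) (Dvd.intro w hw.symm) (2 * α + 1)
  rw [show 2 * α + 1 + 1 = 2 + 2 * α by ring, pow_add (p : AdjoinRoot f), natCast_sq_adjoinRoot,
    zero_mul, zero_mul, one_pow, sub_eq_zero] at hv
  rw [← pow_mul, mul_comm, pow_mul, hv]

/-- Every class of `p R` is an integer multiple of `p t²` with `t` a Teichmüller unit. -/
lemma exists_intCast_mul_sq (hp : p ≠ 2) (hf : f.Monic) (hd : f.natDegree = 2 * α + 1)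
    (hirr : Irreducible (f.map (redCoeff p))) {z : AdjoinRoot f} (hz : (p : AdjoinRoot f) * z ≠ 0) :
    ∃ (n : ℤ) (t : AdjoinRoot f), t ^ (p ^ (2 * α + 1) - 1) = 1 ∧
      (p : AdjoinRoot f) * z = n * (p * t ^ 2) := by
  classical
  have : Fact (Irreducible (f.map (redCoeff p))) := ⟨hirr⟩
  have hcard := card_residueField (p := p) hf hd
  have : Finite (AdjoinRoot (f.map (redCoeff p))) :=
    Nat.finite_of_card_ne_zero (by rw [hcard]; exact pow_ne_zero _ (Fact.out : p.Prime).ne_zero)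
  have : Fintype (AdjoinRoot (f.map (redCoeff p))) := Fintype.ofFinite _
  rw [Nat.card_eq_fintype_card] at hcard
  have hz0 : red f z ≠ 0 := by
    intro h
    obtain ⟨w, rfl⟩ := (red_eq_zero_iff z).1 h
    exact hz (by linear_combination w * natCast_sq_adjoinRoot f)
  suffices h : ∃ (n : ℤ) (s : AdjoinRoot (f.map (redCoeff p))), red f z = n * s ^ 2 by
    obtain ⟨n, s, hns⟩ := h
    have hs : s ≠ 0 := by
      rintro rfl
      exact hz0 (by rw [hns]; ring)
    obtain ⟨t, ht, rfl⟩ := exists_teichmuller hf hd hirr hs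
    refine ⟨n, t, ht, ?_⟩
    rw [p_mul_eq_of_red_eq (a := z) (b := n * t ^ 2) (by rw [hns, map_mul, map_intCast, map_pow])]
    ring
  by_cases hsq : IsSquare (red f z)
  · obtain ⟨s, hs⟩ := hsq
    exact ⟨1, s, by rw [hs, Int.cast_one]; ring⟩
  obtain ⟨a, ha⟩ := quadraticChar_exists_neg_one' (F := ZMod p) (by rwa [ZMod.ringChar_zmod_n])
  have hchar : ringChar (AdjoinRoot (f.map (redCoeff p))) ≠ 2 := by
    rwa [← Algebra.ringChar_eq (ZMod p), ZMod.ringChar_zmod_n]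
  -- A nonresidue of 𝔽_p stays a nonsquare in the residue field because the degree is odd;
  -- multiplying by it makes a nonsquare class a square.
  have ha' : quadraticChar (AdjoinRoot (f.map (redCoeff p))) (algebraMap (ZMod p) _ a) = -1 := by
    have hne : algebraMap (ZMod p) (AdjoinRoot (f.map (redCoeff p))) a ≠ 0 := by
      rw [Ne, map_eq_zero]
      exact a.ne_zero
    rw [quadraticChar_neg_one_iff_not_isSquare, FiniteField.isSquare_iff hchar hne, hcard]
    obtain ⟨j, hj, hpj⟩ := exists_odd_pow_eq (odd_of_ne_two hp) α
    obtain ⟨r, hr⟩ := odd_of_ne_two hp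
    have h2 : p ^ (2 * α + 1) / 2 = p / 2 * j := by
      rw [hpj, hr, Nat.add_sub_cancel, show (2 * r + 1) / 2 = r by omega, mul_assoc]
      omega
    have h3 := quadraticChar_eq_pow_of_char_ne_two' (F := ZMod p)
      (by rwa [ZMod.ringChar_zmod_n]) (a : ZMod p)
    rw [ha, ZMod.card] at h3
    rw [h2, ← map_pow, pow_mul, ← h3, Int.cast_neg, Int.cast_one, hj.neg_one_pow, map_neg, map_one]
    exact Ring.neg_one_ne_one_of_char_ne_two hchar
  have hz' := quadraticChar_neg_one_iff_not_isSquare.2 hsq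
  obtain ⟨s, hs⟩ := (quadraticChar_one_iff_isSquare (a := algebraMap (ZMod p) _ a * red f z)
    (mul_ne_zero (by rw [Ne, map_eq_zero]; exact a.ne_zero) hz0)).1 (by rw [map_mul, ha', hz']; rfl)
  obtain ⟨n, hn⟩ := ZMod.intCast_surjective ((a⁻¹ : (ZMod p)ˣ) : ZMod p)
  refine ⟨n, s, ?_⟩
  have h5 : (n : AdjoinRoot (f.map (redCoeff p))) =
      algebraMap (ZMod p) _ ((a⁻¹ : (ZMod p)ˣ) : ZMod p) := by rw [← hn, map_intCast]
  rw [pow_two s, ← hs, h5, ← mul_assoc, ← map_mul, Units.inv_mul, map_one, one_mul]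

/-- A set of representatives for the orbits of `(ℤ/p)ˣ` on the nonzero elements of `p R`. -/
lemma exists_representatives [Finite (AdjoinRoot f)] {T : Set (AdjoinRoot f)}
    (hT : ∀ z : AdjoinRoot f, (p : AdjoinRoot f) * z ≠ 0 →
      ∃ (n : ℤ), ∃ l ∈ T, (p : AdjoinRoot f) * z = n * (p * l)) :
    ∃ S : Finset (AdjoinRoot f), (∀ l ∈ S, l ∈ T) ∧ ∀ z : AdjoinRoot f, (p : AdjoinRoot f) * z ≠ 0 →
      ∃! l, l ∈ S ∧ ∃ n : ℤ, (p : AdjoinRoot f) * z = n * (p * l) := by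
  classical
  let C : AdjoinRoot f → Set (AdjoinRoot f) := fun z =>
    {l | l ∈ T ∧ ∃ n : ℤ, (p : AdjoinRoot f) * z = n * (p * l)}
  have hC : ∀ z : AdjoinRoot f, (p : AdjoinRoot f) * z ≠ 0 → (C z).Nonempty := fun z hz => by
    obtain ⟨n, l, hl, h⟩ := hT z hz
    exact ⟨l, hl, n, h⟩
  have hCC : ∀ z l : AdjoinRoot f, (p : AdjoinRoot f) * z ≠ 0 →
      (∃ n : ℤ, (p : AdjoinRoot f) * z = n * (p * l)) → C z = C l := by
    rintro z l hz ⟨n, hn⟩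
    have hpn : ¬ (p : ℤ) ∣ n := by
      rintro ⟨c, rfl⟩
      apply hz
      rw [hn]
      push_cast
      linear_combination (c * l) * natCast_sq_adjoinRoot f
    obtain ⟨m, v, hm⟩ := exists_inverse_sq hpn
    have hm' : (m : AdjoinRoot f) * n - 1 = 0 := by
      have := congrArg (Int.cast (R := AdjoinRoot f)) hm
      push_cast at this
      rw [this, natCast_sq_adjoinRoot, zero_mul]
    ext l₂
    refine and_congr_right fun _ => ⟨?_, ?_⟩
    · rintro ⟨n₂, h₂⟩
      refine ⟨m * n₂, ?_⟩
      push_cast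
      linear_combination (-(p * l)) * hm' + (m : AdjoinRoot f) * (h₂ - hn)
    · rintro ⟨n₂, h₂⟩
      refine ⟨n * n₂, ?_⟩
      push_cast
      linear_combination hn + (n : AdjoinRoot f) * h₂
  -- The choice is a function of the set `C z`, not of z; since `C` is constant on orbits, each
  -- orbit receives a single representative.
  let rep : Set (AdjoinRoot f) → AdjoinRoot f := fun A => if h : A.Nonempty then h.choose else 0
  have hrep : ∀ A : Set (AdjoinRoot f), A.Nonempty → rep A ∈ A := fun A h => by
    simp only [rep, dif_pos h]
    exact h.choose_spec
  let S₀ : Set (AdjoinRoot f) := {l | ∃ z : AdjoinRoot f, (p : AdjoinRoot f) * z ≠ 0 ∧ l = rep (C z)}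
  refine ⟨S₀.toFinite.toFinset, ?_, ?_⟩
  · intro l hl
    obtain ⟨z, hz, rfl⟩ := (Set.Finite.mem_toFinset _).1 hl
    exact (hrep _ (hC z hz)).1
  · intro z hz
    refine ⟨rep (C z), ⟨(Set.Finite.mem_toFinset _).2 ⟨z, hz, rfl⟩, (hrep _ (hC z hz)).2⟩, ?_⟩
    rintro l ⟨hl, hn⟩
    obtain ⟨z', hz', rfl⟩ := (Set.Finite.mem_toFinset _).1 hl
    rw [hCC z _ hz hn, ← hCC z' _ hz' (hrep _ (hC z' hz')).2]

lemma nonempty_frame (hp : p ≠ 2) (α : ℕ) : Nonempty (Frame p α) := by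
  obtain ⟨f, hf, hd, hirr⟩ := exists_monic_irreducible_mod p (2 * α + 1) (by omega)
  let κ : H p α ≃+ AdjoinRoot f :=
    ((AdjoinRoot.powerBasis' hf).basis.reindex (finCongr hd)).equivFun.symm.toAddEquiv
  have : Finite (AdjoinRoot f) := Finite.of_equiv _ κ.toEquiv
  obtain ⟨S, hS, hrep⟩ := exists_representatives (p := p) (f := f)
    (T := {l | ∃ t : AdjoinRoot f, t ^ (p ^ (2 * α + 1) - 1) = 1 ∧ l = t ^ 2}) (fun z hz => by
      obtain ⟨n, t, ht, h⟩ := exists_intCast_mul_sq hp hf hd hirr hz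
      exact ⟨n, t ^ 2, ⟨t, ht, rfl⟩, h⟩)
  exact ⟨{
    f := f
    monic := hf
    natDegree_eq := hd
    irreducible_mod := hirr
    κ := κ
    ζ := Complex.exp (2 * Real.pi * Complex.I / (p ^ 2 : ℕ))
    primitive := Complex.isPrimitiveRoot_exp (p ^ 2)
      (pow_ne_zero 2 (Fact.out : p.Prime).ne_zero)
    S := S
    square_teichmuller := hS
    represent := hrep }⟩

end Existence

lemma nonempty_addEquiv_of_card {p n : ℕ} [Fact p.Prime] {V : Type*} [AddCommGroup V] [Finite V]
    [Module (ZMod p) V] (h : Nat.card V = p ^ n) : Nonempty (V ≃+ (Fin n → ZMod p)) := by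
  have h1 := Module.natCard_eq_pow_finrank (K := ZMod p) (V := V)
  rw [h, Nat.card_zmod] at h1
  have h2 : Module.finrank (ZMod p) V = Module.finrank (ZMod p) (Fin n → ZMod p) := by
    rw [Module.finrank_fintype_fun_eq_card, Fintype.card_fin]
    exact (Nat.pow_right_injective (Fact.out : p.Prime).two_le h1).symm
  exact ⟨(LinearEquiv.ofFinrankEq V (Fin n → ZMod p) h2).toAddEquiv⟩

namespace Frame

variable {p α : ℕ} [Fact p.Prime] (F : Frame p α)

lemma nonempty_K_equiv : Nonempty (F.K ≃+ (Fin (2 * α) → ZMod p)) := by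
  have h : ∀ k : F.K, p • k = 0 := by
    intro k
    induction k using QuotientAddGroup.induction_on with
    | H y =>
      have hy : p • y = 0 := by
        ext1
        rw [AddSubgroup.coe_nsmul, (nsmul_eq_zero_iff_mem_L _).2 y.2]
        rfl
      rw [← QuotientAddGroup.mk_nsmul, hy, QuotientAddGroup.mk_zero]
  let _ : Module (ZMod p) F.K := AddCommGroup.zmodModule h
  exact nonempty_addEquiv_of_card F.card_K

end Frame

end GSHDS

end

/-! ### Assembly of the theorem. -/

open GSHDS in
theorem mainTheorem1 (p : ℕ) [Fact p.Prime] (hp : p ≠ 2) (α : ℕ) (hα : 1 ≤ α) :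
    Nonempty (Frame p α) ∧
    ∀ F : Frame p α,
      Nonempty (F.K ≃+ (Fin (2 * α) → ZMod p)) ∧
      F.L₀ * powMap (-1) F.L₀ =
        (p ^ (4 * α - 1) : ℤ) • (1 : AddMonoidAlgebra ℤ F.K)
          - (p ^ (2 * α - 1) : ℤ) • ofSet (Set.univ : Set F.K) ∧
      ∃ ε₀ : ℤ, (ε₀ = 1 ∨ ε₀ = -1) ∧
        ∀ (n₀ : ℤ) (D : Set (G p α)), IsGSHDS n₀ D →
          (α = 1 → IsGSHDS n₀ {y : L p α | ((0 : ZMod p), (y : H p α)) ∈ D}) ∧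
          (p ^ (2 * α) : ℤ) • F.A D =
            principal (F.A D) • ofSet (Set.univ : Set F.K)
              + F.L₀ * powMap (-1) (F.B n₀ D) ∧
          principal (F.A D) = p ^ (α - 1) * ε₀ * F.b₀ n₀ D ∧
          (p ^ (2 * α) : ℤ) • F.B n₀ D =
            principal (F.B n₀ D) • ofSet (Set.univ : Set F.K)
              + (p : ℤ) • (F.L₀ * powMap (-1) (F.A D)) ∧
          principal (F.B n₀ D) = p ^ α * ε₀ * F.a₀ D ∧
          Odd (F.a₀ D) ∧ Odd (F.b₀ n₀ D) ∧
          (∀ k : F.K, Odd ((F.A D).coeff k)) ∧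
          (∀ k : F.K, Odd ((F.B n₀ D).coeff k)) := by
  refine ⟨nonempty_frame hp α, fun F => ⟨F.nonempty_K_equiv, F.L₀_mul_powMap hp hα, ?_⟩⟩
  obtain ⟨ε₀, hε, hc⟩ := F.exists_sign hp
  refine ⟨ε₀, hε, fun n₀ D hD => ?_⟩
  have hp0 : (p : ℤ) ≠ 0 := by exact_mod_cast (Fact.out : p.Prime).ne_zero
  have hB : F.B n₀ D = F.collect (F.ν n₀ D) := rfl
  have hb : F.b₀ n₀ D = ∑ l ∈ F.S, F.ν n₀ D (p * l) := rfl
  have hA := F.A_eq_collect D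
  have ha := F.a₀_eq D
  have pB : principal (F.B n₀ D) = p ^ α * ε₀ * F.a₀ D := by
    have h := Frame.principal_collect hp hα (Frame.e_isHomogeneous hp hD) _ (Frame.hat_e (F := F) hp hD)
    rw [← hB, ← ha, hc] at h
    exact mul_left_cancel₀ (pow_ne_zero _ hp0) h
  -- `hat_ν` carries one more p than `hat_e`; that factor is kept here and cancelled below, where α
  -- ≥ 1 permits the exponent α - 1.
  have pA : (p : ℤ) * principal (F.A D) = p ^ α * ε₀ * F.b₀ n₀ D := by
    have h := Frame.principal_collect hp hα (Frame.ν_isHomogeneous hp hD) _ (Frame.hat_ν (F := F) hp hD)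
    rw [← hA, ← hb, hc] at h
    refine mul_left_cancel₀ (pow_ne_zero (2 * α) hp0) ?_
    rw [← h]
    ring
  refine ⟨?_, ?_, ?_, ?_, pB, ?_, ?_, ?_, ?_⟩
  · rintro rfl
    exact F.isGSHDS_L hp hD
  · have h := Frame.smul_collect_eq hp (Frame.ν_isHomogeneous hp hD) _ (Frame.hat_ν (F := F) hp hD)
    rw [← hA, ← hb, hc, ← hB, ← pA, pow_succ' (p : ℤ) (2 * α), mul_smul, mul_smul, ← smul_add] at h
    exact smul_right_injective _ hp0 h
  · refine mul_left_cancel₀ hp0 (pA.trans ?_)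
    nth_rewrite 1 [show α = α - 1 + 1 by omega]
    ring
  · have h := Frame.smul_collect_eq hp (Frame.e_isHomogeneous hp hD) _ (Frame.hat_e (F := F) hp hD)
    rwa [← hA, ← ha, hc, ← hB, ← pB] at h
  · exact Frame.odd_sum_of_odd (Frame.odd_card_S hp) fun l _ => Frame.odd_d D _
  · exact Frame.odd_sum_of_odd (Frame.odd_card_S hp) fun l hl =>
      Frame.odd_ν hp hD (Frame.p_mul_ne_zero (Frame.isUnit_of_mem hl))
  · exact fun k => Frame.odd_sum_of_odd (Frame.odd_card_S hp) fun l _ => Frame.odd_d D _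
  · exact fun k => Frame.odd_sum_of_odd (Frame.odd_card_S hp) fun l hl =>
      Frame.odd_ν hp hD (Frame.pt_ne_zero hl _)
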